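/- Let $\mathbb T=\mathbb R/2\pi\mathbb Z$ with Lebesgue measure (total mass $2\pi$), and let $\mathcal D'$ be the space of distributions on $\mathbb T$. For $\delta\in[0,1)$ let $$\mathcal I=\mathcal I^\delta=\big\{[2\pi(2^{-k}m+\delta),\,2\pi(2^{-k}(m+1)+\delta)) : k\in\mathbb N_0,\ 0\le m\le 2^k-1\big\}$$ be the associated system of dyadic arcs, and for $I\in\mathcal I$ with left and right halves $I_-,I_+$ let $h_I=|I|^{-1/2}(\chi_{I_-}-\chi_{I_+})$. For a collection $\mathbf f=\{f_I\}_{I\in\mathcal I}\cup\{f_0\}$ of complex numbers put $$S_{\mathcal I}[\mathbf f]=|f_0|+\Big(\sum_{I\in\mathcal I}|f_I|^2\frac{\chi_I}{|I|}\Big)^{1/2}.$$ For $f\in L^1(\mathbb T)$ write $f_I=\int_{\mathbb T} f h_I$, $f_0=(2\pi)^{-1}\int_{\mathbb T} f$, and $S_{\mathcal I}[f]$ for the square function of this collection. * $H^1_{\mathcal I}(\mathbb T)$ is the space of $f\in L^1(\mathbb T)$ with $\|f\|_{H^1_{\mathcal I}}=\|S_{\mathcal I}[f]\|_{L^1(\mathbb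 T)}<\infty$. * $BMO^+_{\mathcal I}(\mathbb T)$ is the space of $b\in L^1(\mathbb T)$ with $$\|b\|_{BMO^+_{\mathcal I}}=\Big(\sup_{I\in\mathcal I}\frac1{|I|}\int_I|b-\langle b\rangle_I|^2\Big)^{1/2}+\Big|\int_{\mathbb T}b\Big|<\infty,\qquad \langle b\rangle_I=\frac1{|I|}\int_I b .$$ * Let $\Psi_0(t)=t/\log(e+t)$. $H^{\log}_{\mathcal I}(\mathbb T)$ is the space of distributions $u$ that are the limit in $\mathcal D'$ of the partial sums $f_0+\sum_{I\in\mathcal I,\,|I|\ge 2^{-N}}f_Ih_I$, as $N\to\infty$, of a collection $\mathbf f$ with $\int_{\mathbb T}\Psi_0(S_{\mathcal I}[\mathbf f])<\infty$; its quasi-norm is $$\|u\|_{H^{\log}_{\mathcal I}}=\inf\Big\{\lambda>0:\tfrac1{2\pi}\int_{\mathbb T}\Psi_0(\lambda^{-1}S_{\mathcal I}[\mathbf f])\le1\Big\}$$ (with the infimum over all such $\mathbf f$ representing $u$). For $f\in H^1_{\mathcal I}(\mathbb T)$ and $b\in BMO^+_{\mathcal I}(\mathbb T)$ the product $f\cdot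 b\in\mathcal D'$ is defined through the $H^1$–$BMO$ duality bracket of $f$ with $b\varphi$, that is, $$\langle f\cdot b,\varphi\rangle=f_0\int_{\mathbb T}b\varphi+\sum_{I\in\mathcal I}f_I\int_{\mathbb T}b\varphi h_I\qquad(\varphi\in C^\infty(\mathbb T)).$$ **Theorem.** There is an absolute constant $C$ such that for every $\delta\in[0,1)$, with $\mathcal I=\mathcal I^\delta$, there exist bilinear operators $$S_{\mathcal I}:H^1_{\mathcal I}(\mathbb T)\times BMO^+_{\mathcal I}(\mathbb T)\to L^1(\mathbb T),\qquad T_{\mathcal I}:H^1_{\mathcal I}(\mathbb T)\times BMO^+_{\mathcal I}(\mathbb T)\to H^{\log}_{\mathcal I}(\mathbb T)$$ such that for all $f\in H^1_{\mathcal I}(\mathbb T)$ and $b\in BMO^+_{\mathcal I}(\mathbb T)$ the series defining $f\cdot b$ converges (unconditionally) for every $\varphi\in C^\infty(\mathbb T)$, $$f\cdot b=S_{\mathcal I}(f,b)+T_{\mathcal I}(f,b)\quad\text{in }\mathcal D',$$ $$\|S_{\mathcal I}(f,b)\|_{L^1(\mathbb T)}\le C\|f\|_{H^1_{\mathcal I}}\|b\|_{BMO^+_{\mathcal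 I}},\qquad \|T_{\mathcal I}(f,b)\|_{H^{\log}_{\mathcal I}}\le C\|f\|_{H^1_{\mathcal I}}\|b\|_{BMO^+_{\mathcal I}} .$$ Moreover $S_{\mathcal I}$ and $T_{\mathcal I}$ can be chosen to extend $\Pi_2+\Pi_3$ and $\Pi_1$ respectively: if $f$ and $b$ have mean zero and only finitely many non-zero Haar coefficients, then $S_{\mathcal I}(f,b)=\Pi_2(f,b)+\Pi_3(f,b)$ and $T_{\mathcal I}(f,b)=\Pi_1(f,b)$, where $$\Pi_1(f,b)=\sum_{J\supsetneq I}f_Ib_Jh_Ih_J,\qquad \Pi_2(f,b)=\sum_{I\supsetneq J}f_Ib_Jh_Ih_J,\qquad \Pi_3(f,b)=\sum_{I=J}f_Ib_Jh_Ih_J$$ (sums over $I,J\in\mathcal I$). -/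

import Mathlib

open MeasureTheory Set Filter Topology
open scoped ENNReal NNReal

noncomputable section

namespace DyadicBGK

/-- The circle `𝕋 = ℝ / 2πℤ`; its `volume` has total mass `2π`. -/
abbrev Circ : Type := AddCircle (2 * Real.pi)

instance factTwoPi : Fact (0 < 2 * Real.pi) := ⟨Real.two_pi_pos⟩

/-- `L¹(𝕋)`, complex valued. -/
abbrev L1 : Type := Lp ℂ 1 (volume : Measure Circ)

/-! ### Distributions on the circle -/

/-- `C^∞(𝕋)`: functions on `𝕋` whose `2π`-periodic lift to `ℝ` is smooth. -/
def TestFn : Submodule ℂ (Circ → ℂ) where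
  carrier := {φ | ContDiff ℝ (⊤ : ℕ∞) (fun x : ℝ => φ (x : Circ))}
  add_mem' := fun {a b} ha hb => by
    have ha' : ContDiff ℝ (⊤ : ℕ∞) fun x : ℝ => a (x : Circ) := ha
    have hb' : ContDiff ℝ (⊤ : ℕ∞) fun x : ℝ => b (x : Circ) := hb
    exact ha'.add hb'
  zero_mem' := by
    have h : ContDiff ℝ (⊤ : ℕ∞) fun _ : ℝ => (0 : ℂ) := contDiff_const
    exact h
  smul_mem' := fun c f hf => by
    have hf' : ContDiff ℝ (⊤ : ℕ∞) fun x : ℝ => f (x : Circ) := hf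
    exact hf'.const_smul c

/-- `𝒟'`: the linear functionals `u` on `C^∞(𝕋)` that are continuous, that is, for some `C` and `n`
satisfy `|u φ| ≤ C · max_{j ≤ n} sup |φ^{(j)}|` for every `φ`. -/
def Distr : Submodule ℂ (Module.Dual ℂ TestFn) where
  carrier := {u | ∃ C : ℝ, ∃ n : ℕ, ∀ (φ : TestFn) (A : ℝ),
    (∀ j ≤ n, ∀ x : ℝ, ‖iteratedDeriv j (fun y : ℝ => φ.1 (y : Circ)) x‖ ≤ A) → ‖u φ‖ ≤ C * A}
  add_mem' := by
    rintro u v ⟨C, n, hu⟩ ⟨D, m, hv⟩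
    refine ⟨C + D, max n m, fun φ A hA => ?_⟩
    have h1 := hu φ A fun j hj => hA j (hj.trans (le_max_left _ _))
    have h2 := hv φ A fun j hj => hA j (hj.trans (le_max_right _ _))
    calc ‖(u + v) φ‖ ≤ ‖u φ‖ + ‖v φ‖ := norm_add_le _ _
      _ ≤ (C + D) * A := by linarith
  zero_mem' := ⟨0, 0, fun φ A _ => by simp⟩
  smul_mem' := by
    rintro c u ⟨C, n, hu⟩
    refine ⟨‖c‖ * C, n, fun φ A hA => ?_⟩
    have h1 := hu φ A hA
    calc ‖(c • u) φ‖ = ‖c‖ * ‖u φ‖ := by simp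
      _ ≤ ‖c‖ * (C * A) := by gcongr
      _ = ‖c‖ * C * A := by ring

lemma TestFn.continuous (φ : TestFn) : Continuous φ.1 := by
  have h0 : ContDiff ℝ (⊤ : ℕ∞) (fun x : ℝ => φ.1 (x : Circ)) := φ.2
  have h : Continuous (fun x : ℝ => φ.1 (x : Circ)) := h0.continuous
  exact (QuotientAddGroup.isQuotientMap_mk _).continuous_iff.2 h

lemma TestFn.integrable_mul (g : L1) (φ : TestFn) :
    Integrable (fun θ => g θ * φ.1 θ) (volume : Measure Circ) := by
  obtain ⟨A, hA⟩ := isCompact_univ.exists_bound_of_continuousOn ((TestFn.continuous φ).continuousOn)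
  exact (L1.integrable_coeFn g).mul_bdd (c := A) (TestFn.continuous φ).aestronglyMeasurable
    (Eventually.of_forall fun θ => hA θ (mem_univ θ))

/-- The distribution `φ ↦ ∫_𝕋 g φ` given by `g ∈ L¹(𝕋)`. -/
def ofL1 : L1 →ₗ[ℂ] Distr where
  toFun g := ⟨{ toFun := fun φ => ∫ θ, g θ * φ.1 θ
                map_add' := fun φ ψ => by
                  rw [← integral_add (TestFn.integrable_mul g φ) (TestFn.integrable_mul g ψ)]
                  simp [mul_add]
                map_smul' := fun c φ => by
                  simp only [RingHom.id_apply, smul_eq_mul]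
                  rw [← integral_const_mul]
                  congr 1; ext θ; simp; ring },
    ⟨∫ θ, ‖g θ‖, 0, fun φ A hA => by
      have hb : ∀ θ : Circ, ‖φ.1 θ‖ ≤ A := fun θ => by
        obtain ⟨x, rfl⟩ := QuotientAddGroup.mk_surjective θ
        simpa using hA 0 le_rfl x
      simp only [LinearMap.coe_mk, AddHom.coe_mk]
      rw [← integral_mul_const]
      refine norm_integral_le_of_norm_le ((L1.integrable_coeFn g).norm.mul_const A)
        (Eventually.of_forall fun θ => ?_)
      rw [norm_mul]
      exact mul_le_mul_of_nonneg_left (hb θ) (norm_nonneg _)⟩⟩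
  map_add' g h := by
    apply Subtype.ext
    apply LinearMap.ext
    intro φ
    change ∫ θ, (g + h : L1) θ * φ.1 θ = (∫ θ, g θ * φ.1 θ) + ∫ θ, h θ * φ.1 θ
    rw [← integral_add (TestFn.integrable_mul g φ) (TestFn.integrable_mul h φ)]
    refine integral_congr_ae ?_
    filter_upwards [Lp.coeFn_add g h] with θ hθ
    rw [hθ, Pi.add_apply, add_mul]
  map_smul' c g := by
    apply Subtype.ext
    apply LinearMap.ext
    intro φ
    change ∫ θ, (c • g : L1) θ * φ.1 θ = c • ∫ θ, g θ * φ.1 θ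
    rw [smul_eq_mul, ← integral_const_mul]
    refine integral_congr_ae ?_
    filter_upwards [Lp.coeFn_smul c g] with θ hθ
    rw [hθ, Pi.smul_apply, smul_eq_mul, mul_assoc]

/-! ### Dyadic arcs and Haar functions -/

/-- The arc `[2π(2^{-k} m + δ), 2π(2^{-k}(m+1) + δ))`, as a subset of `𝕋`. -/
def arcSet (δ : ℝ) (k m : ℕ) : Set Circ :=
  (fun x : ℝ => (x : Circ)) ''
    Ico (2 * Real.pi * ((m : ℝ) / 2 ^ k + δ)) (2 * Real.pi * (((m : ℝ) + 1) / 2 ^ k + δ))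

/-- The pairs `(k, m)` with `0 ≤ m < 2^k`, which index the arcs of the dyadic system `𝓘^δ`. -/
abbrev Idx : Type := Σ k : ℕ, Fin (2 ^ k)

/-- The arc of `𝓘^δ` with index `I`. -/
def arc (δ : ℝ) (I : Idx) : Set Circ := arcSet δ I.1 I.2

/-- `|I|`, the length of a dyadic arc. -/
def len (I : Idx) : ℝ := 2 * Real.pi / 2 ^ I.1

/-- The Haar function `h_I = |I|^{-1/2} (χ_{I₋} - χ_{I₊})`; the left and right halves of the arc
`(k, m)` are the arcs `(k+1, 2m)` and `(k+1, 2m+1)`. -/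
def haar (δ : ℝ) (I : Idx) (θ : Circ) : ℝ :=
  (Real.sqrt (len I))⁻¹ *
    ((arcSet δ (I.1 + 1) (2 * (I.2 : ℕ))).indicator 1 θ -
      (arcSet δ (I.1 + 1) (2 * (I.2 : ℕ) + 1)).indicator 1 θ)

/-- A collection `{f_I}_{I ∈ 𝓘} ∪ {f_0}` of complex numbers. -/
structure Coeffs where
  zero : ℂ
  coef : Idx → ℂ

/-- The mean value `(2π)⁻¹ ∫_𝕋 f`. -/
def mean (f : Circ → ℂ) : ℂ := (2 * Real.pi : ℂ)⁻¹ * ∫ θ, f θ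

/-- The Haar coefficient `⟨f, h_I⟩ = ∫_𝕋 f h_I`. -/
def coeff (δ : ℝ) (f : Circ → ℂ) (I : Idx) : ℂ := ∫ θ, f θ * (haar δ I θ : ℂ)

/-- The collection of Haar coefficients of an integrable function. -/
def coeffs (δ : ℝ) (f : Circ → ℂ) : Coeffs := ⟨mean f, coeff δ f⟩

/-- The partial sums `f_0 + ∑_I f_I h_I` over the arcs of the first `N` generations. -/
def partialSum (δ : ℝ) (c : Coeffs) (N : ℕ) (θ : Circ) : ℂ :=
  c.zero + ∑ k ∈ Finset.range N, ∑ m : Fin (2 ^ k), c.coef ⟨k, m⟩ * (haar δ ⟨k, m⟩ θ : ℂ)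

/-- The dyadic square function `|f_0| + (∑_I |f_I|² χ_I / |I|)^{1/2}`, with values in `[0, ∞]`. -/
def squareFn (δ : ℝ) (c : Coeffs) (θ : Circ) : ℝ≥0∞ :=
  ‖c.zero‖ₑ +
    (∑' I : Idx, (arc δ I).indicator (fun _ => ‖c.coef I‖ₑ ^ 2 / ENNReal.ofReal (len I)) θ) ^ (1 / 2 : ℝ)

/-! ### The dyadic space `H^log` -/

/-- `Ψ₀(t) = t / log(e + t)` on `[0, ∞]`, with `Ψ₀(∞) = ∞`. -/
def Psi0 (t : ℝ≥0∞) : ℝ≥0∞ :=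
  if t = ∞ then ∞ else ENNReal.ofReal (t.toReal / Real.log (Real.exp 1 + t.toReal))

/-- Membership in `h^log`: `∫_𝕋 Ψ₀(S[f]) < ∞`. -/
def MemhLog (δ : ℝ) (c : Coeffs) : Prop := ∫⁻ θ, Psi0 (squareFn δ c θ) < ∞

/-- The quasi-norm of `h^log`: the infimum of the `r > 0` with `(2π)⁻¹ ∫_𝕋 Ψ₀(r⁻¹ S[f]) ≤ 1`. -/
def hLogNorm (δ : ℝ) (c : Coeffs) : ℝ≥0∞ :=
  ⨅ (r : ℝ) (_ : 0 < r ∧ (ENNReal.ofReal (2 * Real.pi))⁻¹ *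
    ∫⁻ θ, Psi0 (ENNReal.ofReal r⁻¹ * squareFn δ c θ) ≤ 1), ENNReal.ofReal r

/-- `u = ι(c)`: the partial sums of the collection `c` converge to `u` in `𝒟'`. -/
def Represents (δ : ℝ) (c : Coeffs) (u : Distr) : Prop :=
  ∀ φ : TestFn, Tendsto (fun N => ∫ θ, partialSum δ c N θ * φ.1 θ) atTop (𝓝 (u.1 φ))

/-- The space `H^log = ι[h^log]` of distributions. -/
def HLog (δ : ℝ) : Set Distr := {u | ∃ c : Coeffs, MemhLog δ c ∧ Represents δ c u}

/-- The quasi-norm of `H^log`: the `h^log` quasi-norm of the collection that `u` comes from. -/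
def HLogNorm (δ : ℝ) (u : Distr) : ℝ≥0∞ :=
  ⨅ (c : Coeffs) (_ : MemhLog δ c ∧ Represents δ c u), hLogNorm δ c

/-! ### The dyadic spaces `H¹` and `BMO⁺` -/

/-- The norm `‖S[f]‖_{L¹(𝕋)}` of `f ∈ L¹(𝕋)`, possibly infinite. -/
def H1Norm (δ : ℝ) (f : L1) : ℝ≥0∞ := ∫⁻ θ, squareFn δ (coeffs δ f) θ

/-- The mean oscillation `|I|⁻¹ ∫_I |b - ⟨b⟩_I|²`, where `⟨b⟩_I = |I|⁻¹ ∫_I b`. -/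
def osc (δ : ℝ) (b : L1) (I : Idx) : ℝ≥0∞ :=
  (ENNReal.ofReal (len I))⁻¹ *
    ∫⁻ θ in arc δ I, ‖b θ - ((len I : ℂ)⁻¹ * ∫ η in arc δ I, b η)‖ₑ ^ 2

/-- The norm `(sup_{I ∈ 𝓘} |I|⁻¹ ∫_I |b - ⟨b⟩_I|²)^{1/2} + |∫_𝕋 b|` of `b ∈ L¹(𝕋)`, possibly
infinite. -/
def BMONorm (δ : ℝ) (b : L1) : ℝ≥0∞ := (⨆ I : Idx, osc δ b I) ^ (1 / 2 : ℝ) + ‖∫ θ, b θ‖ₑ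

lemma measurableSet_arcSet (δ : ℝ) (k m : ℕ) : MeasurableSet (arcSet δ k m) := by
  unfold arcSet
  generalize 2 * Real.pi * ((m : ℝ) / 2 ^ k + δ) = a
  generalize 2 * Real.pi * (((m : ℝ) + 1) / 2 ^ k + δ) = b
  have h : Ico a b = ⋃ n : ℕ, Icc a (b - 1 / ((n : ℝ) + 1)) := by
    ext x
    simp only [mem_Ico, mem_iUnion, mem_Icc]
    constructor
    · rintro ⟨h1, h2⟩
      obtain ⟨n, hn⟩ := exists_nat_one_div_lt (sub_pos.2 h2)
      exact ⟨n, h1, by linarith⟩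
    · rintro ⟨n, h1, h2⟩
      have : (0 : ℝ) < 1 / ((n : ℝ) + 1) := by positivity
      exact ⟨h1, by linarith⟩
  rw [h, image_iUnion]
  refine MeasurableSet.iUnion fun n => IsCompact.measurableSet ?_
  exact isCompact_Icc.image (AddCircle.continuous_mk' _)

lemma measurable_haar (δ : ℝ) (I : Idx) : Measurable (haar δ I) := by
  unfold haar
  exact (((measurable_const.indicator (measurableSet_arcSet _ _ _))).sub
    ((measurable_const.indicator (measurableSet_arcSet _ _ _)))).const_mul _

lemma integrable_mul_haar (δ : ℝ) (I : Idx) (f : L1) :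
    Integrable (fun θ => f θ * (haar δ I θ : ℂ)) (volume : Measure Circ) := by
  refine (L1.integrable_coeFn f).mul_bdd (c := (Real.sqrt (len I))⁻¹ * 2)
    (Complex.measurable_ofReal.comp (measurable_haar δ I)).aestronglyMeasurable
    (Eventually.of_forall fun θ => ?_)
  rw [Complex.norm_real, haar, norm_mul, Real.norm_of_nonneg (inv_nonneg.2 (Real.sqrt_nonneg _))]
  refine mul_le_mul_of_nonneg_left ?_ (inv_nonneg.2 (Real.sqrt_nonneg _))
  refine (norm_sub_le _ _).trans ?_
  have : ∀ s : Set Circ, ‖s.indicator (1 : Circ → ℝ) θ‖ ≤ 1 := fun s => by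
    by_cases h : θ ∈ s <;> simp [h]
  linarith [this (arcSet δ (I.1 + 1) (2 * (I.2 : ℕ))),
    this (arcSet δ (I.1 + 1) (2 * (I.2 : ℕ) + 1))]

lemma coeff_add (δ : ℝ) (f g : L1) (I : Idx) :
    coeff δ (f + g : L1) I = coeff δ f I + coeff δ g I := by
  unfold coeff
  rw [← integral_add (integrable_mul_haar δ I f) (integrable_mul_haar δ I g)]
  refine integral_congr_ae ?_
  filter_upwards [Lp.coeFn_add f g] with θ hθ
  rw [hθ, Pi.add_apply, add_mul]

lemma coeff_smul (δ : ℝ) (a : ℂ) (f : L1) (I : Idx) :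
    coeff δ (a • f : L1) I = a * coeff δ f I := by
  unfold coeff
  rw [← integral_const_mul]
  refine integral_congr_ae ?_
  filter_upwards [Lp.coeFn_smul a f] with θ hθ
  rw [hθ, Pi.smul_apply, smul_eq_mul, mul_assoc]

lemma integral_coe_add (f g : L1) (s : Set Circ) :
    ∫ θ in s, (f + g : L1) θ = (∫ θ in s, f θ) + ∫ θ in s, g θ := by
  rw [← integral_add (L1.integrable_coeFn f).integrableOn (L1.integrable_coeFn g).integrableOn]
  refine integral_congr_ae (ae_restrict_of_ae ?_)
  filter_upwards [Lp.coeFn_add f g] with θ hθ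
  rw [hθ, Pi.add_apply]

lemma integral_coe_smul (a : ℂ) (f : L1) (s : Set Circ) :
    ∫ θ in s, (a • f : L1) θ = a * ∫ θ in s, f θ := by
  rw [← integral_const_mul]
  refine integral_congr_ae (ae_restrict_of_ae ?_)
  filter_upwards [Lp.coeFn_smul a f] with θ hθ
  rw [hθ, Pi.smul_apply, smul_eq_mul]

lemma mean_add (f g : L1) : mean (f + g : L1) = mean f + mean g := by
  have := integral_coe_add f g univ
  simp only [Measure.restrict_univ] at this
  simp only [mean, this, mul_add]

lemma mean_smul (a : ℂ) (f : L1) : mean (a • f : L1) = a * mean f := by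
  have := integral_coe_smul a f univ
  simp only [Measure.restrict_univ] at this
  simp only [mean, this]; ring

lemma measurable_squareFn (δ : ℝ) (c : Coeffs) : Measurable (squareFn δ c) := by
  unfold squareFn
  have h : ∀ I : Idx, Measurable ((arc δ I).indicator
      fun _ => ‖c.coef I‖ₑ ^ 2 / ENNReal.ofReal (len I)) := fun I =>
    measurable_const.indicator (measurableSet_arcSet _ _ _)
  exact measurable_const.add (Measurable.pow_const (Measurable.tsum h) _)

lemma enorm_add_sq_le (x y : ℂ) : ‖x + y‖ₑ ^ 2 ≤ 2 * (‖x‖ₑ ^ 2 + ‖y‖ₑ ^ 2) := by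
  refine (pow_le_pow_left' (enorm_add_le x y) 2).trans ?_
  have h := ENNReal.rpow_add_le_mul_rpow_add_rpow ‖x‖ₑ ‖y‖ₑ (p := 2) (by norm_num)
  norm_num at h
  exact_mod_cast h

lemma squareFn_coeffs_add (δ : ℝ) (f g : L1) (θ : Circ) :
    squareFn δ (coeffs δ (f + g : L1)) θ ≤
      2 * (squareFn δ (coeffs δ f) θ + squareFn δ (coeffs δ g) θ) := by
  simp only [squareFn, coeffs, mean_add, coeff_add]
  set X := ∑' I : Idx, (arc δ I).indicator
    (fun _ => ‖coeff δ f I‖ₑ ^ 2 / ENNReal.ofReal (len I)) θ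
  set Y := ∑' I : Idx, (arc δ I).indicator
    (fun _ => ‖coeff δ g I‖ₑ ^ 2 / ENNReal.ofReal (len I)) θ
  have h1 : (∑' I : Idx, (arc δ I).indicator
      (fun _ => ‖coeff δ f I + coeff δ g I‖ₑ ^ 2 / ENNReal.ofReal (len I)) θ) ≤ 2 * (X + Y) := by
    rw [← ENNReal.tsum_add, ← ENNReal.tsum_mul_left]
    refine ENNReal.tsum_le_tsum fun I => ?_
    by_cases h : θ ∈ arc δ I
    · simp only [h, indicator_of_mem]
      rw [← ENNReal.add_div, ← mul_div_assoc]
      exact ENNReal.div_le_div_right (enorm_add_sq_le _ _) _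
    · simp [h]
  have h2 : (2 * (X + Y)) ^ (1 / 2 : ℝ) ≤ 2 * (X ^ (1 / 2 : ℝ) + Y ^ (1 / 2 : ℝ)) := by
    rw [ENNReal.mul_rpow_of_nonneg _ _ (by norm_num)]
    refine mul_le_mul' ?_ (ENNReal.rpow_add_le_add_rpow _ _ (by norm_num) (by norm_num))
    calc (2 : ℝ≥0∞) ^ (1 / 2 : ℝ) ≤ 2 ^ (1 : ℝ) :=
          ENNReal.rpow_le_rpow_of_exponent_le (by norm_num) (by norm_num)
      _ = 2 := by simp
  have h3 : ‖mean f + mean g‖ₑ ≤ 2 * (‖mean f‖ₑ + ‖mean g‖ₑ) :=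
    (enorm_add_le _ _).trans (le_mul_of_one_le_left zero_le (by norm_num))
  calc _ ≤ 2 * (‖mean f‖ₑ + ‖mean g‖ₑ) + 2 * (X ^ (1 / 2 : ℝ) + Y ^ (1 / 2 : ℝ)) :=
        add_le_add h3 ((ENNReal.rpow_le_rpow h1 (by norm_num)).trans h2)
    _ = _ := by ring

lemma squareFn_coeffs_smul (δ : ℝ) (a : ℂ) (f : L1) (θ : Circ) :
    squareFn δ (coeffs δ (a • f : L1)) θ = ‖a‖ₑ * squareFn δ (coeffs δ f) θ := by
  simp only [squareFn, coeffs, mean_smul, coeff_smul]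
  have h : ∀ I : Idx, (arc δ I).indicator
      (fun _ => ‖a * coeff δ f I‖ₑ ^ 2 / ENNReal.ofReal (len I)) θ = ‖a‖ₑ ^ 2 *
      (arc δ I).indicator (fun _ => ‖coeff δ f I‖ₑ ^ 2 / ENNReal.ofReal (len I)) θ := fun I => by
    by_cases h : θ ∈ arc δ I
    · simp only [h, indicator_of_mem, enorm_mul, mul_pow, mul_div_assoc]
    · simp [h]
  simp only [h, ENNReal.tsum_mul_left]
  rw [ENNReal.mul_rpow_of_nonneg _ _ (by norm_num), enorm_mul, mul_add, ← ENNReal.rpow_natCast,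
    ← ENNReal.rpow_mul]
  norm_num

lemma H1Norm_add (δ : ℝ) (f g : L1) : H1Norm δ (f + g) ≤ 2 * (H1Norm δ f + H1Norm δ g) := by
  unfold H1Norm
  rw [← lintegral_add_left (measurable_squareFn _ _), ← lintegral_const_mul' _ _ (by norm_num)]
  exact lintegral_mono fun θ => squareFn_coeffs_add δ f g θ

lemma H1Norm_smul (δ : ℝ) (a : ℂ) (f : L1) : H1Norm δ (a • f) = ‖a‖ₑ * H1Norm δ f := by
  unfold H1Norm
  rw [← lintegral_const_mul' _ _ enorm_ne_top]
  exact lintegral_congr fun θ => squareFn_coeffs_smul δ a f θ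

/-- The dyadic Hardy space `H¹_𝓘(𝕋)`: the integrable functions whose dyadic square function is
integrable. -/
def H1 (δ : ℝ) : Submodule ℂ L1 where
  carrier := {f | H1Norm δ f < ∞}
  add_mem' := fun {f g} hf hg =>
    (H1Norm_add δ f g).trans_lt (ENNReal.mul_lt_top (by norm_num) (ENNReal.add_lt_top.2 ⟨hf, hg⟩))
  zero_mem' := by
    have := H1Norm_smul δ 0 0
    simp only [zero_smul, enorm_zero, zero_mul] at this
    simp [this]
  smul_mem' := fun a f hf => by
    simp only [Set.mem_ofPred_eq, H1Norm_smul] at *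
    exact ENNReal.mul_lt_top enorm_lt_top hf

lemma BMONorm_lt_top_iff (δ : ℝ) (b : L1) : BMONorm δ b < ∞ ↔ (⨆ I : Idx, osc δ b I) < ∞ := by
  unfold BMONorm
  rw [ENNReal.add_lt_top, and_iff_left enorm_lt_top, ENNReal.rpow_lt_top_iff_of_pos (by norm_num)]

lemma osc_add (δ : ℝ) (b c : L1) (I : Idx) : osc δ (b + c) I ≤ 2 * (osc δ b I + osc δ c I) := by
  unfold osc
  rw [← mul_add, mul_left_comm]
  refine mul_le_mul' le_rfl ?_
  rw [← lintegral_add_left', ← lintegral_const_mul' _ _ (by norm_num)]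
  · refine lintegral_mono_ae (ae_restrict_of_ae ?_)
    filter_upwards [Lp.coeFn_add b c] with θ hθ
    rw [hθ, Pi.add_apply, integral_coe_add]
    refine le_trans (le_of_eq ?_) (enorm_add_sq_le _ _)
    congr 2; ring
  · have := (Lp.aestronglyMeasurable b).aemeasurable.restrict (s := arc δ I)
    fun_prop

lemma osc_smul (δ : ℝ) (a : ℂ) (b : L1) (I : Idx) : osc δ (a • b) I = ‖a‖ₑ ^ 2 * osc δ b I := by
  unfold osc
  rw [mul_left_comm, ← lintegral_const_mul' (‖a‖ₑ ^ 2) _ (by finiteness)]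
  congr 1
  refine lintegral_congr_ae (ae_restrict_of_ae ?_)
  filter_upwards [Lp.coeFn_smul a b] with θ hθ
  rw [hθ, Pi.smul_apply, integral_coe_smul, smul_eq_mul, ← mul_pow, ← enorm_mul]
  congr 2; ring

/-- The dyadic space `BMO⁺_𝓘(𝕋)`: the integrable functions of finite `BMO⁺` norm. -/
def BMO (δ : ℝ) : Submodule ℂ L1 where
  carrier := {b | BMONorm δ b < ∞}
  add_mem' := fun {b c} hb hc => by
    simp only [Set.mem_ofPred_eq, BMONorm_lt_top_iff] at *
    refine lt_of_le_of_lt (iSup_le fun I => (osc_add δ b c I).trans ?_)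
      (ENNReal.mul_lt_top (a := 2) (by norm_num) (ENNReal.add_lt_top.2 ⟨hb, hc⟩))
    exact mul_le_mul' le_rfl (add_le_add (le_iSup (osc δ b) I) (le_iSup (osc δ c) I))
  zero_mem' := by
    have h : ∀ I, osc δ 0 I = 0 := fun I => by simpa using osc_smul δ 0 0 I
    simp [BMONorm_lt_top_iff, h]
  smul_mem' := fun a b hb => by
    simp only [Set.mem_ofPred_eq, BMONorm_lt_top_iff] at *
    simp only [osc_smul, ← ENNReal.mul_iSup]
    exact ENNReal.mul_lt_top (by finiteness) hb

/-! ### Products and paraproducts -/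

/-- `u` is the product `f · b` in `𝒟'`: for every test function `φ`, the value `⟨u, φ⟩` is the
`H¹`-`BMO` duality bracket `f_0 ∫ bφ + ∑_I f_I ⟨bφ, h_I⟩` of `f` with `b φ`. -/
def IsProduct (δ : ℝ) (f b : L1) (u : Distr) : Prop :=
  ∀ φ : TestFn, HasSum (fun I : Idx => coeff δ f I * coeff δ (fun θ => b θ * φ.1 θ) I)
    (u.1 φ - mean f * ∫ θ, b θ * φ.1 θ)

/-- `f` has mean zero and only finitely many nonzero Haar coefficients. -/
def FiniteHaar (δ : ℝ) (f : L1) : Prop := mean f = 0 ∧ {I : Idx | coeff δ f I ≠ 0}.Finite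

/-- The `(I, J)` term `f_I b_J h_I(θ) h_J(θ)` of the paraproducts. -/
def prodTerm (δ : ℝ) (f b : L1) (θ : Circ) (p : Idx × Idx) : ℂ :=
  coeff δ f p.1 * coeff δ b p.2 * (haar δ p.1 θ : ℂ) * (haar δ p.2 θ : ℂ)

/-- `Π₁(f, b) = ∑_{J ⊋ I} f_I b_J h_I h_J`, for finite Haar expansions. -/
def Pi1 (δ : ℝ) (f b : L1) (θ : Circ) : ℂ :=
  ∑ᶠ p ∈ {p : Idx × Idx | arc δ p.1 ⊂ arc δ p.2}, prodTerm δ f b θ p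

/-- `Π₂(f, b) = ∑_{I ⊋ J} f_I b_J h_I h_J`, for finite Haar expansions. -/
def Pi2 (δ : ℝ) (f b : L1) (θ : Circ) : ℂ :=
  ∑ᶠ p ∈ {p : Idx × Idx | arc δ p.2 ⊂ arc δ p.1}, prodTerm δ f b θ p

/-- `Π₃(f, b) = ∑_{I = J} f_I b_J h_I h_J`, for finite Haar expansions. -/
def Pi3 (δ : ℝ) (f b : L1) (θ : Circ) : ℂ :=
  ∑ᶠ p ∈ {p : Idx × Idx | arc δ p.1 = arc δ p.2}, prodTerm δ f b θ p

end DyadicBGK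

end

open DyadicBGK

/-!
Write `Δ_k f` for the part `∑ f_I h_I` of generation `k` of the Haar expansion of `f`, and `E_k b`
for the conditional expectation of `b` on the arcs of generation `k`. Since `|h_I|` is constant on
`I`, the square `|Δ_k f|²` is constant on the arcs of generation `k`, and this predictability lets
summation by parts (`integral_sum_mul_le`) replace stopping times and atomic decompositions.

On an arc `I` one has `b h_I = ⟨b⟩_I h_I + (b - ⟨b⟩_I) h_I`. The first terms give the distribution
`T(f, b) = ∑ f_I ⟨b⟩_I h_I`, and the second ones, with the mean of `f`, the function
`S(f, b) = f_0 b + ∑_k Δ_k f (b - E_k b)`. For finite Haar expansions of mean zero,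
`⟨b⟩_I = ∑_{J ⊋ I} b_J h_J` on `I`, so these are `Π₁` and `Π₂ + Π₃`.

*The bound for `S`.* The Garsia-Herz inequality `integral_sum_sqrt_mul_le` pairs a square function
in `L¹` with a Carleson sequence. By duality with `|g| ≤ 1`, the `L¹` bound for
`∑ Δ_k f (b - E_k b)` is the pairing of `f_I` with `c_I = ∫ (b - ⟨b⟩_I) g h_I`. That `c_I` is a
Carleson sequence (`setIntegral_sum_oscCoeff_le`) follows by telescoping over the tree a potential
built from the variances of `b` and `g` and from their covariance. Applied to tails, the same bound
gives convergence of the series in `L¹`; applied with a test function as `g`, it gives the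
absolute convergence of the series that defines `f · b`.

*The bound for `T`.* The square function of the collection `f_I ⟨b⟩_I` is at most `M S[f]`, where
`M` is the maximal function of the mean values of `b`. Doob's inequality on arcs
(`setIntegral_maxDiff_le`) bounds the conditional expectation of the future increments of `M`, and
summation by parts turns this into exponential integrability (`integral_exp_maxAvg_le`). The
inequality `Ψ₀(s t) ≤ s + e^t - 1` (`Psi0_ofReal_le`) concludes.
-/

namespace DyadicBGK

/-! ### The tree of dyadic arcs -/

lemma len_pos (I : Idx) : 0 < len I := div_pos Real.two_pi_pos (by positivity)

/-- The position of `θ` in the fundamental domain that starts at `2πδ`, rescaled to `[0, 1)`. -/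
noncomputable def unitPos (δ : ℝ) (θ : Circ) : ℝ :=
  (AddCircle.equivIco (2 * Real.pi) (2 * Real.pi * δ) θ : ℝ) / (2 * Real.pi) - δ

lemma unitPos_nonneg (δ : ℝ) (θ : Circ) : 0 ≤ unitPos δ θ := by
  have h := (AddCircle.equivIco (2 * Real.pi) (2 * Real.pi * δ) θ).2.1
  rw [unitPos, sub_nonneg, le_div_iff₀ Real.two_pi_pos]; linarith

lemma unitPos_lt_one (δ : ℝ) (θ : Circ) : unitPos δ θ < 1 := by
  have h := (AddCircle.equivIco (2 * Real.pi) (2 * Real.pi * δ) θ).2.2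
  rw [unitPos, sub_lt_iff_lt_add, div_lt_iff₀ Real.two_pi_pos]; linarith

lemma coe_unitPos (δ : ℝ) (θ : Circ) :
    ((2 * Real.pi * (unitPos δ θ + δ) : ℝ) : Circ) = θ := by
  have h : 2 * Real.pi * (unitPos δ θ + δ) =
      (AddCircle.equivIco (2 * Real.pi) (2 * Real.pi * δ) θ : ℝ) := by
    have := Real.two_pi_pos.ne'
    rw [unitPos]; field_simp; ring
  rw [h]; exact AddCircle.coe_equivIco

lemma unitPos_coe (δ : ℝ) {x : ℝ} (h0 : 0 ≤ x) (h1 : x < 1) :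
    unitPos δ ((2 * Real.pi * (x + δ) : ℝ) : Circ) = x := by
  have hp := Real.two_pi_pos
  have hx : 2 * Real.pi * (x + δ) ∈ Ico (2 * Real.pi * δ) (2 * Real.pi * δ + 2 * Real.pi) :=
    ⟨by nlinarith, by nlinarith⟩
  rw [unitPos, AddCircle.equivIco_coe_of_mem hx]
  field_simp; ring

lemma floor_unitPos_lt (δ : ℝ) (k : ℕ) (θ : Circ) : ⌊unitPos δ θ * 2 ^ k⌋₊ < 2 ^ k := by
  have h0 := unitPos_nonneg δ θ
  rw [Nat.floor_lt (by positivity)]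
  push_cast
  have : (0 : ℝ) < 2 ^ k := by positivity
  nlinarith [unitPos_lt_one δ θ]

/-- The dyadic arc of generation `k` that contains `θ`. -/
noncomputable def node (δ : ℝ) (k : ℕ) (θ : Circ) : Idx :=
  ⟨k, ⟨⌊unitPos δ θ * 2 ^ k⌋₊, floor_unitPos_lt δ k θ⟩⟩

@[simp] lemma node_fst (δ : ℝ) (k : ℕ) (θ : Circ) : (node δ k θ).1 = k := rfl

lemma mem_arcSet_iff (δ : ℝ) {k m : ℕ} (hm : m < 2 ^ k) (θ : Circ) :
    θ ∈ arcSet δ k m ↔ ⌊unitPos δ θ * 2 ^ k⌋₊ = m := by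
  have h2 : (0 : ℝ) < 2 ^ k := by positivity
  have hp := Real.two_pi_pos
  have hm' : (m : ℝ) + 1 ≤ 2 ^ k := by exact_mod_cast hm
  rw [Nat.floor_eq_iff (mul_nonneg (unitPos_nonneg δ θ) h2.le)]
  constructor
  · rintro ⟨x, ⟨h1, h3⟩, rfl⟩
    set y := x / (2 * Real.pi) - δ with hy
    have hx : x = 2 * Real.pi * (y + δ) := by rw [hy]; field_simp; ring
    rw [hx] at h1 h3
    have h1' : (m : ℝ) / 2 ^ k ≤ y := by have := le_of_mul_le_mul_left h1 hp; linarith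
    have h3' : y < ((m : ℝ) + 1) / 2 ^ k := by have := lt_of_mul_lt_mul_left h3 hp.le; linarith
    have hy0 : 0 ≤ y := le_trans (by positivity) h1'
    have hy1 : y < 1 := h3'.trans_le ((div_le_one h2).2 hm')
    change _ ≤ unitPos δ (x : Circ) * _ ∧ unitPos δ (x : Circ) * _ < _
    rw [hx, unitPos_coe δ hy0 hy1]
    exact ⟨(div_le_iff₀ h2).1 h1', (lt_div_iff₀ h2).1 h3'⟩
  · rintro ⟨h1, h3⟩
    refine ⟨2 * Real.pi * (unitPos δ θ + δ), ⟨?_, ?_⟩, coe_unitPos δ θ⟩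
    · have := (div_le_iff₀ h2).2 h1
      gcongr
    · have := (lt_div_iff₀ h2).2 h3
      gcongr

lemma mem_arc_iff (δ : ℝ) (I : Idx) (θ : Circ) : θ ∈ arc δ I ↔ node δ I.1 θ = I := by
  obtain ⟨k, m, hm⟩ := I
  rw [arc, mem_arcSet_iff δ hm]
  simp [node]

lemma mem_arc_node (δ : ℝ) (k : ℕ) (θ : Circ) : θ ∈ arc δ (node δ k θ) := by
  rw [mem_arc_iff]; rfl

lemma measurableSet_arc (δ : ℝ) (I : Idx) : MeasurableSet (arc δ I) := measurableSet_arcSet _ _ _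

/-- The left half of a dyadic arc. -/
def left (I : Idx) : Idx := ⟨I.1 + 1, ⟨2 * (I.2 : ℕ), by have := I.2.2; rw [pow_succ]; omega⟩⟩

/-- The right half of a dyadic arc. -/
def right (I : Idx) : Idx := ⟨I.1 + 1, ⟨2 * (I.2 : ℕ) + 1, by have := I.2.2; rw [pow_succ]; omega⟩⟩

@[simp] lemma left_fst (I : Idx) : (left I).1 = I.1 + 1 := rfl
@[simp] lemma right_fst (I : Idx) : (right I).1 = I.1 + 1 := rfl

lemma len_left (I : Idx) : len (left I) = len I / 2 := by
  simp only [len, left_fst, pow_succ]; field_simp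

lemma len_right (I : Idx) : len (right I) = len I / 2 := by
  simp only [len, right_fst, pow_succ]; field_simp

lemma left_ne_right (I J : Idx) : left I ≠ right J := by
  obtain ⟨k, m, hm⟩ := I
  obtain ⟨l, n, hn⟩ := J
  intro h
  simp only [left, right, Sigma.mk.injEq] at h
  obtain ⟨h1, h2⟩ := h
  obtain rfl : k = l := by omega
  simp only [heq_eq_eq, Fin.mk.injEq] at h2
  omega

lemma left_injective : Function.Injective left := by
  rintro ⟨k, m, hm⟩ ⟨l, n, hn⟩ h
  simp only [left, Sigma.mk.injEq] at h
  obtain ⟨h1, h2⟩ := h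
  obtain rfl : k = l := by omega
  simp only [heq_eq_eq, Fin.mk.injEq] at h2
  obtain rfl : m = n := by omega
  rfl

lemma right_injective : Function.Injective right := by
  rintro ⟨k, m, hm⟩ ⟨l, n, hn⟩ h
  simp only [right, Sigma.mk.injEq] at h
  obtain ⟨h1, h2⟩ := h
  obtain rfl : k = l := by omega
  simp only [heq_eq_eq, Fin.mk.injEq] at h2
  obtain rfl : m = n := by omega
  rfl

lemma node_succ (δ : ℝ) (k : ℕ) (θ : Circ) :
    node δ (k + 1) θ = left (node δ k θ) ∨ node δ (k + 1) θ = right (node δ k θ) := by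
  have h : ⌊unitPos δ θ * 2 ^ (k + 1)⌋₊ / 2 = ⌊unitPos δ θ * 2 ^ k⌋₊ := by
    rw [← Nat.floor_div_ofNat, pow_succ]
    congr 1
    ring
  have h' : ⌊unitPos δ θ * 2 ^ (k + 1)⌋₊ = 2 * ⌊unitPos δ θ * 2 ^ k⌋₊ ∨
      ⌊unitPos δ θ * 2 ^ (k + 1)⌋₊ = 2 * ⌊unitPos δ θ * 2 ^ k⌋₊ + 1 := by omega
  simpa [node, left, right] using h'

/-- The sign of the Haar functions of generation `k` at `θ`: `1` on left halves, `-1` on right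
halves. -/
noncomputable def sgn (δ : ℝ) (k : ℕ) (θ : Circ) : ℝ :=
  if node δ (k + 1) θ = left (node δ k θ) then 1 else -1

lemma abs_sgn (δ : ℝ) (k : ℕ) (θ : Circ) : |sgn δ k θ| = 1 := by
  unfold sgn; split_ifs <;> norm_num

lemma mem_left_or_right (δ : ℝ) {I : Idx} {θ : Circ} (h : θ ∈ arc δ I) :
    (θ ∈ arc δ (left I) ∧ sgn δ I.1 θ = 1) ∨ (θ ∈ arc δ (right I) ∧ sgn δ I.1 θ = -1) := by
  have hI := (mem_arc_iff δ I θ).1 h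
  simp only [mem_arc_iff, left_fst, right_fst, sgn, hI]
  rcases node_succ δ I.1 θ with h1 | h1 <;> rw [hI] at h1
  · simp [h1]
  · simp [h1, (left_ne_right I I).symm]

lemma node_eq_of_node_succ_eq (δ : ℝ) {k : ℕ} {θ η : Circ}
    (h : node δ (k + 1) θ = node δ (k + 1) η) : node δ k θ = node δ k η := by
  rcases node_succ δ k θ with h1 | h1 <;> rcases node_succ δ k η with h2 | h2 <;>
    rw [h1, h2] at h
  · exact left_injective h
  · exact absurd h (left_ne_right _ _)
  · exact absurd h.symm (left_ne_right _ _)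
  · exact right_injective h

lemma node_eq_of_le (δ : ℝ) {k l : ℕ} (hkl : k ≤ l) {θ η : Circ}
    (h : node δ l θ = node δ l η) : node δ k θ = node δ k η := by
  induction l, hkl using Nat.le_induction with
  | base => exact h
  | succ l _ ih => exact ih (node_eq_of_node_succ_eq δ h)

lemma left_subset (δ : ℝ) (I : Idx) : arc δ (left I) ⊆ arc δ I := by
  intro θ h
  rw [mem_arc_iff] at h ⊢
  rcases node_succ δ I.1 θ with h1 | h1
  · exact left_injective (h1.symm.trans h)
  · exact absurd (h.symm.trans h1) (left_ne_right _ _)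

lemma right_subset (δ : ℝ) (I : Idx) : arc δ (right I) ⊆ arc δ I := by
  intro θ h
  rw [mem_arc_iff] at h ⊢
  rcases node_succ δ I.1 θ with h1 | h1
  · exact absurd (h1.symm.trans h) (left_ne_right _ _)
  · exact right_injective (h1.symm.trans h)

lemma arc_eq_union (δ : ℝ) (I : Idx) : arc δ I = arc δ (left I) ∪ arc δ (right I) := by
  apply Subset.antisymm
  · intro θ h
    rcases mem_left_or_right δ h with h | h
    · exact Or.inl h.1
    · exact Or.inr h.1
  · exact union_subset (left_subset δ I) (right_subset δ I)

lemma disjoint_halves (δ : ℝ) (I : Idx) : Disjoint (arc δ (left I)) (arc δ (right I)) := by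
  rw [Set.disjoint_left]
  intro θ h1 h2
  rw [mem_arc_iff] at h1 h2
  exact left_ne_right _ _ (h1.symm.trans h2)

lemma sgn_eq_one (δ : ℝ) {I : Idx} {θ : Circ} (h : θ ∈ arc δ (left I)) : sgn δ I.1 θ = 1 := by
  rcases mem_left_or_right δ (left_subset δ I h) with h1 | h1
  · exact h1.2
  · exact absurd h1.1 (Set.disjoint_left.1 (disjoint_halves δ I) h)

lemma sgn_eq_neg_one (δ : ℝ) {I : Idx} {θ : Circ} (h : θ ∈ arc δ (right I)) :
    sgn δ I.1 θ = -1 := by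
  rcases mem_left_or_right δ (right_subset δ I h) with h1 | h1
  · exact absurd h (Set.disjoint_left.1 (disjoint_halves δ I) h1.1)
  · exact h1.2

lemma haar_eq (δ : ℝ) (I : Idx) (θ : Circ) :
    haar δ I θ = (Real.sqrt (len I))⁻¹ * (arc δ I).indicator (sgn δ I.1) θ := by
  unfold haar
  congr 1
  change (arc δ (left I)).indicator 1 θ - (arc δ (right I)).indicator 1 θ = _
  by_cases h : θ ∈ arc δ I
  · rw [indicator_of_mem h]
    rcases mem_left_or_right δ h with ⟨h1, h2⟩ | ⟨h1, h2⟩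
    · rw [indicator_of_mem h1, h2, indicator_of_notMem
        (Set.disjoint_left.1 (disjoint_halves δ I) h1)]
      simp
    · rw [indicator_of_mem h1, h2, indicator_of_notMem
        (Set.disjoint_right.1 (disjoint_halves δ I) h1)]
      simp
  · rw [indicator_of_notMem h, indicator_of_notMem fun h' => h (left_subset δ I h'),
      indicator_of_notMem fun h' => h (right_subset δ I h'), sub_zero]

lemma haar_of_notMem (δ : ℝ) {I : Idx} {θ : Circ} (h : θ ∉ arc δ I) : haar δ I θ = 0 := by
  rw [haar_eq, indicator_of_notMem h, mul_zero]

lemma haar_node (δ : ℝ) (k : ℕ) (θ : Circ) :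
    haar δ (node δ k θ) θ = (Real.sqrt (len (node δ k θ)))⁻¹ * sgn δ k θ := by
  rw [haar_eq, indicator_of_mem (mem_arc_node δ k θ)]
  rfl

lemma abs_haar_le (δ : ℝ) (I : Idx) (θ : Circ) : |haar δ I θ| ≤ (Real.sqrt (len I))⁻¹ := by
  rw [haar_eq, abs_mul, abs_of_nonneg (by positivity)]
  refine mul_le_of_le_one_right (by positivity) ?_
  by_cases h : θ ∈ arc δ I
  · rw [indicator_of_mem h, abs_sgn]
  · rw [indicator_of_notMem h]; simp

lemma volume_arc (δ : ℝ) (I : Idx) : volume (arc δ I) = ENNReal.ofReal (len I) := by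
  have hp := Real.two_pi_pos
  have h2 : (0 : ℝ) < 2 ^ I.1 := by positivity
  rw [← (AddCircle.measurePreserving_mk (2 * Real.pi) (2 * Real.pi * δ)).measure_preimage
    (measurableSet_arc δ I).nullMeasurableSet]
  rw [← Measure.restrict_congr_set (Ico_ae_eq_Ioc (μ := volume)),
    Measure.restrict_apply ((AddCircle.measurable_mk') (measurableSet_arc δ I))]
  have h : (fun x : ℝ => (x : Circ)) ⁻¹' (arc δ I) ∩
      Ico (2 * Real.pi * δ) (2 * Real.pi * δ + 2 * Real.pi) =
      Ico (2 * Real.pi * (((I.2 : ℕ) : ℝ) / 2 ^ I.1 + δ))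
        (2 * Real.pi * ((((I.2 : ℕ) : ℝ) + 1) / 2 ^ I.1 + δ)) := by
    have hm : (((I.2 : ℕ) : ℝ) + 1) ≤ 2 ^ I.1 := by exact_mod_cast I.2.2
    ext x
    set y := x / (2 * Real.pi) - δ with hy
    have hx : x = 2 * Real.pi * (y + δ) := by rw [hy]; field_simp; ring
    simp only [mem_inter_iff, mem_preimage, mem_Ico]
    constructor
    · rintro ⟨h1, h3, h4⟩
      have hy0 : 0 ≤ y := by rw [hx] at h3; have := le_of_mul_le_mul_left h3 hp; linarith
      have hy1 : y < 1 := by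
        rw [hx] at h4
        have : 2 * Real.pi * (y + δ) < 2 * Real.pi * (1 + δ) := by linarith
        have := lt_of_mul_lt_mul_left this hp.le
        linarith
      rw [arc, mem_arcSet_iff δ I.2.2, hx, unitPos_coe δ hy0 hy1,
        Nat.floor_eq_iff (by positivity)] at h1
      rw [hx]
      constructor
      · have := (div_le_iff₀ h2).2 h1.1
        gcongr
      · have := (lt_div_iff₀ h2).2 h1.2
        gcongr
    · rintro ⟨h1, h3⟩
      refine ⟨⟨x, ⟨h1, h3⟩, rfl⟩, le_trans ?_ h1, h3.trans_le ?_⟩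
      · have : 0 ≤ ((I.2 : ℕ) : ℝ) / 2 ^ I.1 := by positivity
        nlinarith
      · have := (div_le_one h2).2 hm
        nlinarith
  erw [h]
  rw [Real.volume_Ico, len]
  congr 1
  field_simp
  ring

lemma volume_real_arc (δ : ℝ) (I : Idx) : (volume : Measure Circ).real (arc δ I) = len I := by
  rw [Measure.real, volume_arc, ENNReal.toReal_ofReal (len_pos I).le]

/-! ### Functions that are constant on the arcs of one generation -/

/-- `w` is constant on the arcs of generation `k`. -/
abbrev Adapted {α : Type*} (δ : ℝ) (k : ℕ) (w : Circ → α) : Prop :=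
  Function.FactorsThrough w (node δ k)

lemma sum_indicator_arc {E : Type*} [AddCommMonoid E] (δ : ℝ) (k : ℕ) (F : Idx → Circ → E)
    (θ : Circ) :
    ∑ m : Fin (2 ^ k), (arc δ ⟨k, m⟩).indicator (F ⟨k, m⟩) θ = F (node δ k θ) θ := by
  obtain ⟨m₀, h₀⟩ : ∃ m₀ : Fin (2 ^ k), node δ k θ = ⟨k, m₀⟩ := ⟨_, rfl⟩
  have hm : ∀ m : Fin (2 ^ k), θ ∈ arc δ ⟨k, m⟩ ↔ m = m₀ := fun m => by
    rw [mem_arc_iff]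
    change node δ k θ = _ ↔ _
    rw [h₀]
    simp [eq_comm]
  rw [h₀, Finset.sum_eq_single m₀]
  · exact indicator_of_mem ((hm m₀).2 rfl) _
  · exact fun m _ h => indicator_of_notMem (fun h' => h ((hm m).1 h')) _
  · simp

lemma adapted_node {α : Type*} (δ : ℝ) (k : ℕ) (u : Idx → α) :
    Adapted δ k fun θ => u (node δ k θ) := fun _ _ h => congrArg u h

lemma adapted_sgn (δ : ℝ) {k l : ℕ} (h : k < l) : Adapted δ l (sgn δ k) := by
  intro θ η hθ
  unfold sgn
  rw [node_eq_of_le δ h hθ, node_eq_of_le δ h.le hθ]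

lemma Adapted.mono {α : Type*} {δ : ℝ} {k l : ℕ} {w : Circ → α} (hw : Adapted δ k w)
    (h : k ≤ l) : Adapted δ l w := fun _ _ hθ => hw (node_eq_of_le δ h hθ)

lemma Adapted.exists_eq {α : Type*} [Nonempty α] {δ : ℝ} {k : ℕ} {w : Circ → α}
    (hw : Adapted δ k w) : ∃ u : Idx → α, ∀ θ, w θ = u (node δ k θ) := by
  obtain ⟨u, hu⟩ := (Function.factorsThrough_iff w).1 hw
  exact ⟨u, fun θ => congrFun hu θ⟩

lemma Adapted.measurable {E : Type*} [AddCommMonoid E] [MeasurableSpace E] [MeasurableAdd₂ E]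
    {δ : ℝ} {k : ℕ} {w : Circ → E} (hw : Adapted δ k w) : Measurable w := by
  obtain ⟨u, hu⟩ := hw.exists_eq
  have : w = fun θ => ∑ m : Fin (2 ^ k), (arc δ ⟨k, m⟩).indicator (fun _ => u ⟨k, m⟩) θ := by
    ext θ
    rw [sum_indicator_arc δ k (fun I _ => u I), hu]
  rw [this]
  exact Finset.measurable_sum _ fun m _ => measurable_const.indicator (measurableSet_arc _ _)

lemma Adapted.exists_bound {E : Type*} [SeminormedAddCommGroup E] {δ : ℝ} {k : ℕ} {w : Circ → E}
    (hw : Adapted δ k w) : ∃ A : ℝ, ∀ θ, ‖w θ‖ ≤ A := by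
  obtain ⟨u, hu⟩ := hw.exists_eq
  refine ⟨∑ m : Fin (2 ^ k), ‖u ⟨k, m⟩‖, fun θ => ?_⟩
  rw [hu]
  exact Finset.single_le_sum (f := fun m : Fin (2 ^ k) => ‖u ⟨k, m⟩‖)
    (fun m _ => norm_nonneg _) (Finset.mem_univ (node δ k θ).2)

lemma Adapted.integrable {E : Type*} [NormedAddCommGroup E] [MeasurableSpace E] [BorelSpace E]
    [SecondCountableTopology E] {δ : ℝ} {k : ℕ} {w : Circ → E} (hw : Adapted δ k w) :
    Integrable w (volume : Measure Circ) := by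
  obtain ⟨A, hA⟩ := hw.exists_bound
  exact Integrable.of_bound hw.measurable.aestronglyMeasurable A (Eventually.of_forall hA)

lemma Adapted.integrable_mul {𝕜 : Type*} [RCLike 𝕜] {δ : ℝ} {k : ℕ} {w v : Circ → 𝕜}
    (hw : Adapted δ k w) (hv : Integrable v (volume : Measure Circ)) :
    Integrable (fun θ => w θ * v θ) (volume : Measure Circ) := by
  obtain ⟨A, hA⟩ := hw.exists_bound
  exact hv.bdd_mul hw.measurable.aestronglyMeasurable (Eventually.of_forall hA)

lemma integral_eq_sum_arc {E : Type*} [NormedAddCommGroup E] [NormedSpace ℝ E] (δ : ℝ) (k : ℕ)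
    {F : Circ → E} (hF : Integrable F (volume : Measure Circ)) :
    ∫ θ, F θ = ∑ m : Fin (2 ^ k), ∫ θ in arc δ ⟨k, m⟩, F θ := by
  simp_rw [← integral_indicator (measurableSet_arc δ _)]
  rw [← integral_finsetSum _ fun m _ => hF.indicator (measurableSet_arc δ _)]
  congr 1
  ext θ
  exact (sum_indicator_arc δ k (fun _ => F) θ).symm

lemma setIntegral_arc {E : Type*} [NormedAddCommGroup E] [NormedSpace ℝ E] (δ : ℝ) (I : Idx)
    {F : Circ → E} (hF : Integrable F (volume : Measure Circ)) :
    ∫ θ in arc δ I, F θ = (∫ θ in arc δ (left I), F θ) + ∫ θ in arc δ (right I), F θ := by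
  conv_lhs => rw [arc_eq_union δ I]
  exact setIntegral_union (disjoint_halves δ I) (measurableSet_arc δ _) hF.integrableOn
    hF.integrableOn

lemma setIntegral_arc_const {E : Type*} [NormedAddCommGroup E] [NormedSpace ℝ E] [CompleteSpace E]
    (δ : ℝ) (I : Idx) (x : E) : ∫ _ in arc δ I, x = len I • x := by
  rw [setIntegral_const, volume_real_arc]

/-- A comparison of integrals over the arcs of generation `k` persists after multiplication by a
nonnegative function that is constant on those arcs. -/
lemma Adapted.integral_mul_mono {δ : ℝ} {k : ℕ} {w u v : Circ → ℝ} (hw : Adapted δ k w)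
    (hw0 : ∀ θ, 0 ≤ w θ) (hu : Integrable u (volume : Measure Circ))
    (hv : Integrable v (volume : Measure Circ))
    (h : ∀ θ, w θ ≠ 0 → ∫ η in arc δ (node δ k θ), u η ≤ ∫ η in arc δ (node δ k θ), v η) :
    ∫ θ, w θ * u θ ≤ ∫ θ, w θ * v θ := by
  rw [integral_eq_sum_arc δ k (hw.integrable_mul hu),
    integral_eq_sum_arc δ k (hw.integrable_mul hv)]
  refine Finset.sum_le_sum fun m _ => ?_
  rcases (arc δ ⟨k, m⟩).eq_empty_or_nonempty with he | ⟨η, hη⟩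
  · simp [he]
  rw [mem_arc_iff] at hη
  change node δ k η = _ at hη
  have key : ∀ F : Circ → ℝ, ∫ θ in arc δ ⟨k, m⟩, w θ * F θ =
      w η * ∫ θ in arc δ ⟨k, m⟩, F θ := fun F => by
    rw [← integral_const_mul]
    refine setIntegral_congr_fun (measurableSet_arc _ _) fun θ hθ => ?_
    rw [mem_arc_iff] at hθ
    change node δ k θ = _ at hθ
    exact congrArg (· * F θ) (hw (hθ.trans hη.symm))
  rw [key, key]
  by_cases h0 : w η = 0
  · simp [h0]
  · refine mul_le_mul_of_nonneg_left ?_ (hw0 η)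
    rw [← hη]
    exact h η h0

/-- Summation by parts. The sequence `w` increases along generations, and the tails of `∑ β_k` have
mean value at most `c` on every arc of the generation where they start; then the integral of
`∑ β_k w_k` is at most that of `c` times the last `w`. -/
lemma integral_sum_mul_le {δ : ℝ} {c : ℝ} {N : ℕ} {β w : ℕ → Circ → ℝ}
    (hβ : ∀ k, Integrable (β k) (volume : Measure Circ)) (hw : ∀ k, Adapted δ k (w k))
    (hw0 : ∀ θ, 0 ≤ w 0 θ) (hmono : ∀ k θ, w k θ ≤ w (k + 1) θ)
    (h : ∀ I : Idx, I.1 ≤ N →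
      ∫ θ in arc δ I, ∑ k ∈ Finset.Ico I.1 (N + 1), β k θ ≤ c * len I) :
    ∫ θ, ∑ k ∈ Finset.range (N + 1), β k θ * w k θ ≤ c * ∫ θ, w N θ := by
  -- The increments of `w`, with the convention that `w` vanishes before generation `0`.
  set d : ℕ → Circ → ℝ := fun n θ => if n = 0 then w 0 θ else w n θ - w (n - 1) θ with hd
  have hsum : ∀ k θ, w k θ = ∑ n ∈ Finset.Ico 0 (k + 1), d n θ := by
    intro k θ
    induction k with
    | zero => simp [hd]
    | succ k ih => rw [Finset.sum_Ico_succ_top (by omega), ← ih]; simp [hd]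
  have hd0 : ∀ n θ, 0 ≤ d n θ := by
    intro n θ
    rcases n with _ | n
    · simpa [hd] using hw0 θ
    · simpa [hd] using hmono n θ
  have hda : ∀ n, Adapted δ n (d n) := by
    intro n θ η h
    simp only [hd]
    rw [hw n h, hw 0 (node_eq_of_le δ n.zero_le h), hw (n - 1) (node_eq_of_le δ (by omega) h)]
  have hint : ∀ n, Integrable (fun θ => ∑ k ∈ Finset.Ico n (N + 1), β k θ)
      (volume : Measure Circ) := fun n => integrable_finsetSum _ fun k _ => hβ k
  have e1 : ∀ θ, ∑ k ∈ Finset.range (N + 1), β k θ * w k θ =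
      ∑ n ∈ Finset.Ico 0 (N + 1), d n θ * ∑ k ∈ Finset.Ico n (N + 1), β k θ := by
    intro θ
    simp_rw [hsum, Finset.mul_sum, Finset.range_eq_Ico]
    rw [Finset.sum_Ico_Ico_comm]
    simp_rw [mul_comm]
  simp_rw [e1]
  rw [integral_finsetSum _ fun n _ => (hda n).integrable_mul (hint n)]
  simp_rw [hsum N]
  rw [integral_finsetSum _ fun n _ => (hda n).integrable, Finset.mul_sum]
  refine Finset.sum_le_sum fun n hn => ?_
  have := (hda n).integral_mul_mono (hd0 n) (hint n) (integrable_const c) fun θ _ => by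
    rw [setIntegral_arc_const, smul_eq_mul, mul_comm (len _) c]
    exact h (node δ n θ) (by simp at hn ⊢; omega)
  rwa [integral_mul_const, mul_comm _ c] at this

/-- The duality between a square function and a Carleson sequence, by the Garsia-Herz method: with
`S_k = (a_0 + ⋯ + a_k)^{1/2}` one has `√(a_k β_k) ≤ B (S_k - S_{k-1}) + β_k S_k / (2 B)`. The first
terms telescope and the second ones are summed by parts. -/
lemma integral_sum_sqrt_mul_le {δ B : ℝ} (hB : 0 < B) {N : ℕ} {a β : ℕ → Circ → ℝ}
    (ha : ∀ k, Adapted δ k (a k)) (hβ : ∀ k, Adapted δ k (β k))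
    (ha0 : ∀ k θ, 0 ≤ a k θ) (hβ0 : ∀ k θ, 0 ≤ β k θ)
    (h : ∀ I : Idx, ∀ n, ∫ θ in arc δ I, ∑ k ∈ Finset.Ico I.1 n, β k θ ≤ B ^ 2 * len I) :
    ∫ θ, ∑ k ∈ Finset.range N, Real.sqrt (a k θ * β k θ) ≤
      3 / 2 * B * ∫ θ, Real.sqrt (∑ k ∈ Finset.range N, a k θ) := by
  rcases N with _ | N
  · simp
  set S : ℕ → Circ → ℝ := fun n θ => Real.sqrt (∑ k ∈ Finset.range n, a k θ) with hS
  have hS0 : ∀ n θ, 0 ≤ S n θ := fun n θ => Real.sqrt_nonneg _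
  have hSsq : ∀ n θ, S (n + 1) θ ^ 2 = S n θ ^ 2 + a n θ := by
    intro n θ
    simp only [hS]
    rw [Real.sq_sqrt (Finset.sum_nonneg fun k _ => ha0 k θ),
      Real.sq_sqrt (Finset.sum_nonneg fun k _ => ha0 k θ), Finset.sum_range_succ]
  have hSmono : ∀ n θ, S n θ ≤ S (n + 1) θ := by
    intro n θ
    refine Real.sqrt_le_sqrt ?_
    rw [Finset.sum_range_succ]
    linarith [ha0 n θ]
  have hSa : ∀ n, Adapted δ n (S (n + 1)) := by
    intro n θ η hθ
    simp only [hS]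
    congr 1
    exact Finset.sum_congr rfl fun k hk =>
      ha k (node_eq_of_le δ (by simpa [Nat.lt_succ_iff] using hk) hθ)
  have hSi : ∀ n, Integrable (S (n + 1)) (volume : Measure Circ) := fun n => (hSa n).integrable
  have hpt : ∀ k θ, Real.sqrt (a k θ * β k θ) ≤
      B * (S (k + 1) θ - S k θ) + (2 * B)⁻¹ * (β k θ * S (k + 1) θ) := by
    intro k θ
    have hX : 0 ≤ S (k + 1) θ - S k θ := sub_nonneg.2 (hSmono k θ)
    have hY : 0 ≤ β k θ * S (k + 1) θ := mul_nonneg (hβ0 k θ) (hS0 _ θ)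
    have hZ : 0 ≤ (2 * B)⁻¹ * (β k θ * S (k + 1) θ) := mul_nonneg (by positivity) hY
    refine Real.sqrt_le_iff.2 ⟨add_nonneg (mul_nonneg hB.le hX) hZ, ?_⟩
    have h1 : a k θ ≤ 2 * S (k + 1) θ * (S (k + 1) θ - S k θ) := by
      nlinarith [hSsq k θ, hS0 k θ, hS0 (k + 1) θ]
    have h2 := four_mul_le_sq_add (B * (S (k + 1) θ - S k θ)) ((2 * B)⁻¹ * (β k θ * S (k + 1) θ))
    have h3 : 4 * (B * (S (k + 1) θ - S k θ)) * ((2 * B)⁻¹ * (β k θ * S (k + 1) θ)) =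
        2 * S (k + 1) θ * (S (k + 1) θ - S k θ) * β k θ := by
      field_simp; ring
    rw [h3] at h2
    exact (mul_le_mul_of_nonneg_right h1 (hβ0 k θ)).trans h2
  have hβw : ∀ k, Integrable (fun θ => β k θ * S (k + 1) θ) (volume : Measure Circ) :=
    fun k => (hβ k).integrable_mul (hSi k)
  have hcar := integral_sum_mul_le (δ := δ) (c := B ^ 2) (N := N) (β := β)
    (w := fun k => S (k + 1)) (fun k => (hβ k).integrable) hSa (fun θ => hS0 _ θ)
    (fun k θ => hSmono _ θ) fun I _ => h I _
  have htel : ∀ θ, ∑ k ∈ Finset.range (N + 1), (B * (S (k + 1) θ - S k θ) +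
      (2 * B)⁻¹ * (β k θ * S (k + 1) θ)) = B * S (N + 1) θ +
      (2 * B)⁻¹ * ∑ k ∈ Finset.range (N + 1), β k θ * S (k + 1) θ := by
    intro θ
    rw [Finset.sum_add_distrib, ← Finset.mul_sum, ← Finset.mul_sum,
      Finset.sum_range_sub (fun k => S k θ)]
    simp [hS]
  have hint : Integrable (fun θ => ∑ k ∈ Finset.range (N + 1), β k θ * S (k + 1) θ)
      (volume : Measure Circ) := integrable_finsetSum _ fun k _ => hβw k
  have hleft : Integrable (fun θ => ∑ k ∈ Finset.range (N + 1), Real.sqrt (a k θ * β k θ))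
      (volume : Measure Circ) := integrable_finsetSum _ fun k _ =>
    Adapted.integrable (δ := δ) (k := k) fun θ η hθ => by simp only [ha k hθ, hβ k hθ]
  calc ∫ θ, ∑ k ∈ Finset.range (N + 1), Real.sqrt (a k θ * β k θ)
      ≤ ∫ θ, (B * S (N + 1) θ +
        (2 * B)⁻¹ * ∑ k ∈ Finset.range (N + 1), β k θ * S (k + 1) θ) := by
        refine integral_mono hleft (((hSi N).const_mul B).add (hint.const_mul _)) fun θ => ?_
        simp only [← htel θ]
        exact Finset.sum_le_sum fun k _ => hpt k θ
    _ = B * (∫ θ, S (N + 1) θ) +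
        (2 * B)⁻¹ * ∫ θ, ∑ k ∈ Finset.range (N + 1), β k θ * S (k + 1) θ := by
        rw [integral_add ((hSi N).const_mul B) (hint.const_mul _), integral_const_mul,
          integral_const_mul]
    _ ≤ B * (∫ θ, S (N + 1) θ) + (2 * B)⁻¹ * (B ^ 2 * ∫ θ, S (N + 1) θ) := by gcongr
    _ = 3 / 2 * B * ∫ θ, S (N + 1) θ := by field_simp; ring

/-- A nonnegative function `V` on the tree that dominates `q` plus its values at the two halves
dominates the whole sum of `q` below an arc. -/
lemma setIntegral_sum_div_len_le {δ : ℝ} {q V : Idx → ℝ} (hV0 : ∀ I, 0 ≤ V I)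
    (hV : ∀ I, V (left I) + V (right I) + q I ≤ V I) (I : Idx) (n : ℕ) :
    ∫ θ in arc δ I, ∑ k ∈ Finset.Ico I.1 n, q (node δ k θ) / len (node δ k θ) ≤ V I := by
  have hint : ∀ k, Integrable (fun θ => q (node δ k θ) / len (node δ k θ))
      (volume : Measure Circ) := fun k =>
    (adapted_node δ k fun J => q J / len J).integrable
  have key : ∀ d : ℕ, ∀ I : Idx, ∫ θ in arc δ I, ∑ k ∈ Finset.Ico I.1 (I.1 + d),
      q (node δ k θ) / len (node δ k θ) ≤ V I := by
    intro d
    induction d with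
    | zero => intro I; simpa using hV0 I
    | succ d ih =>
      intro I
      have hi : Integrable (fun θ => ∑ k ∈ Finset.Ico (I.1 + 1) (I.1 + 1 + d),
          q (node δ k θ) / len (node δ k θ)) (volume : Measure Circ) :=
        integrable_finsetSum _ fun k _ => hint k
      have e : ∀ θ, ∑ k ∈ Finset.Ico I.1 (I.1 + (d + 1)), q (node δ k θ) / len (node δ k θ) =
          q (node δ I.1 θ) / len (node δ I.1 θ) + ∑ k ∈ Finset.Ico (I.1 + 1) (I.1 + 1 + d),
          q (node δ k θ) / len (node δ k θ) := by
        intro θ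
        rw [Finset.sum_eq_sum_Ico_succ_bot (by omega), add_right_comm, add_assoc]
      simp_rw [e]
      rw [integral_add (hint I.1).integrableOn hi.integrableOn, setIntegral_arc δ I hi]
      have e2 : ∫ θ in arc δ I, q (node δ I.1 θ) / len (node δ I.1 θ) = q I := by
        rw [setIntegral_congr_fun (g := fun _ => q I / len I) (measurableSet_arc δ I),
          setIntegral_arc_const, smul_eq_mul, mul_div_cancel₀ _ (len_pos I).ne']
        intro θ hθ
        simp only [(mem_arc_iff δ I θ).1 hθ]
      rw [e2]
      have h1 := ih (left I)
      have h2 := ih (right I)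
      simp only [left_fst, right_fst] at h1 h2
      linarith [hV I]
  rcases le_total I.1 n with h | h
  · obtain ⟨d, rfl⟩ := Nat.exists_eq_add_of_le h
    exact key d I
  · simpa [Finset.Ico_eq_empty_of_le h] using hV0 I

/-! ### Mean values, oscillation and Haar coefficients -/

/-- The mean value of `b` over a dyadic arc. -/
noncomputable def avg (δ : ℝ) (b : Circ → ℂ) (I : Idx) : ℂ :=
  (len I : ℂ)⁻¹ * ∫ θ in arc δ I, b θ

/-- The oscillation `∫_I |b - ⟨b⟩_I|²`, not divided by `|I|`. -/
noncomputable def var (δ : ℝ) (b : Circ → ℂ) (I : Idx) : ℝ :=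
  ∫ θ in arc δ I, ‖b θ - avg δ b I‖ ^ 2

lemma var_nonneg (δ : ℝ) (b : Circ → ℂ) (I : Idx) : 0 ≤ var δ b I :=
  integral_nonneg fun _ => by positivity

lemma len_ne_zero (I : Idx) : (len I : ℂ) ≠ 0 := by exact_mod_cast (len_pos I).ne'

lemma sqrt_len_pos (I : Idx) : 0 < Real.sqrt (len I) := Real.sqrt_pos.2 (len_pos I)

lemma ofReal_sqrt_len_mul_self (I : Idx) :
    (Real.sqrt (len I) : ℂ) * (Real.sqrt (len I) : ℂ) = (len I : ℂ) := by
  exact_mod_cast Real.mul_self_sqrt (len_pos I).le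

lemma len_mul_avg (δ : ℝ) (b : Circ → ℂ) (I : Idx) :
    (len I : ℂ) * avg δ b I = ∫ θ in arc δ I, b θ := by
  rw [avg, mul_inv_cancel_left₀ (len_ne_zero I)]

lemma coeff_eq_setIntegral (δ : ℝ) (F : Circ → ℂ) (I : Idx) :
    coeff δ F I = ∫ θ in arc δ I, F θ * (haar δ I θ : ℂ) := by
  rw [coeff, setIntegral_eq_integral_of_forall_compl_eq_zero]
  intro θ hθ
  rw [haar_of_notMem δ hθ]; simp

lemma integrable_mul_haar' (δ : ℝ) (I : Idx) {F : Circ → ℂ}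
    (hF : Integrable F (volume : Measure Circ)) :
    Integrable (fun θ => F θ * (haar δ I θ : ℂ)) (volume : Measure Circ) := by
  refine hF.mul_bdd (c := (Real.sqrt (len I))⁻¹)
    (Complex.measurable_ofReal.comp (measurable_haar δ I)).aestronglyMeasurable
    (Eventually.of_forall fun θ => ?_)
  rw [Complex.norm_real]
  exact abs_haar_le δ I θ

lemma coeff_eq (δ : ℝ) {F : Circ → ℂ} (hF : Integrable F (volume : Measure Circ)) (I : Idx) :
    coeff δ F I = (Real.sqrt (len I) : ℂ)⁻¹ *
      ((∫ θ in arc δ (left I), F θ) - ∫ θ in arc δ (right I), F θ) := by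
  rw [coeff_eq_setIntegral, setIntegral_arc δ I (integrable_mul_haar' δ I hF), mul_sub,
    ← integral_const_mul, ← integral_const_mul, sub_eq_add_neg, ← integral_neg]
  congr 1
  · refine setIntegral_congr_fun (measurableSet_arc _ _) fun θ hθ => ?_
    rw [haar_eq, indicator_of_mem (left_subset δ I hθ), sgn_eq_one δ hθ]
    push_cast; ring
  · refine setIntegral_congr_fun (measurableSet_arc _ _) fun θ hθ => ?_
    rw [haar_eq, indicator_of_mem (right_subset δ I hθ), sgn_eq_neg_one δ hθ]
    push_cast; ring

lemma avg_left (δ : ℝ) {b : Circ → ℂ} (hb : Integrable b (volume : Measure Circ)) (I : Idx) :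
    avg δ b (left I) = avg δ b I + coeff δ b I * (Real.sqrt (len I) : ℂ)⁻¹ := by
  have h2 := ofReal_sqrt_len_mul_self I
  have h3 := len_ne_zero I
  have h1 : (Real.sqrt (len I) : ℂ) ≠ 0 := by exact_mod_cast (sqrt_len_pos I).ne'
  rw [coeff_eq δ hb, avg, avg, setIntegral_arc δ I hb, len_left]
  push_cast
  rw [← h2]
  field_simp
  ring

lemma avg_right (δ : ℝ) {b : Circ → ℂ} (hb : Integrable b (volume : Measure Circ)) (I : Idx) :
    avg δ b (right I) = avg δ b I - coeff δ b I * (Real.sqrt (len I) : ℂ)⁻¹ := by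
  have h2 := ofReal_sqrt_len_mul_self I
  have h3 := len_ne_zero I
  have h1 : (Real.sqrt (len I) : ℂ) ≠ 0 := by exact_mod_cast (sqrt_len_pos I).ne'
  rw [coeff_eq δ hb, avg, avg, setIntegral_arc δ I hb, len_right]
  push_cast
  rw [← h2]
  field_simp
  ring

lemma avg_node_succ (δ : ℝ) {b : Circ → ℂ} (hb : Integrable b (volume : Measure Circ)) (k : ℕ)
    (θ : Circ) : avg δ b (node δ (k + 1) θ) = avg δ b (node δ k θ) +
      coeff δ b (node δ k θ) * (haar δ (node δ k θ) θ : ℂ) := by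
  rw [haar_node]
  have h0 := mem_arc_node δ (k + 1) θ
  rcases node_succ δ k θ with h | h <;> rw [h] at h0 ⊢
  · have := sgn_eq_one δ h0
    rw [node_fst] at this
    rw [avg_left δ hb, this]; push_cast; ring
  · have := sgn_eq_neg_one δ h0
    rw [node_fst] at this
    rw [avg_right δ hb, this]; push_cast; ring

lemma integrable_norm_sub_sq {b : Circ → ℂ} (hb : MemLp b 2 (volume : Measure Circ)) (c : ℂ) :
    Integrable (fun θ => ‖b θ - c‖ ^ 2) (volume : Measure Circ) :=
  (hb.sub (memLp_const c)).norm.integrable_sq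

/-- The variance identity on an arc. -/
lemma setIntegral_norm_sub_sq {δ : ℝ} {b : Circ → ℂ} (hb : MemLp b 2 (volume : Measure Circ))
    (I : Idx) (c : ℂ) :
    ∫ θ in arc δ I, ‖b θ - c‖ ^ 2 = var δ b I + len I * ‖avg δ b I - c‖ ^ 2 := by
  have hbi : Integrable b (volume : Measure Circ) := hb.integrable (by norm_num)
  set a := avg δ b I with ha
  have h0 : Integrable (fun θ => b θ - a) (volume : Measure Circ) := hbi.sub (integrable_const a)
  have h1 := integrable_norm_sub_sq hb a
  have h2 : Integrable (fun θ => 2 * inner ℝ (a - c) (b θ - a)) (volume : Measure Circ) :=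
    (h0.const_inner _).const_mul 2
  have e : ∀ θ, ‖b θ - c‖ ^ 2 =
      ‖b θ - a‖ ^ 2 + 2 * inner ℝ (a - c) (b θ - a) + ‖a - c‖ ^ 2 := by
    intro θ
    rw [real_inner_comm, ← norm_add_sq_real]
    congr 2; ring
  simp_rw [e]
  have h12 : Integrable (fun θ => ‖b θ - a‖ ^ 2 + 2 * inner ℝ (a - c) (b θ - a))
      (volume : Measure Circ) := h1.add h2
  rw [integral_add h12.integrableOn (integrable_const _),
    integral_add h1.integrableOn h2.integrableOn, integral_const_mul,
    integral_inner h0.integrableOn, integral_sub hbi.integrableOn (integrable_const _),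
    ← len_mul_avg, setIntegral_arc_const, setIntegral_arc_const, ← ha]
  simp [var, ← ha]

/-- The variance on an arc splits into those on its halves and the Haar coefficient. Together with
`setIntegral_sum_div_len_le` it replaces Bessel's inequality on arcs. -/
lemma var_eq {δ : ℝ} {b : Circ → ℂ} (hb : MemLp b 2 (volume : Measure Circ)) (I : Idx) :
    var δ b I = var δ b (left I) + var δ b (right I) + ‖coeff δ b I‖ ^ 2 := by
  have hbi : Integrable b (volume : Measure Circ) := hb.integrable (by norm_num)
  have hs := Real.sq_sqrt (len_pos I).le
  have hs0 := sqrt_len_pos I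
  rw [var, setIntegral_arc δ I (integrable_norm_sub_sq hb _), setIntegral_norm_sub_sq hb,
    setIntegral_norm_sub_sq hb, avg_left δ hbi, avg_right δ hbi, add_sub_cancel_left,
    sub_sub_cancel_left, norm_neg, norm_mul, norm_inv, Complex.norm_real,
    Real.norm_of_nonneg hs0.le, len_left, len_right, mul_pow, inv_pow, hs]
  have := (len_pos I).ne'
  field_simp
  ring

lemma setIntegral_norm_sub_avg_le {δ B : ℝ} (hB : 0 < B) {b : Circ → ℂ}
    (hb : MemLp b 2 (volume : Measure Circ)) (hvar : ∀ I, var δ b I ≤ B ^ 2 * len I) (I : Idx) :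
    ∫ θ in arc δ I, ‖b θ - avg δ b I‖ ≤ B * len I := by
  have hbi : Integrable b (volume : Measure Circ) := hb.integrable (by norm_num)
  have h1 := integrable_norm_sub_sq hb (avg δ b I)
  have h2 : ∀ θ, ‖b θ - avg δ b I‖ ≤ (2 * B)⁻¹ * ‖b θ - avg δ b I‖ ^ 2 + B / 2 := by
    intro θ
    set x := ‖b θ - avg δ b I‖
    have h : (2 * B)⁻¹ * x ^ 2 + B / 2 - x = (2 * B)⁻¹ * (x - B) ^ 2 := by field_simp; ring
    have : 0 ≤ (2 * B)⁻¹ * (x - B) ^ 2 := by positivity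
    linarith
  calc ∫ θ in arc δ I, ‖b θ - avg δ b I‖
      ≤ ∫ θ in arc δ I, ((2 * B)⁻¹ * ‖b θ - avg δ b I‖ ^ 2 + B / 2) :=
        setIntegral_mono (hbi.sub (integrable_const _)).norm.integrableOn
          ((h1.const_mul _).add (integrable_const _)).integrableOn h2
    _ = (2 * B)⁻¹ * var δ b I + len I * (B / 2) := by
        rw [integral_add (h1.const_mul _).integrableOn (integrable_const _), integral_const_mul,
          setIntegral_arc_const, var, smul_eq_mul]
    _ ≤ (2 * B)⁻¹ * (B ^ 2 * len I) + len I * (B / 2) := by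
        have := hvar I
        gcongr
    _ = B * len I := by field_simp; ring

/-! ### The Carleson sequence attached to a function of bounded mean oscillation -/

/-- The coefficient `∫ (b - ⟨b⟩_I) g h_I`. -/
noncomputable def oscCoeff (δ : ℝ) (b g : Circ → ℂ) (I : Idx) : ℂ :=
  coeff δ (fun θ => (b θ - avg δ b I) * g θ) I

/-- The mean value of `(b - ⟨b⟩_I) g` over `I`, the covariance of `b` and `g` on `I`. -/
noncomputable def cov (δ : ℝ) (b g : Circ → ℂ) (I : Idx) : ℂ :=
  avg δ (fun θ => (b θ - avg δ b I) * g θ) I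

section

variable {δ B : ℝ} {b g : Circ → ℂ}

lemma integrable_sub_const_mul (hb : Integrable b (volume : Measure Circ))
    (hg : AEStronglyMeasurable g (volume : Measure Circ)) (hg1 : ∀ θ, ‖g θ‖ ≤ 1) (c : ℂ) :
    Integrable (fun θ => (b θ - c) * g θ) (volume : Measure Circ) :=
  (hb.sub (integrable_const c)).mul_bdd hg (Eventually.of_forall hg1)

lemma memLp_of_norm_le_one (hg : AEStronglyMeasurable g (volume : Measure Circ))
    (hg1 : ∀ θ, ‖g θ‖ ≤ 1) : MemLp g 2 (volume : Measure Circ) :=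
  MemLp.of_bound hg 1 (Eventually.of_forall hg1)

lemma setIntegral_sub_mul (hb : Integrable b (volume : Measure Circ))
    (hg : AEStronglyMeasurable g (volume : Measure Circ)) (hg1 : ∀ θ, ‖g θ‖ ≤ 1) (I : Idx)
    (c : ℂ) : ∫ θ in arc δ I, (b θ - c) * g θ =
      len I * (cov δ b g I + (avg δ b I - c) * avg δ g I) := by
  have hgi : Integrable g (volume : Measure Circ) :=
    (memLp_of_norm_le_one hg hg1).integrable (by norm_num)
  have e : ∀ θ, (b θ - c) * g θ = (b θ - avg δ b I) * g θ + (avg δ b I - c) * g θ := fun θ => by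
    ring
  simp_rw [e]
  rw [integral_add (integrable_sub_const_mul hb hg hg1 _).integrableOn
    (hgi.const_mul _).integrableOn, integral_const_mul, ← len_mul_avg, ← len_mul_avg]
  simp only [cov]
  ring

lemma cov_eq (hb : Integrable b (volume : Measure Circ))
    (hg : AEStronglyMeasurable g (volume : Measure Circ)) (hg1 : ∀ θ, ‖g θ‖ ≤ 1) (I : Idx) :
    cov δ b g I = (cov δ b g (left I) + cov δ b g (right I)) / 2 +
      coeff δ b I * coeff δ g I / len I := by
  have hgi : Integrable g (volume : Measure Circ) :=
    (memLp_of_norm_le_one hg hg1).integrable (by norm_num)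
  have h2 := ofReal_sqrt_len_mul_self I
  have h3 := len_ne_zero I
  have h1 : (Real.sqrt (len I) : ℂ) ≠ 0 := by exact_mod_cast (sqrt_len_pos I).ne'
  rw [cov, avg, setIntegral_arc δ I (integrable_sub_const_mul hb hg hg1 _),
    setIntegral_sub_mul hb hg hg1, setIntegral_sub_mul hb hg hg1, avg_left δ hb, avg_right δ hb,
    avg_left δ hgi, avg_right δ hgi, len_left, len_right]
  push_cast
  rw [← h2]
  field_simp
  ring

lemma oscCoeff_eq (hb : Integrable b (volume : Measure Circ))
    (hg : AEStronglyMeasurable g (volume : Measure Circ)) (hg1 : ∀ θ, ‖g θ‖ ≤ 1) (I : Idx) :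
    oscCoeff δ b g I = Real.sqrt (len I) / 2 * (cov δ b g (left I) - cov δ b g (right I)) +
      coeff δ b I * avg δ g I := by
  have hgi : Integrable g (volume : Measure Circ) :=
    (memLp_of_norm_le_one hg hg1).integrable (by norm_num)
  have h2 := ofReal_sqrt_len_mul_self I
  have h1 : (Real.sqrt (len I) : ℂ) ≠ 0 := by exact_mod_cast (sqrt_len_pos I).ne'
  rw [oscCoeff, coeff_eq δ (integrable_sub_const_mul hb hg hg1 _),
    setIntegral_sub_mul hb hg hg1, setIntegral_sub_mul hb hg hg1, avg_left δ hb, avg_right δ hb,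
    avg_left δ hgi, avg_right δ hgi, len_left, len_right]
  push_cast
  rw [← h2]
  field_simp
  ring

lemma norm_avg_le_of_norm_le {F : Circ → ℂ} {u : Circ → ℝ} {A : ℝ} {I : Idx}
    (hu : Integrable u (volume : Measure Circ)) (hF : ∀ θ, ‖F θ‖ ≤ u θ)
    (h : ∫ θ in arc δ I, u θ ≤ A * len I) : ‖avg δ F I‖ ≤ A := by
  have hl := len_pos I
  rw [avg, norm_mul, norm_inv, Complex.norm_real, Real.norm_of_nonneg hl.le,
    inv_mul_le_iff₀ hl, mul_comm (len I) A]
  exact (norm_integral_le_of_norm_le hu.integrableOn (Eventually.of_forall hF)).trans h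

lemma norm_cov_le (hB : 0 < B) (hb : MemLp b 2 (volume : Measure Circ))
    (hvar : ∀ I, var δ b I ≤ B ^ 2 * len I) (hg1 : ∀ θ, ‖g θ‖ ≤ 1) (I : Idx) :
    ‖cov δ b g I‖ ≤ B := by
  have hbi : Integrable b (volume : Measure Circ) := hb.integrable (by norm_num)
  refine norm_avg_le_of_norm_le (hbi.sub (integrable_const (avg δ b I))).norm (fun θ => ?_)
    (setIntegral_norm_sub_avg_le hB hb hvar I)
  rw [norm_mul]
  exact mul_le_of_le_one_right (norm_nonneg _) (hg1 θ)

lemma norm_avg_le_one (hg1 : ∀ θ, ‖g θ‖ ≤ 1) (I : Idx) : ‖avg δ g I‖ ≤ 1 := by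
  refine norm_avg_le_of_norm_le (integrable_const (1 : ℝ)) hg1 ?_
  rw [setIntegral_arc_const, smul_eq_mul, mul_comm]

lemma var_le_len (hg : AEStronglyMeasurable g (volume : Measure Circ)) (hg1 : ∀ θ, ‖g θ‖ ≤ 1)
    (I : Idx) : var δ g I ≤ len I := by
  have h := setIntegral_norm_sub_sq (δ := δ) (memLp_of_norm_le_one hg hg1) I 0
  have h1 : ∫ θ in arc δ I, ‖g θ - 0‖ ^ 2 ≤ ∫ θ in arc δ I, (1 : ℝ) := by
    refine setIntegral_mono (integrable_norm_sub_sq (memLp_of_norm_le_one hg hg1) 0).integrableOn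
      (integrable_const _).integrableOn fun θ => ?_
    simpa using hg1 θ
  rw [setIntegral_arc_const, smul_eq_mul, mul_one] at h1
  have : 0 ≤ len I * ‖avg δ g I - 0‖ ^ 2 := mul_nonneg (len_pos I).le (by positivity)
  linarith

/-- The inequality between quadratic forms behind `norm_oscCoeff_sq_le`. By the parallelogram law,
what `|x|²` and `|y|²` exceed the square of their midpoint by is a multiple of `|x - y|²`. -/
lemma norm_sq_add_le_of_midpoint {s B : ℝ} (hs : 0 < s) {w x y β γ m : ℂ}
    (hw : w = (x + y) / 2 + β * γ / (s ^ 2 : ℝ)) (hwB : ‖w‖ ≤ B) (hm : ‖m‖ ≤ 1) :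
    ‖(s : ℂ) / 2 * (x - y) + β * m‖ ^ 2 ≤ 4 * ‖β‖ ^ 2 + 2 * B ^ 2 * ‖γ‖ ^ 2 +
      2 * (s ^ 2 / 2 * ‖x‖ ^ 2 + s ^ 2 / 2 * ‖y‖ ^ 2 - s ^ 2 * ‖w‖ ^ 2) := by
  have hs2 : (0 : ℝ) < s ^ 2 := by positivity
  set e : ℂ := β * γ / (s ^ 2 : ℝ) with he
  have hen : s ^ 2 * ‖e‖ = ‖β‖ * ‖γ‖ := by
    rw [he, norm_div, norm_mul, Complex.norm_real, Real.norm_of_nonneg hs2.le]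
    field_simp
  have hpar := parallelogram_law_with_norm ℝ x y
  have hxy : ‖x + y‖ = 2 * ‖w - e‖ := by
    have : x + y = 2 * (w - e) := by rw [hw]; ring
    rw [this, norm_mul]; norm_num
  have hwe : ‖w‖ ≤ ‖w - e‖ + ‖e‖ := by simpa using norm_add_le (w - e) e
  have hwe2 : ‖w‖ ^ 2 - 2 * ‖w‖ * ‖e‖ ≤ ‖w - e‖ ^ 2 := by
    rcases le_total ‖w‖ (‖e‖) with h | h
    · nlinarith [norm_nonneg w, norm_nonneg e, sq_nonneg ‖w - e‖]
    · nlinarith [norm_nonneg w, norm_nonneg e, norm_nonneg (w - e)]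
  have hc : ‖(s : ℂ) / 2 * (x - y) + β * m‖ ≤ s / 2 * ‖x - y‖ + ‖β‖ := by
    refine (norm_add_le _ _).trans (add_le_add ?_ ?_)
    · rw [norm_mul, norm_div, Complex.norm_real, Real.norm_of_nonneg hs.le]; norm_num
    · rw [norm_mul]; exact mul_le_of_le_one_right (norm_nonneg _) hm
  have hc2 : ‖(s : ℂ) / 2 * (x - y) + β * m‖ ^ 2 ≤ 2 * (s ^ 2 / 4 * ‖x - y‖ ^ 2) + 2 * ‖β‖ ^ 2 := by
    refine (pow_le_pow_left₀ (norm_nonneg _) hc 2).trans ?_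
    nlinarith [sq_nonneg (s / 2 * ‖x - y‖ - ‖β‖)]
  have h4 : s ^ 2 * (2 * ‖w‖ * ‖e‖) ≤ ‖β‖ ^ 2 + B ^ 2 * ‖γ‖ ^ 2 := by
    have h5 : s ^ 2 * (2 * ‖w‖ * ‖e‖) = 2 * ‖w‖ * (‖β‖ * ‖γ‖) := by rw [← hen]; ring
    have h6 : 2 * ‖w‖ * (‖β‖ * ‖γ‖) ≤ 2 * B * (‖β‖ * ‖γ‖) := by gcongr
    nlinarith [sq_nonneg (‖β‖ - B * ‖γ‖)]
  have h7 := mul_le_mul_of_nonneg_left hwe2 hs2.le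
  have h8 : s ^ 2 * ‖x - y‖ ^ 2 = 2 * s ^ 2 * (‖x‖ ^ 2 + ‖y‖ ^ 2) - 4 * (s ^ 2 * ‖w - e‖ ^ 2) := by
    rw [hxy] at hpar
    linear_combination s ^ 2 * hpar
  nlinarith

lemma norm_oscCoeff_sq_le (hB : 0 < B) (hb : MemLp b 2 (volume : Measure Circ))
    (hvar : ∀ I, var δ b I ≤ B ^ 2 * len I)
    (hg : AEStronglyMeasurable g (volume : Measure Circ)) (hg1 : ∀ θ, ‖g θ‖ ≤ 1) (I : Idx) :
    ‖oscCoeff δ b g I‖ ^ 2 ≤ 4 * ‖coeff δ b I‖ ^ 2 + 2 * B ^ 2 * ‖coeff δ g I‖ ^ 2 +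
      2 * (len I / 2 * ‖cov δ b g (left I)‖ ^ 2 + len I / 2 * ‖cov δ b g (right I)‖ ^ 2 -
        len I * ‖cov δ b g I‖ ^ 2) := by
  have hbi : Integrable b (volume : Measure Circ) := hb.integrable (by norm_num)
  have hs := Real.sq_sqrt (len_pos I).le
  rw [oscCoeff_eq hbi hg hg1]
  have h := norm_sq_add_le_of_midpoint (sqrt_len_pos I) (w := cov δ b g I)
    (x := cov δ b g (left I)) (y := cov δ b g (right I)) (β := coeff δ b I) (γ := coeff δ g I)
    (m := avg δ g I) (by rw [hs]; exact cov_eq hbi hg hg1 I) (norm_cov_le hB hb hvar hg1 I)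
    (norm_avg_le_one hg1 I)
  rwa [hs] at h

/-- The coefficients `∫ (b - ⟨b⟩_I) g h_I` form a Carleson sequence when `b` has bounded mean
oscillation and `|g| ≤ 1`. -/
lemma setIntegral_sum_oscCoeff_le (hB : 0 < B) (hb : MemLp b 2 (volume : Measure Circ))
    (hvar : ∀ I, var δ b I ≤ B ^ 2 * len I)
    (hg : AEStronglyMeasurable g (volume : Measure Circ)) (hg1 : ∀ θ, ‖g θ‖ ≤ 1) (I : Idx)
    (n : ℕ) : ∫ θ in arc δ I, ∑ k ∈ Finset.Ico I.1 n,
      ‖oscCoeff δ b g (node δ k θ)‖ ^ 2 / len (node δ k θ) ≤ (3 * B) ^ 2 * len I := by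
  have hcov : ∀ J, ‖cov δ b g J‖ ^ 2 ≤ B ^ 2 := fun J =>
    pow_le_pow_left₀ (norm_nonneg _) (norm_cov_le hB hb hvar hg1 J) 2
  have hcl : ∀ J, len J * ‖cov δ b g J‖ ^ 2 ≤ len J * B ^ 2 := fun J =>
    mul_le_mul_of_nonneg_left (hcov J) (len_pos J).le
  have hB2 : 0 < B ^ 2 := by positivity
  -- The potential: each of the terms on the right of `norm_oscCoeff_sq_le` is a difference between
  -- an arc and its halves.
  refine (setIntegral_sum_div_len_le (δ := δ) (q := fun J => ‖oscCoeff δ b g J‖ ^ 2)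
    (V := fun J => 4 * var δ b J + 2 * B ^ 2 * var δ g J +
      2 * (len J * B ^ 2 - len J * ‖cov δ b g J‖ ^ 2)) (fun J => ?_) (fun J => ?_) I n).trans ?_
  · have h1 := var_nonneg δ b J
    have h2 := mul_nonneg hB2.le (var_nonneg δ g J)
    linarith [hcl J]
  · have h1 := var_eq (δ := δ) hb J
    have h2 := var_eq (δ := δ) (memLp_of_norm_le_one hg hg1) J
    have h3 := norm_oscCoeff_sq_le hB hb hvar hg hg1 J
    simp only [len_left, len_right]
    rw [h1, h2]
    linarith
  · have h1 := hvar I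
    have h2 := mul_le_mul_of_nonneg_left (var_le_len (δ := δ) hg hg1 I) hB2.le
    have h3 : 0 ≤ len I * ‖cov δ b g I‖ ^ 2 := mul_nonneg (len_pos I).le (by positivity)
    have h4 : 0 ≤ B ^ 2 * len I := mul_nonneg hB2.le (len_pos I).le
    linarith

end

/-! ### Norms in real terms -/

/-- `b` is square integrable, with mean oscillation at most `B` on every dyadic arc and
`|∫ b| ≤ B`, where `B > 0`. -/
structure IsBMO (δ B : ℝ) (b : Circ → ℂ) : Prop where
  pos : 0 < B
  memLp : MemLp b 2 (volume : Measure Circ)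
  var_le : ∀ I, var δ b I ≤ B ^ 2 * len I
  norm_integral_le : ‖∫ θ, b θ‖ ≤ B

/-- The arc of generation `0`, that is, the whole circle. -/
def root : Idx := ⟨0, 0⟩

lemma node_zero (δ : ℝ) (θ : Circ) : node δ 0 θ = root := by
  have h : (node δ 0 θ).2 = 0 := Subsingleton.elim (α := Fin 1) _ _
  exact congrArg (fun m => (⟨0, m⟩ : Idx)) h

lemma arc_root (δ : ℝ) : arc δ root = univ :=
  eq_univ_of_forall fun θ => (mem_arc_iff δ root θ).2 (node_zero δ θ)

lemma len_root : len root = 2 * Real.pi := by simp [len, root]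

lemma isBMO_of_BMONorm_le {δ B : ℝ} (hB : 0 < B) {b : L1}
    (h : BMONorm δ b ≤ ENNReal.ofReal B) : IsBMO δ B b := by
  have hbi : Integrable b (volume : Measure Circ) := L1.integrable_coeFn b
  have hosc : ∀ I, ∫⁻ θ in arc δ I, ‖b θ - avg δ b I‖ₑ ^ 2 ≤ ENNReal.ofReal (B ^ 2 * len I) := by
    intro I
    have h1 : (⨆ I : Idx, osc δ b I) ^ (1 / 2 : ℝ) ≤ ENNReal.ofReal B := le_self_add.trans h
    have h2 : (⨆ I : Idx, osc δ b I) ≤ ENNReal.ofReal (B ^ 2) := by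
      have := ENNReal.rpow_le_rpow h1 (z := 2) (by norm_num)
      rw [← ENNReal.rpow_mul] at this
      norm_num at this
      rw [ENNReal.ofReal_pow hB.le]
      exact iSup_le this
    have h3 := (le_iSup (osc δ b) I).trans h2
    have hl0 : ENNReal.ofReal (len I) ≠ 0 := by simpa using len_pos I
    rw [osc, mul_comm, ← div_eq_mul_inv,
      ENNReal.div_le_iff hl0 ENNReal.ofReal_ne_top, ← ENNReal.ofReal_mul (by positivity)] at h3
    exact h3
  have hmem : MemLp b 2 (volume : Measure Circ) := by
    have h1 := hosc root
    rw [arc_root, Measure.restrict_univ] at h1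
    have h2 : MemLp (fun θ => b θ - avg δ b root) 2 (volume : Measure Circ) := by
      refine ⟨hbi.aestronglyMeasurable.sub aestronglyMeasurable_const, ?_⟩
      rw [eLpNorm_lt_top_iff_lintegral_rpow_enorm_lt_top (by norm_num) (by norm_num)]
      refine lt_of_le_of_lt ?_ (h1.trans_lt ENNReal.ofReal_lt_top)
      simp
    have h3 := h2.add (memLp_const (avg δ b root))
    convert h3 using 1
    ext θ; simp
  refine ⟨hB, hmem, fun I => ?_, ?_⟩
  · have h1 := (integrable_norm_sub_sq hmem (avg δ b I)).integrableOn (s := arc δ I)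
    have h2 := ofReal_integral_eq_lintegral_ofReal h1
      (Eventually.of_forall fun θ => by positivity)
    have h3 : ∀ θ, ENNReal.ofReal (‖b θ - avg δ b I‖ ^ 2) = ‖b θ - avg δ b I‖ₑ ^ 2 := fun θ => by
      rw [ENNReal.ofReal_pow (norm_nonneg _), ofReal_norm]
    simp_rw [h3] at h2
    have h4 := h2.trans_le (hosc I)
    exact (ENNReal.ofReal_le_ofReal_iff
      (mul_nonneg (by positivity) (len_pos I).le)).1 h4
  · have h1 : ‖∫ θ, b θ‖ₑ ≤ ENNReal.ofReal B := le_add_self.trans h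
    rw [← ofReal_norm] at h1
    exact (ENNReal.ofReal_le_ofReal_iff hB.le).1 h1

namespace IsBMO

variable {δ B : ℝ} {b : Circ → ℂ}

lemma integrable (h : IsBMO δ B b) : Integrable b (volume : Measure Circ) :=
  h.memLp.integrable (by norm_num)

lemma norm_coeff_le (h : IsBMO δ B b) (I : Idx) : ‖coeff δ b I‖ ≤ B * Real.sqrt (len I) := by
  have h1 := var_eq (δ := δ) h.memLp I
  have h2 := h.var_le I
  have h3 := var_nonneg δ b (left I)
  have h4 := var_nonneg δ b (right I)
  refine le_of_sq_le_sq ?_ (mul_nonneg h.pos.le (Real.sqrt_nonneg _))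
  rw [mul_pow, Real.sq_sqrt (len_pos I).le]
  linarith

lemma norm_avg_succ_sub_le (h : IsBMO δ B b) (k : ℕ) (θ : Circ) :
    ‖avg δ b (node δ (k + 1) θ) - avg δ b (node δ k θ)‖ ≤ B := by
  rw [avg_node_succ δ h.integrable, add_sub_cancel_left, norm_mul, Complex.norm_real]
  have hs := sqrt_len_pos (node δ k θ)
  calc _ ≤ B * Real.sqrt (len (node δ k θ)) * (Real.sqrt (len (node δ k θ)))⁻¹ :=
        mul_le_mul (h.norm_coeff_le _) (abs_haar_le δ _ θ) (abs_nonneg _)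
          (mul_nonneg h.pos.le hs.le)
    _ = B := by field_simp

lemma norm_avg_root_le (h : IsBMO δ B b) : ‖avg δ b root‖ ≤ B := by
  rw [avg, arc_root, Measure.restrict_univ, len_root, norm_mul, norm_inv, Complex.norm_real,
    Real.norm_of_nonneg Real.two_pi_pos.le, inv_mul_le_iff₀ Real.two_pi_pos]
  have : 1 ≤ 2 * Real.pi := by linarith [Real.pi_gt_three]
  nlinarith [h.norm_integral_le, h.pos]

lemma norm_avg_node_le (h : IsBMO δ B b) (k : ℕ) (θ : Circ) :
    ‖avg δ b (node δ k θ)‖ ≤ (k + 1) * B := by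
  induction k with
  | zero => simpa [node_zero] using h.norm_avg_root_le
  | succ k ih =>
    have h1 := norm_le_norm_add_norm_sub' (avg δ b (node δ (k + 1) θ)) (avg δ b (node δ k θ))
    have h2 := h.norm_avg_succ_sub_le k θ
    push_cast
    linarith

lemma integral_norm_le (h : IsBMO δ B b) : ∫ θ, ‖b θ‖ ≤ 14 * B := by
  have h1 := setIntegral_norm_sub_avg_le h.pos h.memLp h.var_le root
  have h2 := h.norm_avg_root_le
  have hp := Real.pi_lt_d2
  have hi : Integrable (fun θ => ‖b θ - avg δ b root‖) (volume : Measure Circ) :=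
    (h.integrable.sub (integrable_const _)).norm
  rw [len_root, arc_root, Measure.restrict_univ] at h1
  calc ∫ θ, ‖b θ‖ ≤ ∫ θ, (‖b θ - avg δ b root‖ + ‖avg δ b root‖) := by
        refine integral_mono h.integrable.norm (hi.add (integrable_const _)) fun θ => ?_
        simpa using norm_add_le (b θ - avg δ b root) (avg δ b root)
    _ = (∫ θ, ‖b θ - avg δ b root‖) + 2 * Real.pi * ‖avg δ b root‖ := by
        rw [integral_add hi (integrable_const _), integral_const]
        simp [Measure.real, AddCircle.measure_univ, Real.pi_pos.le]
    _ ≤ 14 * B := by nlinarith [h.pos, Real.pi_pos]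

end IsBMO

/-- The contribution `|c_I|² / |I|` of generation `k` to the square function of a collection. -/
noncomputable def sqTerm (δ : ℝ) (c : Idx → ℂ) (k : ℕ) (θ : Circ) : ℝ :=
  ‖c (node δ k θ)‖ ^ 2 / len (node δ k θ)

lemma sqTerm_nonneg (δ : ℝ) (c : Idx → ℂ) (k : ℕ) (θ : Circ) : 0 ≤ sqTerm δ c k θ :=
  div_nonneg (by positivity) (len_pos _).le

lemma adapted_sqTerm (δ : ℝ) (c : Idx → ℂ) (k : ℕ) : Adapted δ k (sqTerm δ c k) :=
  adapted_node δ k fun I => ‖c I‖ ^ 2 / len I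

lemma tsum_indicator_arc (δ : ℝ) (q : Idx → ℝ≥0∞) (θ : Circ) :
    ∑' I : Idx, (arc δ I).indicator (fun _ => q I) θ = ∑' k, q (node δ k θ) := by
  rw [ENNReal.tsum_sigma']
  refine tsum_congr fun k => ?_
  rw [tsum_fintype]
  exact sum_indicator_arc δ k (fun I _ => q I) θ

lemma squareFn_eq (δ : ℝ) (c : Coeffs) (θ : Circ) : squareFn δ c θ =
    ‖c.zero‖ₑ + (∑' k, ENNReal.ofReal (sqTerm δ c.coef k θ)) ^ (1 / 2 : ℝ) := by
  rw [squareFn, tsum_indicator_arc]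
  congr 2
  refine tsum_congr fun k => ?_
  rw [sqTerm, ENNReal.ofReal_div_of_pos (len_pos _), ENNReal.ofReal_pow (norm_nonneg _),
    ofReal_norm]

lemma ofReal_sqrt_eq_rpow {x : ℝ} (hx : 0 ≤ x) :
    ENNReal.ofReal (Real.sqrt x) = ENNReal.ofReal x ^ (1 / 2 : ℝ) := by
  rw [Real.sqrt_eq_rpow, ENNReal.ofReal_rpow_of_nonneg hx (by norm_num)]

lemma ofReal_sqrt_sum_sqTerm (δ : ℝ) (c : Idx → ℂ) (F : Finset ℕ) (θ : Circ) :
    ENNReal.ofReal (Real.sqrt (∑ k ∈ F, sqTerm δ c k θ)) =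
      (∑ k ∈ F, ENNReal.ofReal (sqTerm δ c k θ)) ^ (1 / 2 : ℝ) := by
  rw [ofReal_sqrt_eq_rpow (Finset.sum_nonneg fun k _ => sqTerm_nonneg δ c k θ),
    ENNReal.ofReal_sum_of_nonneg fun k _ => sqTerm_nonneg δ c k θ]

lemma integrable_sqrt_sum_sqTerm (δ : ℝ) (c : Idx → ℂ) (F : Finset ℕ) :
    Integrable (fun θ => Real.sqrt (∑ k ∈ F, sqTerm δ c k θ)) (volume : Measure Circ) := by
  refine Adapted.integrable (δ := δ) (k := F.sup id) fun θ η h => ?_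
  congr 1
  exact Finset.sum_congr rfl fun k hk => ((adapted_sqTerm δ c k).mono
    (Finset.le_sup (f := id) hk)) h

lemma ofReal_integral_sqrt_sum_sqTerm_le (δ : ℝ) (f : L1) (F : Finset ℕ) :
    ENNReal.ofReal (∫ θ, Real.sqrt (∑ k ∈ F, sqTerm δ (coeff δ f) k θ)) ≤ H1Norm δ f := by
  rw [ofReal_integral_eq_lintegral_ofReal (integrable_sqrt_sum_sqTerm δ _ F)
    (Eventually.of_forall fun θ => Real.sqrt_nonneg _)]
  refine lintegral_mono fun θ => ?_
  rw [ofReal_sqrt_sum_sqTerm, squareFn_eq]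
  exact (ENNReal.rpow_le_rpow (ENNReal.sum_le_tsum F) (by norm_num)).trans le_add_self

lemma norm_mean_le {δ H : ℝ} (hH : 0 ≤ H) {f : L1} (h : H1Norm δ f ≤ ENNReal.ofReal H) :
    2 * Real.pi * ‖mean f‖ ≤ H := by
  have h1 : ∫⁻ _ : Circ, ‖mean f‖ₑ ≤ H1Norm δ f := lintegral_mono fun θ => by
    rw [squareFn_eq]; exact le_self_add
  rw [lintegral_const, AddCircle.measure_univ] at h1
  have h2 := h1.trans h
  rw [← ofReal_norm, ← ENNReal.ofReal_mul (norm_nonneg _), ENNReal.ofReal_le_ofReal_iff hH] at h2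
  linarith

/-- The pairing of a collection with a Carleson sequence is controlled by the square function. -/
lemma sum_norm_mul_le {δ B : ℝ} (hB : 0 < B) {f c : Idx → ℂ}
    (h : ∀ I : Idx, ∀ n, ∫ θ in arc δ I, ∑ k ∈ Finset.Ico I.1 n, sqTerm δ c k θ ≤ B ^ 2 * len I)
    (F : Finset ℕ) :
    ∑ k ∈ F, ∑ m : Fin (2 ^ k), ‖f ⟨k, m⟩‖ * ‖c ⟨k, m⟩‖ ≤
      3 / 2 * B * ∫ θ, Real.sqrt (∑ k ∈ F, sqTerm δ f k θ) := by
  classical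
  have hint : ∀ k, Integrable (fun θ => Real.sqrt (sqTerm δ f k θ * sqTerm δ c k θ))
      (volume : Measure Circ) := fun k => Adapted.integrable (δ := δ) (k := k) fun θ η hθ => by
    simp only [adapted_sqTerm δ f k hθ, adapted_sqTerm δ c k hθ]
  have e1 : ∀ k, ∑ m : Fin (2 ^ k), ‖f ⟨k, m⟩‖ * ‖c ⟨k, m⟩‖ =
      ∫ θ, Real.sqrt (sqTerm δ f k θ * sqTerm δ c k θ) := by
    intro k
    rw [integral_eq_sum_arc δ k (hint k)]
    refine Finset.sum_congr rfl fun m _ => ?_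
    have hl := len_pos ⟨k, m⟩
    rw [setIntegral_congr_fun (g := fun _ => ‖f ⟨k, m⟩‖ * ‖c ⟨k, m⟩‖ / len ⟨k, m⟩)
      (measurableSet_arc δ _), setIntegral_arc_const, smul_eq_mul, mul_div_cancel₀ _ hl.ne']
    intro θ hθ
    have h1 := (mem_arc_iff δ _ θ).1 hθ
    simp only at h1
    simp only [sqTerm, h1]
    rw [← Real.sqrt_sq (x := ‖f ⟨k, m⟩‖ * ‖c ⟨k, m⟩‖ / len ⟨k, m⟩) (by positivity)]
    congr 1
    ring
  obtain ⟨N, hN⟩ := F.exists_nat_subset_range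
  set a : ℕ → Circ → ℝ := fun k θ => if k ∈ F then sqTerm δ f k θ else 0 with ha
  have h1 := integral_sum_sqrt_mul_le (δ := δ) hB (N := N) (a := a) (β := sqTerm δ c)
    (fun k θ η hθ => by simp only [ha, adapted_sqTerm δ f k hθ]) (fun k => adapted_sqTerm δ c k)
    (fun k θ => by
      simp only [ha]
      split_ifs
      exacts [sqTerm_nonneg δ f k θ, le_rfl])
    (fun k θ => sqTerm_nonneg δ c k θ) h
  have e2 : ∀ θ, ∑ k ∈ Finset.range N, a k θ = ∑ k ∈ F, sqTerm δ f k θ := fun θ => by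
    simp only [ha]
    rw [← Finset.sum_filter, Finset.filter_mem_eq_inter, Finset.inter_eq_right.2 hN]
  have e3 : ∀ θ, ∑ k ∈ Finset.range N, Real.sqrt (a k θ * sqTerm δ c k θ) =
      ∑ k ∈ F, Real.sqrt (sqTerm δ f k θ * sqTerm δ c k θ) := fun θ => by
    simp only [ha, ite_mul, zero_mul, apply_ite Real.sqrt, Real.sqrt_zero]
    rw [← Finset.sum_filter, Finset.filter_mem_eq_inter, Finset.inter_eq_right.2 hN]
  simp_rw [e2, e3] at h1
  simp_rw [e1]
  rwa [← integral_finsetSum _ fun k _ => hint k]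

/-- The pairing of a collection with the coefficients `∫ (b - ⟨b⟩_I) g h_I`. -/
lemma sum_norm_mul_oscCoeff_le {δ B : ℝ} {b g : Circ → ℂ} (hb : IsBMO δ B b)
    (hg : AEStronglyMeasurable g (volume : Measure Circ)) (hg1 : ∀ θ, ‖g θ‖ ≤ 1) (f : Idx → ℂ)
    (F : Finset ℕ) :
    ∑ k ∈ F, ∑ m : Fin (2 ^ k), ‖f ⟨k, m⟩‖ * ‖oscCoeff δ b g ⟨k, m⟩‖ ≤
      5 * B * ∫ θ, Real.sqrt (∑ k ∈ F, sqTerm δ f k θ) := by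
  have h := sum_norm_mul_le (δ := δ) (B := 3 * B) (by linarith [hb.pos]) (f := f)
    (c := oscCoeff δ b g) (setIntegral_sum_oscCoeff_le hb.pos hb.memLp hb.var_le hg hg1) F
  have h0 : 0 ≤ B * ∫ θ, Real.sqrt (∑ k ∈ F, sqTerm δ f k θ) :=
    mul_nonneg hb.pos.le (integral_nonneg fun θ => Real.sqrt_nonneg _)
  linarith

/-! ### The bounded part of the product -/

/-- The part `∑_{|I| = 2π 2^{-k}} f_I h_I (b - ⟨b⟩_I)` of generation `k` of the sum of the
paraproducts `Π₂` and `Π₃`. -/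
noncomputable def block (δ : ℝ) (f b : Circ → ℂ) (k : ℕ) (θ : Circ) : ℂ :=
  coeff δ f (node δ k θ) * (haar δ (node δ k θ) θ : ℂ) * (b θ - avg δ b (node δ k θ))

lemma adapted_haar_node (δ : ℝ) (k : ℕ) : Adapted δ (k + 1) fun θ => haar δ (node δ k θ) θ := by
  intro θ η h
  simp only [haar_node]
  rw [node_eq_of_node_succ_eq δ h, adapted_sgn δ k.lt_succ_self h]

lemma adapted_diff (δ : ℝ) (c : Idx → ℂ) (k : ℕ) :
    Adapted δ (k + 1) fun θ => c (node δ k θ) * (haar δ (node δ k θ) θ : ℂ) := by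
  intro θ η h
  simp only
  rw [show haar δ (node δ k θ) θ = haar δ (node δ k η) η from adapted_haar_node δ k h,
    node_eq_of_node_succ_eq δ h]

lemma integrable_block (δ : ℝ) (f : Circ → ℂ) {b : Circ → ℂ}
    (hb : Integrable b (volume : Measure Circ)) (k : ℕ) :
    Integrable (block δ f b k) (volume : Measure Circ) :=
  (adapted_diff δ (coeff δ f) k).integrable_mul (hb.sub (adapted_node δ k (avg δ b)).integrable)

lemma integral_block_mul (δ : ℝ) (f : Circ → ℂ) {b g : Circ → ℂ}
    (hb : Integrable b (volume : Measure Circ))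
    (hg : AEStronglyMeasurable g (volume : Measure Circ)) {A : ℝ} (hgA : ∀ θ, ‖g θ‖ ≤ A) (k : ℕ) :
    ∫ θ, block δ f b k θ * g θ =
      ∑ m : Fin (2 ^ k), coeff δ f ⟨k, m⟩ * oscCoeff δ b g ⟨k, m⟩ := by
  rw [integral_eq_sum_arc δ k ((integrable_block δ f hb k).mul_bdd hg (Eventually.of_forall hgA))]
  refine Finset.sum_congr rfl fun m _ => ?_
  rw [oscCoeff, coeff_eq_setIntegral δ fun θ => _ * g θ, ← integral_const_mul]
  refine setIntegral_congr_fun (measurableSet_arc δ _) fun θ hθ => ?_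
  have h1 := (mem_arc_iff δ _ θ).1 hθ
  simp only at h1
  simp only [block, h1]
  ring

/-- The `L¹` bound for sums of blocks, by duality with the conjugate phase of the sum. -/
lemma integral_norm_sum_block_le {δ B : ℝ} {b : Circ → ℂ} (hb : IsBMO δ B b) (f : Circ → ℂ)
    (F : Finset ℕ) :
    ∫ θ, ‖∑ k ∈ F, block δ f b k θ‖ ≤
      5 * B * ∫ θ, Real.sqrt (∑ k ∈ F, sqTerm δ (coeff δ f) k θ) := by
  set G : Circ → ℂ := fun θ => ∑ k ∈ F, block δ f b k θ with hG
  have hGi : Integrable G (volume : Measure Circ) :=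
    integrable_finsetSum _ fun k _ => integrable_block δ f hb.integrable k
  set g : Circ → ℂ := fun θ => (starRingEnd ℂ) (G θ) / (‖G θ‖ : ℂ) with hg
  have hgm : AEStronglyMeasurable g (volume : Measure Circ) := by
    have := hGi.aestronglyMeasurable.aemeasurable
    refine AEMeasurable.aestronglyMeasurable ?_
    exact (Complex.continuous_conj.measurable.comp_aemeasurable this).div
      (Complex.measurable_ofReal.comp_aemeasurable this.norm)
  have hg1 : ∀ θ, ‖g θ‖ ≤ 1 := fun θ => by
    simp only [hg, norm_div, RCLike.norm_conj, Complex.norm_real, norm_norm]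
    exact div_self_le_one _
  have e : ∀ θ, ((‖G θ‖ : ℝ) : ℂ) = ∑ k ∈ F, block δ f b k θ * g θ := fun θ => by
    rw [← Finset.sum_mul]
    change _ = G θ * ((starRingEnd ℂ) (G θ) / (‖G θ‖ : ℂ))
    rw [← mul_div_assoc, Complex.mul_conj, Complex.normSq_eq_norm_sq]
    by_cases h0 : ‖G θ‖ = 0
    · simp [h0]
    · push_cast
      field_simp
  have h1 : ((∫ θ, ‖G θ‖ : ℝ) : ℂ) =
      ∑ k ∈ F, ∑ m : Fin (2 ^ k), coeff δ f ⟨k, m⟩ * oscCoeff δ b g ⟨k, m⟩ := by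
    rw [← integral_complex_ofReal]
    simp_rw [e]
    rw [integral_finsetSum _ fun k _ => (integrable_block δ f hb.integrable k).mul_bdd hgm
      (Eventually.of_forall hg1)]
    exact Finset.sum_congr rfl fun k _ => integral_block_mul δ f hb.integrable hgm hg1 k
  have h2 : ∫ θ, ‖G θ‖ = ‖((∫ θ, ‖G θ‖ : ℝ) : ℂ)‖ := by
    rw [Complex.norm_real, Real.norm_of_nonneg (integral_nonneg fun θ => norm_nonneg _)]
  rw [h2, h1]
  refine le_trans ?_ (sum_norm_mul_oscCoeff_le hb hgm hg1 (coeff δ f) F)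
  refine (norm_sum_le _ _).trans (Finset.sum_le_sum fun k _ => (norm_sum_le _ _).trans ?_)
  exact Finset.sum_le_sum fun m _ => (norm_mul _ _).le

lemma exists_H1Norm_le {δ : ℝ} (f : H1 δ) : ∃ H : ℝ, 0 < H ∧ H1Norm δ f.1 ≤ ENNReal.ofReal H := by
  have h : H1Norm δ f.1 < ∞ := f.2
  refine ⟨(H1Norm δ f.1).toReal + 1, by positivity, ?_⟩
  rw [ENNReal.ofReal_add ENNReal.toReal_nonneg zero_le_one, ENNReal.ofReal_toReal h.ne]
  exact le_self_add

lemma exists_BMONorm_le {δ : ℝ} (b : BMO δ) :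
    ∃ B : ℝ, 0 < B ∧ BMONorm δ b.1 ≤ ENNReal.ofReal B := by
  have h : BMONorm δ b.1 < ∞ := b.2
  refine ⟨(BMONorm δ b.1).toReal + 1, by positivity, ?_⟩
  rw [ENNReal.ofReal_add ENNReal.toReal_nonneg zero_le_one, ENNReal.ofReal_toReal h.ne]
  exact le_self_add

lemma exists_isBMO {δ : ℝ} (b : BMO δ) : ∃ B : ℝ, IsBMO δ B b.1 := by
  obtain ⟨B, hB, h⟩ := exists_BMONorm_le b
  exact ⟨B, isBMO_of_BMONorm_le hB h⟩

/-- The part of generation `k` of `Π₂ + Π₃`, as an element of `L¹`. -/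
noncomputable def blockL1 (δ : ℝ) (f b : L1) (k : ℕ) : L1 :=
  (integrable_block δ f (L1.integrable_coeFn b) k).toL1 _

lemma blockL1_coe (δ : ℝ) (f b : L1) (k : ℕ) :
    blockL1 δ f b k =ᵐ[volume] block δ f b k := Integrable.coeFn_toL1 _

lemma sum_blockL1_coe (δ : ℝ) (f b : L1) (F : Finset ℕ) :
    (∑ k ∈ F, blockL1 δ f b k : L1) =ᵐ[volume] fun θ => ∑ k ∈ F, block δ f b k θ := by
  filter_upwards [Lp.coeFn_finsetSum F (blockL1 δ f b),
    (ae_all_iff.2 fun k => blockL1_coe δ f b k)] with θ h1 h2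
  rw [h1, Finset.sum_apply]
  exact Finset.sum_congr rfl fun k _ => h2 k

lemma norm_sum_blockL1_le {δ B : ℝ} {f b : L1} (hb : IsBMO δ B b) (F : Finset ℕ) :
    ‖∑ k ∈ F, blockL1 δ f b k‖ ≤
      5 * B * ∫ θ, Real.sqrt (∑ k ∈ F, sqTerm δ (coeff δ f) k θ) := by
  rw [L1.norm_eq_integral_norm]
  refine le_trans (le_of_eq (integral_congr_ae ?_)) (integral_norm_sum_block_le hb f F)
  filter_upwards [sum_blockL1_coe δ f b F] with θ h
  rw [h]

/-- The tails of an integrable square function tend to zero in `L¹`. -/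
lemma exists_integral_sqrt_tail_lt {δ : ℝ} {f : L1} (hf : H1Norm δ f < ∞) {ε : ℝ} (hε : 0 < ε) :
    ∃ s : Finset ℕ, ∀ t, Disjoint t s →
      ∫ θ, Real.sqrt (∑ k ∈ t, sqTerm δ (coeff δ f) k θ) < ε := by
  set R : ℕ → Circ → ℝ≥0∞ := fun N θ =>
    (∑' k, ENNReal.ofReal (sqTerm δ (coeff δ f) (k + N) θ)) ^ (1 / 2 : ℝ) with hR
  have hmeas : ∀ k, Measurable fun θ => ENNReal.ofReal (sqTerm δ (coeff δ f) k θ) := fun k =>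
    (adapted_sqTerm δ _ k).measurable.ennreal_ofReal
  have hRm : ∀ N, Measurable (R N) := fun N =>
    (Measurable.tsum fun k => hmeas (k + N)).pow_const _
  have hR0 : ∀ N θ, R N θ ≤ squareFn δ (coeffs δ f) θ := fun N θ => by
    rw [squareFn_eq]
    refine le_trans (ENNReal.rpow_le_rpow ?_ (by norm_num)) le_add_self
    exact ENNReal.tsum_comp_le_tsum_of_injective (add_left_injective N) _
  have hlim : ∀ᵐ θ : Circ, Tendsto (fun N => R N θ) atTop (𝓝 0) := by
    filter_upwards [ae_lt_top (measurable_squareFn δ (coeffs δ f)) hf.ne] with θ hθ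
    have h1 : ∑' k, ENNReal.ofReal (sqTerm δ (coeff δ f) k θ) ≠ ∞ := by
      have h2 := le_add_self.trans_lt ((squareFn_eq δ (coeffs δ f) θ).symm.trans_lt hθ)
      rw [ENNReal.rpow_lt_top_iff_of_pos (by norm_num)] at h2
      exact h2.ne
    have h3 := (ENNReal.continuous_rpow_const (y := 1 / 2)).tendsto 0 |>.comp
      (ENNReal.tendsto_sum_nat_add _ h1)
    rw [ENNReal.zero_rpow_of_pos (by norm_num)] at h3
    exact h3
  have h := tendsto_lintegral_of_dominated_convergence (μ := (volume : Measure Circ))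
    (squareFn δ (coeffs δ f)) hRm (fun N => Eventually.of_forall (hR0 N)) hf.ne hlim
  simp only [lintegral_zero] at h
  obtain ⟨N, hN⟩ := (h.eventually_lt_const (ENNReal.ofReal_pos.2 hε)).exists
  refine ⟨Finset.range N, fun t ht => ?_⟩
  rw [← ENNReal.ofReal_lt_ofReal_iff hε,
    ofReal_integral_eq_lintegral_ofReal (integrable_sqrt_sum_sqTerm δ _ t)
    (Eventually.of_forall fun θ => Real.sqrt_nonneg _)]
  refine lt_of_le_of_lt (lintegral_mono fun θ => ?_) hN
  rw [ofReal_sqrt_sum_sqTerm]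
  refine ENNReal.rpow_le_rpow ?_ (by norm_num)
  have hinj : Set.InjOn (fun k => k - N) (t : Set ℕ) := by
    intro k hk l hl hkl
    have h1 : N ≤ k := by simpa using Finset.disjoint_left.1 ht hk
    have h2 : N ≤ l := by simpa using Finset.disjoint_left.1 ht hl
    simp only at hkl
    omega
  calc ∑ k ∈ t, ENNReal.ofReal (sqTerm δ (coeff δ f) k θ)
      = ∑ k ∈ t.image (fun k => k - N), ENNReal.ofReal (sqTerm δ (coeff δ f) (k + N) θ) := by
        rw [Finset.sum_image hinj]
        refine Finset.sum_congr rfl fun k hk => ?_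
        have h1 : N ≤ k := by simpa using Finset.disjoint_left.1 ht hk
        rw [Nat.sub_add_cancel h1]
    _ ≤ _ := ENNReal.sum_le_tsum _

lemma summable_blockL1 {δ : ℝ} (f : H1 δ) (b : BMO δ) : Summable (blockL1 δ f.1 b.1) := by
  obtain ⟨B, hb⟩ := exists_isBMO b
  have hB := hb.pos
  refine summable_iff_vanishing_norm.2 fun ε hε => ?_
  obtain ⟨s, hs⟩ := exists_integral_sqrt_tail_lt (δ := δ) (f := f.1) f.2
    (ε := ε / (5 * B)) (by positivity)
  refine ⟨s, fun t ht => (norm_sum_blockL1_le hb t).trans_lt ?_⟩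
  have := hs t ht
  rwa [lt_div_iff₀' (by positivity)] at this

lemma avg_coe_add (δ : ℝ) (b c : L1) (I : Idx) :
    avg δ (b + c : L1) I = avg δ b I + avg δ c I := by
  simp only [avg, integral_coe_add, mul_add]

lemma avg_coe_smul (δ : ℝ) (a : ℂ) (b : L1) (I : Idx) : avg δ (a • b : L1) I = a * avg δ b I := by
  simp only [avg, integral_coe_smul]; ring

lemma blockL1_add_left (δ : ℝ) (f g b : L1) (k : ℕ) :
    blockL1 δ (f + g) b k = blockL1 δ f b k + blockL1 δ g b k := by
  refine Lp.ext ?_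
  filter_upwards [blockL1_coe δ (f + g) b k, blockL1_coe δ f b k, blockL1_coe δ g b k,
    Lp.coeFn_add (blockL1 δ f b k) (blockL1 δ g b k)] with θ h1 h2 h3 h4
  rw [h1, h4, Pi.add_apply, h2, h3]
  simp only [block, coeff_add]
  ring

lemma blockL1_smul_left (δ : ℝ) (a : ℂ) (f b : L1) (k : ℕ) :
    blockL1 δ (a • f) b k = a • blockL1 δ f b k := by
  refine Lp.ext ?_
  filter_upwards [blockL1_coe δ (a • f) b k, blockL1_coe δ f b k,
    Lp.coeFn_smul a (blockL1 δ f b k)] with θ h1 h2 h3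
  rw [h1, h3, Pi.smul_apply, h2]
  simp only [block, coeff_smul, smul_eq_mul]
  ring

lemma blockL1_add_right (δ : ℝ) (f b c : L1) (k : ℕ) :
    blockL1 δ f (b + c) k = blockL1 δ f b k + blockL1 δ f c k := by
  refine Lp.ext ?_
  filter_upwards [blockL1_coe δ f (b + c) k, blockL1_coe δ f b k, blockL1_coe δ f c k,
    Lp.coeFn_add (blockL1 δ f b k) (blockL1 δ f c k), Lp.coeFn_add b c] with θ h1 h2 h3 h4 h5
  rw [h1, h4, Pi.add_apply, h2, h3]
  simp only [block, avg_coe_add, h5, Pi.add_apply]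
  ring

lemma blockL1_smul_right (δ : ℝ) (a : ℂ) (f b : L1) (k : ℕ) :
    blockL1 δ f (a • b) k = a • blockL1 δ f b k := by
  refine Lp.ext ?_
  filter_upwards [blockL1_coe δ f (a • b) k, blockL1_coe δ f b k,
    Lp.coeFn_smul a (blockL1 δ f b k), Lp.coeFn_smul a b] with θ h1 h2 h3 h4
  rw [h1, h3, Pi.smul_apply, h2]
  simp only [block, avg_coe_smul, h4, Pi.smul_apply, smul_eq_mul]
  ring

/-- The bounded part `f_0 b + Π₂(f, b) + Π₃(f, b)` of the product. -/
noncomputable def boundedPart (δ : ℝ) : H1 δ →ₗ[ℂ] BMO δ →ₗ[ℂ] L1 :=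
  LinearMap.mk₂ ℂ (fun f b => mean f.1 • b.1 + ∑' k, blockL1 δ f.1 b.1 k)
    (fun f g b => by
      have h : blockL1 δ (f + g : H1 δ).1 b.1 = fun k =>
          blockL1 δ f.1 b.1 k + blockL1 δ g.1 b.1 k :=
        funext fun k => blockL1_add_left δ f.1 g.1 b.1 k
      rw [h, (summable_blockL1 f b).tsum_add (summable_blockL1 g b), Submodule.coe_add, mean_add,
        add_smul]
      abel)
    (fun a f b => by
      have h : blockL1 δ (a • f : H1 δ).1 b.1 = fun k => a • blockL1 δ f.1 b.1 k :=
        funext fun k => blockL1_smul_left δ a f.1 b.1 k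
      rw [h, (summable_blockL1 f b).tsum_const_smul a, Submodule.coe_smul, mean_smul, smul_add,
        mul_smul])
    (fun f b c => by
      have h : blockL1 δ f.1 (b + c : BMO δ).1 = fun k =>
          blockL1 δ f.1 b.1 k + blockL1 δ f.1 c.1 k :=
        funext fun k => blockL1_add_right δ f.1 b.1 c.1 k
      rw [h, (summable_blockL1 f b).tsum_add (summable_blockL1 f c), Submodule.coe_add, smul_add]
      abel)
    (fun a f b => by
      have h : blockL1 δ f.1 (a • b : BMO δ).1 = fun k => a • blockL1 δ f.1 b.1 k :=
        funext fun k => blockL1_smul_right δ a f.1 b.1 k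
      rw [h, (summable_blockL1 f b).tsum_const_smul a, Submodule.coe_smul, smul_add, smul_comm])

lemma boundedPart_apply {δ : ℝ} (f : H1 δ) (b : BMO δ) :
    boundedPart δ f b = mean f.1 • b.1 + ∑' k, blockL1 δ f.1 b.1 k := rfl

lemma norm_boundedPart_le {δ H B : ℝ} (hH : 0 ≤ H) (f : H1 δ) (b : BMO δ)
    (hf : H1Norm δ f.1 ≤ ENNReal.ofReal H) (hb : IsBMO δ B b.1) :
    ‖boundedPart δ f b‖ ≤ 8 * H * B := by
  have hB := hb.pos
  have h1 : ‖∑' k, blockL1 δ f.1 b.1 k‖ ≤ 5 * B * H := by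
    refine le_of_tendsto (summable_blockL1 f b).hasSum.norm (Eventually.of_forall fun F => ?_)
    refine (norm_sum_blockL1_le hb F).trans ?_
    gcongr
    exact (ENNReal.ofReal_le_ofReal_iff hH).1
      ((ofReal_integral_sqrt_sum_sqTerm_le δ f.1 F).trans hf)
  have h2 : ‖b.1‖ ≤ 14 * B := by
    rw [L1.norm_eq_integral_norm]; exact hb.integral_norm_le
  have h3 := norm_mean_le hH hf
  have h4 : ‖mean f.1‖ * ‖b.1‖ ≤ 3 * H * B := by
    have h5 : 6 * ‖mean f.1‖ ≤ H := by
      nlinarith [Real.pi_gt_three, norm_nonneg (mean f.1)]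
    nlinarith [norm_nonneg (mean f.1), mul_le_mul_of_nonneg_left h2 (norm_nonneg (mean f.1))]
  rw [boundedPart_apply]
  refine (norm_add_le _ _).trans ?_
  rw [norm_smul]
  linarith

/-! ### The distributional part of the product -/

lemma exists_node_eq (δ : ℝ) (I : Idx) : ∃ θ, node δ I.1 θ = I := by
  have h : (arc δ I).Nonempty := by
    refine Set.Nonempty.image _ (nonempty_Ico.2 ?_)
    have hp := Real.two_pi_pos
    gcongr
    linarith
  obtain ⟨θ, hθ⟩ := h
  exact ⟨θ, (mem_arc_iff δ I θ).1 hθ⟩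

lemma TestFn.integrable (φ : TestFn) : Integrable φ.1 (volume : Measure Circ) :=
  (TestFn.continuous φ).integrable_of_hasCompactSupport (HasCompactSupport.of_compactSpace _)

lemma TestFn.exists_bound (φ : TestFn) : ∃ A : ℝ, 0 < A ∧ ∀ θ, ‖φ.1 θ‖ ≤ A := by
  obtain ⟨A, hA⟩ := isCompact_univ.exists_bound_of_continuousOn (TestFn.continuous φ).continuousOn
  exact ⟨max A 1, by positivity, fun θ => (hA θ (mem_univ θ)).trans (le_max_left _ _)⟩

lemma TestFn.exists_deriv_bound (φ : TestFn) :
    ∃ A : ℝ, ∀ x : ℝ, ‖deriv (fun y : ℝ => φ.1 (y : Circ)) x‖ ≤ A := by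
  have h : ContDiff ℝ (⊤ : ℕ∞) (fun x : ℝ => φ.1 (x : Circ)) := φ.2
  have hper : Function.Periodic (deriv fun y : ℝ => φ.1 (y : Circ)) (2 * Real.pi) := fun x => by
    rw [← deriv_comp_add_const]
    congr 1
    ext y
    rw [AddCircle.coe_add_period]
  obtain ⟨A, hA⟩ := (isCompact_Icc (a := (0 : ℝ)) (b := 2 * Real.pi)).exists_bound_of_continuousOn
    (h.continuous_deriv (by simp)).continuousOn
  refine ⟨A, fun x => ?_⟩
  obtain ⟨y, hy, hxy⟩ := hper.exists_mem_Ico₀ Real.two_pi_pos x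
  rw [hxy]
  exact hA y (Ico_subset_Icc_self hy)

lemma exists_lifts_of_mem_arc {δ : ℝ} {I : Idx} {θ η : Circ} (hθ : θ ∈ arc δ I)
    (hη : η ∈ arc δ I) : ∃ x y : ℝ, (x : Circ) = θ ∧ (y : Circ) = η ∧ |x - y| ≤ len I := by
  obtain ⟨x, hx, rfl⟩ := hθ
  obtain ⟨y, hy, rfl⟩ := hη
  refine ⟨x, y, rfl, rfl, ?_⟩
  have hl : len I = 2 * Real.pi * ((((I.2 : ℕ) : ℝ) + 1) / 2 ^ I.1 + δ) -
      2 * Real.pi * (((I.2 : ℕ) : ℝ) / 2 ^ I.1 + δ) := by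
    rw [len]; ring
  rw [hl, abs_le]
  constructor <;> linarith [hx.1, hx.2, hy.1, hy.2]

lemma norm_sub_le_of_mem_arc {δ A : ℝ} {φ : TestFn}
    (hA : ∀ x : ℝ, ‖deriv (fun y : ℝ => φ.1 (y : Circ)) x‖ ≤ A) {I : Idx} {θ η : Circ}
    (hθ : θ ∈ arc δ I) (hη : η ∈ arc δ I) : ‖φ.1 θ - φ.1 η‖ ≤ A * len I := by
  obtain ⟨x, y, rfl, rfl, hxy⟩ := exists_lifts_of_mem_arc hθ hη
  have h : ContDiff ℝ (⊤ : ℕ∞) (fun x : ℝ => φ.1 (x : Circ)) := φ.2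
  have h1 := convex_univ.norm_image_sub_le_of_norm_deriv_le
    (fun z _ => (h.differentiable (by simp)).differentiableAt) (fun z _ => hA z)
    (mem_univ y) (mem_univ x)
  have hA0 : 0 ≤ A := (norm_nonneg _).trans (hA 0)
  exact h1.trans (mul_le_mul_of_nonneg_left hxy hA0)

lemma coeff_sub_const (δ : ℝ) {F : Circ → ℂ} (hF : Integrable F (volume : Measure Circ)) (c : ℂ)
    (I : Idx) : coeff δ (fun θ => F θ - c) I = coeff δ F I := by
  have hFc : Integrable (fun θ => F θ - c) (volume : Measure Circ) := hF.sub (integrable_const c)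
  rw [coeff_eq δ hFc, coeff_eq δ hF,
    integral_sub hF.integrableOn (integrable_const c),
    integral_sub hF.integrableOn (integrable_const c), setIntegral_arc_const,
    setIntegral_arc_const, len_left, len_right]
  congr 1
  ring

/-- The Haar coefficients of a smooth function are `O(|I|^{3/2})`. -/
lemma norm_coeff_testFn_le (δ : ℝ) {A : ℝ} {φ : TestFn}
    (hA : ∀ x : ℝ, ‖deriv (fun y : ℝ => φ.1 (y : Circ)) x‖ ≤ A) (I : Idx) :
    ‖coeff δ φ.1 I‖ ≤ A * len I * Real.sqrt (len I) := by
  obtain ⟨η, hη⟩ := exists_node_eq δ I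
  have hη' : η ∈ arc δ I := (mem_arc_iff δ I η).2 hη
  rw [← coeff_sub_const δ (TestFn.integrable φ) (φ.1 η), coeff_eq_setIntegral]
  have h := norm_setIntegral_le_of_norm_le_const (μ := (volume : Measure Circ)) (s := arc δ I)
    (f := fun θ => (φ.1 θ - φ.1 η) * (haar δ I θ : ℂ))
    (C := A * len I * (Real.sqrt (len I))⁻¹) (by rw [volume_arc]; exact ENNReal.ofReal_lt_top)
    (fun θ hθ => by
      rw [norm_mul, Complex.norm_real]
      exact mul_le_mul (norm_sub_le_of_mem_arc hA hθ hη') (abs_haar_le δ I θ) (abs_nonneg _)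
        ((norm_nonneg _).trans (norm_sub_le_of_mem_arc hA hθ hη')))
  rw [volume_real_arc] at h
  refine h.trans (le_of_eq ?_)
  have hs := sqrt_len_pos I
  have := Real.mul_self_sqrt (len_pos I).le
  field_simp
  rw [pow_two, pow_two, this, mul_assoc]

/-- The arcs of one generation are disjoint, so their Haar coefficients are summed by `‖f‖_1`. -/
lemma sum_norm_coeff_le (δ : ℝ) (f : L1) (k : ℕ) :
    ∑ m : Fin (2 ^ k), ‖coeff δ f ⟨k, m⟩‖ ≤
      (Real.sqrt (2 * Real.pi / 2 ^ k))⁻¹ * ∫ θ, ‖f θ‖ := by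
  have hf := L1.integrable_coeFn f
  rw [integral_eq_sum_arc δ k hf.norm, Finset.mul_sum]
  refine Finset.sum_le_sum fun m _ => ?_
  rw [coeff_eq_setIntegral, ← integral_const_mul]
  refine norm_integral_le_of_norm_le (hf.norm.const_mul _).integrableOn
    (Eventually.of_forall fun θ => ?_)
  rw [norm_mul, Complex.norm_real, mul_comm]
  exact mul_le_mul_of_nonneg_right (abs_haar_le δ _ θ) (norm_nonneg _)

/-- The coefficient `f_I ⟨b⟩_I` of the distributional part of the product. -/
noncomputable def paraCoeff (δ : ℝ) (f b : Circ → ℂ) (I : Idx) : ℂ := coeff δ f I * avg δ b I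

/-- The sum `2π ∑_k (k + 1) 2^{-k}`. -/
noncomputable def paraConst : ℝ := ∑' k : ℕ, ((k : ℝ) + 1) * (2 * Real.pi / 2 ^ k)

lemma summable_paraConst : Summable fun k : ℕ => ((k : ℝ) + 1) * (2 * Real.pi / 2 ^ k) := by
  have h1 := summable_pow_mul_geometric_of_norm_lt_one 1 (r := (1 / 2 : ℝ)) (by norm_num)
  have h2 := summable_geometric_of_lt_one (r := (1 / 2 : ℝ)) (by norm_num) (by norm_num)
  refine ((h1.add h2).mul_left (2 * Real.pi)).congr fun k => ?_
  rw [one_div, inv_pow]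
  field_simp

lemma sum_norm_paraCoeff_mul_le {δ B A : ℝ} {f : L1} {b : Circ → ℂ} (hb : IsBMO δ B b)
    {φ : TestFn} (hA : ∀ x : ℝ, ‖deriv (fun y : ℝ => φ.1 (y : Circ)) x‖ ≤ A) (k : ℕ) :
    ∑ m : Fin (2 ^ k), ‖paraCoeff δ f b ⟨k, m⟩ * coeff δ φ.1 ⟨k, m⟩‖ ≤
      (∫ θ, ‖f θ‖) * B * A * (((k : ℝ) + 1) * (2 * Real.pi / 2 ^ k)) := by
  set l : ℝ := 2 * Real.pi / 2 ^ k with hl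
  have hl0 : 0 < l := div_pos Real.two_pi_pos (by positivity)
  have hs : 0 < Real.sqrt l := Real.sqrt_pos.2 hl0
  have hA0 : 0 ≤ A := (norm_nonneg _).trans (hA 0)
  have hB := hb.pos
  calc ∑ m : Fin (2 ^ k), ‖paraCoeff δ f b ⟨k, m⟩ * coeff δ φ.1 ⟨k, m⟩‖
      ≤ ∑ m : Fin (2 ^ k), ‖coeff δ f ⟨k, m⟩‖ * (((k + 1) * B) * (A * l * Real.sqrt l)) := by
        refine Finset.sum_le_sum fun m _ => ?_
        obtain ⟨θ, hθ⟩ := exists_node_eq δ ⟨k, m⟩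
        have h1 := hb.norm_avg_node_le k θ
        simp only at hθ
        rw [hθ] at h1
        rw [paraCoeff, norm_mul, norm_mul, mul_assoc]
        refine mul_le_mul_of_nonneg_left ?_ (norm_nonneg _)
        exact mul_le_mul h1 (norm_coeff_testFn_le δ hA ⟨k, m⟩) (norm_nonneg _) (by positivity)
    _ = (∑ m : Fin (2 ^ k), ‖coeff δ f ⟨k, m⟩‖) * (((k + 1) * B) * (A * l * Real.sqrt l)) := by
        rw [Finset.sum_mul]
    _ ≤ ((Real.sqrt l)⁻¹ * ∫ θ, ‖f θ‖) * (((k + 1) * B) * (A * l * Real.sqrt l)) :=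
        mul_le_mul_of_nonneg_right (sum_norm_coeff_le δ f k) (by positivity)
    _ = _ := by field_simp

lemma summable_paraCoeff_mul {δ B : ℝ} {f : L1} {b : Circ → ℂ} (hb : IsBMO δ B b)
    (φ : TestFn) : Summable fun I => paraCoeff δ f b I * coeff δ φ.1 I := by
  obtain ⟨A, hA⟩ := TestFn.exists_deriv_bound φ
  refine Summable.of_norm ((summable_sigma_of_nonneg fun I => norm_nonneg _).2
    ⟨fun k => (hasSum_fintype _).summable, ?_⟩)
  simp_rw [tsum_fintype]
  exact Summable.of_nonneg_of_le (fun k => Finset.sum_nonneg fun m _ => norm_nonneg _)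
    (sum_norm_paraCoeff_mul_le hb hA) (summable_paraConst.mul_left _)

lemma norm_tsum_paraCoeff_mul_le {δ B A : ℝ} {f : L1} {b : Circ → ℂ} (hb : IsBMO δ B b)
    {φ : TestFn} (hA : ∀ x : ℝ, ‖deriv (fun y : ℝ => φ.1 (y : Circ)) x‖ ≤ A) :
    ‖∑' I, paraCoeff δ f b I * coeff δ φ.1 I‖ ≤ (∫ θ, ‖f θ‖) * B * paraConst * A := by
  have h := (summable_paraCoeff_mul (f := f) hb φ).hasSum.sigma fun k => hasSum_fintype _
  have h2 : ‖∑' I, paraCoeff δ f b I * coeff δ φ.1 I‖ ≤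
      ∑' k : ℕ, (∫ θ, ‖f θ‖) * B * A * (((k : ℝ) + 1) * (2 * Real.pi / 2 ^ k)) := by
    rw [← h.tsum_eq]
    exact tsum_of_norm_bounded (summable_paraConst.mul_left _).hasSum fun k =>
      (norm_sum_le _ _).trans (sum_norm_paraCoeff_mul_le hb hA k)
  rw [tsum_mul_left] at h2
  refine h2.trans (le_of_eq ?_)
  rw [paraConst]; ring

lemma coeff_testFn_add (δ : ℝ) (φ ψ : TestFn) (I : Idx) :
    coeff δ (φ + ψ : TestFn).1 I = coeff δ φ.1 I + coeff δ ψ.1 I := by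
  unfold coeff
  rw [← integral_add (integrable_mul_haar' δ I (TestFn.integrable φ))
    (integrable_mul_haar' δ I (TestFn.integrable ψ))]
  simp [add_mul]

lemma coeff_testFn_smul (δ : ℝ) (a : ℂ) (φ : TestFn) (I : Idx) :
    coeff δ (a • φ : TestFn).1 I = a * coeff δ φ.1 I := by
  unfold coeff
  rw [← integral_const_mul]
  simp [mul_assoc]

/-- The distribution `∑_I f_I ⟨b⟩_I h_I`. -/
noncomputable def paraDistr {δ : ℝ} (f : H1 δ) (b : BMO δ) : Distr :=
  ⟨{ toFun := fun φ => ∑' I, paraCoeff δ f.1 b.1 I * coeff δ φ.1 I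
     map_add' := fun φ ψ => by
      obtain ⟨B, hb⟩ := exists_isBMO b
      rw [← (summable_paraCoeff_mul hb φ).tsum_add (summable_paraCoeff_mul hb ψ)]
      simp_rw [coeff_testFn_add, mul_add]
     map_smul' := fun a φ => by
      rw [RingHom.id_apply, smul_eq_mul, ← tsum_mul_left]
      simp_rw [coeff_testFn_smul, mul_left_comm] },
    by
      obtain ⟨B, hb⟩ := exists_isBMO b
      refine ⟨(∫ θ, ‖f.1 θ‖) * B * paraConst, 1, fun φ A hA => ?_⟩
      refine norm_tsum_paraCoeff_mul_le hb fun x => ?_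
      have := hA 1 le_rfl x
      rwa [iteratedDeriv_one] at this⟩

lemma paraDistr_apply {δ : ℝ} (f : H1 δ) (b : BMO δ) (φ : TestFn) :
    (paraDistr f b).1 φ = ∑' I, paraCoeff δ f.1 b.1 I * coeff δ φ.1 I := rfl

/-- The map `(f, b) ↦ ∑_I f_I ⟨b⟩_I h_I`, which extends `Π₁`. -/
noncomputable def logPart (δ : ℝ) : H1 δ →ₗ[ℂ] BMO δ →ₗ[ℂ] Distr :=
  LinearMap.mk₂ ℂ paraDistr
    (fun f g b => by
      obtain ⟨B, hb⟩ := exists_isBMO b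
      refine Subtype.ext (LinearMap.ext fun φ => ?_)
      change _ = (paraDistr f b).1 φ + (paraDistr g b).1 φ
      simp only [paraDistr_apply]
      rw [← (summable_paraCoeff_mul hb φ).tsum_add (summable_paraCoeff_mul hb φ)]
      simp only [paraCoeff, Submodule.coe_add, coeff_add, add_mul])
    (fun a f b => by
      refine Subtype.ext (LinearMap.ext fun φ => ?_)
      change _ = a * (paraDistr f b).1 φ
      simp only [paraDistr_apply]
      rw [← tsum_mul_left]
      simp only [paraCoeff, Submodule.coe_smul, coeff_smul, mul_assoc])
    (fun f b c => by
      obtain ⟨B, hb⟩ := exists_isBMO b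
      obtain ⟨D, hc⟩ := exists_isBMO c
      refine Subtype.ext (LinearMap.ext fun φ => ?_)
      change _ = (paraDistr f b).1 φ + (paraDistr f c).1 φ
      simp only [paraDistr_apply]
      rw [← (summable_paraCoeff_mul hb φ).tsum_add (summable_paraCoeff_mul hc φ)]
      simp only [paraCoeff, Submodule.coe_add, avg_coe_add, mul_add, add_mul])
    (fun a f b => by
      refine Subtype.ext (LinearMap.ext fun φ => ?_)
      change _ = a * (paraDistr f b).1 φ
      simp only [paraDistr_apply]
      rw [← tsum_mul_left]
      refine tsum_congr fun I => ?_
      simp only [paraCoeff, Submodule.coe_smul, avg_coe_smul]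
      ring)

lemma logPart_apply {δ : ℝ} (f : H1 δ) (b : BMO δ) (φ : TestFn) :
    (logPart δ f b).1 φ = ∑' I, paraCoeff δ f.1 b.1 I * coeff δ φ.1 I := rfl

lemma represents_logPart {δ : ℝ} (f : H1 δ) (b : BMO δ) :
    Represents δ ⟨0, paraCoeff δ f.1 b.1⟩ (logPart δ f b) := by
  intro φ
  obtain ⟨B, hb⟩ := exists_isBMO b
  have h := (summable_paraCoeff_mul (f := f.1) hb φ).hasSum.sigma fun k => hasSum_fintype _
  refine h.tendsto_sum_nat.congr fun N => ?_
  simp only [partialSum, zero_add, Finset.sum_mul]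
  have hi : ∀ I : Idx, Integrable (fun θ => paraCoeff δ f.1 b.1 I * (haar δ I θ : ℂ) * φ.1 θ)
      (volume : Measure Circ) := fun I =>
    ((integrable_mul_haar' δ I (TestFn.integrable φ)).const_mul (paraCoeff δ f.1 b.1 I)).congr
      (Eventually.of_forall fun θ => by ring)
  rw [integral_finsetSum _ fun k _ => integrable_finsetSum _ fun m _ => hi ⟨k, m⟩]
  refine Finset.sum_congr rfl fun k _ => ?_
  rw [integral_finsetSum _ fun m _ => hi ⟨k, m⟩]
  refine Finset.sum_congr rfl fun m _ => ?_
  rw [coeff, ← integral_const_mul]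
  congr 1
  ext θ
  ring

/-! ### The product formula -/

/-- Integration against a test function, as a continuous functional on `L¹`. -/
noncomputable def pairing (φ : TestFn) : L1 →L[ℂ] ℂ :=
  LinearMap.mkContinuousOfExistsBound
    { toFun := fun g => (ofL1 g).1 φ
      map_add' := fun g h => by rw [map_add]; rfl
      map_smul' := fun c g => by rw [map_smul]; rfl } <| by
    obtain ⟨A, -, hA⟩ := TestFn.exists_bound φ
    refine ⟨A, fun g => ?_⟩
    rw [L1.norm_eq_integral_norm, ← integral_const_mul]
    refine norm_integral_le_of_norm_le ((L1.integrable_coeFn g).norm.const_mul A)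
      (Eventually.of_forall fun θ => ?_)
    rw [norm_mul, mul_comm]
    exact mul_le_mul_of_nonneg_right (hA θ) (norm_nonneg _)

lemma pairing_apply (φ : TestFn) (g : L1) : pairing φ g = ∫ θ, g θ * φ.1 θ := rfl

lemma coeff_mul_eq (δ : ℝ) {b : Circ → ℂ} (hb : Integrable b (volume : Measure Circ)) (φ : TestFn)
    (I : Idx) : coeff δ (fun θ => b θ * φ.1 θ) I =
      oscCoeff δ b φ.1 I + avg δ b I * coeff δ φ.1 I := by
  obtain ⟨A, -, hA⟩ := TestFn.exists_bound φ
  have h1 : Integrable (fun θ => (b θ - avg δ b I) * φ.1 θ) (volume : Measure Circ) :=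
    (hb.sub (integrable_const _)).mul_bdd (TestFn.continuous φ).aestronglyMeasurable
      (Eventually.of_forall hA)
  unfold oscCoeff coeff
  rw [← integral_const_mul, ← integral_add (integrable_mul_haar' δ I h1)
    ((integrable_mul_haar' δ I (TestFn.integrable φ)).const_mul _)]
  congr 1
  ext θ
  ring

lemma summable_coeff_mul_oscCoeff {δ : ℝ} (f : H1 δ) (b : BMO δ) (φ : TestFn) :
    Summable fun I => coeff δ f.1 I * oscCoeff δ b.1 φ.1 I := by
  obtain ⟨B, hb⟩ := exists_isBMO b
  obtain ⟨H, hH, hf⟩ := exists_H1Norm_le f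
  obtain ⟨A, hA0, hA⟩ := TestFn.exists_bound φ
  have hB := hb.pos
  -- The bound for `oscCoeff` needs a function bounded by `1`.
  set g : Circ → ℂ := fun θ => (A : ℂ)⁻¹ * φ.1 θ with hg
  have hgm : AEStronglyMeasurable g (volume : Measure Circ) :=
    ((TestFn.continuous φ).const_smul (A : ℂ)⁻¹).aestronglyMeasurable
  have hg1 : ∀ θ, ‖g θ‖ ≤ 1 := fun θ => by
    simp only [hg, norm_mul, norm_inv, Complex.norm_real, Real.norm_of_nonneg hA0.le]
    rw [inv_mul_le_iff₀ hA0, mul_one]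
    exact hA θ
  have hosc : ∀ I, oscCoeff δ b.1 φ.1 I = A * oscCoeff δ b.1 g I := fun I => by
    unfold oscCoeff coeff
    rw [← integral_const_mul]
    congr 1
    ext θ
    have : (A : ℂ) ≠ 0 := by exact_mod_cast hA0.ne'
    simp only [hg]
    field_simp
  simp_rw [hosc, mul_left_comm _ (A : ℂ)]
  refine Summable.mul_left _ (Summable.of_norm ((summable_sigma_of_nonneg fun I =>
    norm_nonneg _).2 ⟨fun k => (hasSum_fintype _).summable, ?_⟩))
  simp_rw [tsum_fintype, norm_mul]
  refine summable_of_sum_le (c := 5 * B * H)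
    (fun k => Finset.sum_nonneg fun m _ => by positivity) fun F => ?_
  refine (sum_norm_mul_oscCoeff_le hb hgm hg1 (coeff δ f.1) F).trans ?_
  gcongr
  exact (ENNReal.ofReal_le_ofReal_iff hH.le).1
    ((ofReal_integral_sqrt_sum_sqTerm_le δ f.1 F).trans hf)

lemma isProduct_boundedPart_add_logPart {δ : ℝ} (f : H1 δ) (b : BMO δ) :
    IsProduct δ f.1 b.1 (ofL1 (boundedPart δ f b) + logPart δ f b) := by
  intro φ
  obtain ⟨B, hb⟩ := exists_isBMO b
  obtain ⟨A, -, hA⟩ := TestFn.exists_bound φ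
  have h1 := (summable_coeff_mul_oscCoeff f b φ).hasSum
  have h2 := h1.sigma fun k => hasSum_fintype _
  have h3 := (summable_blockL1 f b).hasSum.mapL (pairing φ)
  have h4 : ∀ k, pairing φ (blockL1 δ f.1 b.1 k) =
      ∑ m : Fin (2 ^ k), coeff δ f.1 ⟨k, m⟩ * oscCoeff δ b.1 φ.1 ⟨k, m⟩ := fun k => by
    rw [← integral_block_mul δ f.1 hb.integrable (TestFn.continuous φ).aestronglyMeasurable hA k,
      pairing_apply]
    refine integral_congr_ae ?_
    filter_upwards [blockL1_coe δ f.1 b.1 k] with θ hθ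
    rw [hθ]
  simp_rw [h4] at h3
  have h5 := h2.unique h3
  have h6 : (ofL1 (boundedPart δ f b) + logPart δ f b : Distr).1 φ -
      mean f.1 * ∫ θ, b.1 θ * φ.1 θ =
      (∑' I, coeff δ f.1 I * oscCoeff δ b.1 φ.1 I) +
        ∑' I, paraCoeff δ f.1 b.1 I * coeff δ φ.1 I := by
    change pairing φ (boundedPart δ f b) + (logPart δ f b).1 φ - mean f.1 * pairing φ b.1 = _
    rw [h5, boundedPart_apply, map_add, map_smul, smul_eq_mul, logPart_apply]
    ring
  rw [h6]
  refine (h1.add (summable_paraCoeff_mul hb φ).hasSum).congr_fun fun I => ?_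
  rw [coeff_mul_eq δ hb.integrable, paraCoeff]
  ring

/-! ### Exponential integrability of the maximal function -/

/-- The pathwise form of Doob's inequality: where the maximum increases it equals the current
term. -/
lemma partialSups_sq_le {z : ℕ → ℝ} (hz : ∀ n, 0 ≤ z n) (h0 : z 0 = 0) (n : ℕ) :
    partialSups z n ^ 2 ≤
      2 * ∑ i ∈ Finset.range n, (partialSups z (i + 1) - partialSups z i) * z (i + 1) := by
  induction n with
  | zero => simp [h0]
  | succ n ih =>
    rw [Finset.sum_range_succ, mul_add]
    have h1 : 0 ≤ partialSups z n := (hz n).trans (le_partialSups z n)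
    rw [partialSups_add_one]
    rcases le_total (partialSups z n) (z (n + 1)) with h | h
    · rw [sup_eq_right.2 h]
      nlinarith
    · rw [sup_eq_left.2 h]
      linarith

lemma adapted_partialSups {δ : ℝ} {n : ℕ} {Z : ℕ → Circ → ℝ}
    (hZ : ∀ j, Adapted δ (n + j) (Z j)) (j : ℕ) :
    Adapted δ (n + j) fun θ => partialSups (fun i => Z i θ) j := by
  induction j with
  | zero => intro θ η h; simpa using hZ 0 h
  | succ j ih =>
    intro θ η h
    simp only [partialSups_add_one]
    rw [hZ (j + 1) h, show partialSups (fun i => Z i θ) j = partialSups (fun i => Z i η) j from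
      (ih.mono (by omega)) h]

/-- The maximal function of the differences `⟨b⟩_J - ⟨b⟩_I`, `J ⊆ I`, over `j` generations. -/
noncomputable def maxDiff (δ : ℝ) (b : Circ → ℂ) (n j : ℕ) (θ : Circ) : ℝ :=
  partialSups (fun i => ‖avg δ b (node δ (n + i) θ) - avg δ b (node δ n θ)‖) j

lemma adapted_norm_avg_sub (δ : ℝ) (b : Circ → ℂ) (n j : ℕ) : Adapted δ (n + j) fun θ =>
    ‖avg δ b (node δ (n + j) θ) - avg δ b (node δ n θ)‖ := by
  intro θ η h
  simp only
  rw [h, node_eq_of_le δ (Nat.le_add_right n j) h]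

lemma adapted_maxDiff (δ : ℝ) (b : Circ → ℂ) (n j : ℕ) : Adapted δ (n + j) (maxDiff δ b n j) :=
  adapted_partialSups (adapted_norm_avg_sub δ b n) j

lemma maxDiff_mono (δ : ℝ) (b : Circ → ℂ) (n j : ℕ) (θ : Circ) :
    maxDiff δ b n j θ ≤ maxDiff δ b n (j + 1) θ :=
  partialSups_monotone (fun i => ‖avg δ b (node δ (n + i) θ) - avg δ b (node δ n θ)‖) j.le_succ

/-- Doob's `L²` maximal inequality on an arc, in the form of an `L¹` bound. -/
lemma setIntegral_maxDiff_le {δ B : ℝ} {b : Circ → ℂ} (hb : IsBMO δ B b) (I : Idx) (j : ℕ) :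
    ∫ θ in arc δ I, maxDiff δ b I.1 j θ ≤ 2 * B * len I := by
  have hB := hb.pos
  set P : ℕ → Circ → ℝ := fun i => maxDiff δ b I.1 i with hP
  set Z : ℕ → Circ → ℝ := fun i θ =>
    ‖avg δ b (node δ (I.1 + i) θ) - avg δ b (node δ I.1 θ)‖ with hZ
  set v : Circ → ℝ := fun θ => ‖b θ - avg δ b I‖ with hv
  have hvi : Integrable v (volume : Measure Circ) := (hb.integrable.sub (integrable_const _)).norm
  have hv2 : Integrable (fun θ => v θ ^ 2) (volume : Measure Circ) :=
    integrable_norm_sub_sq hb.memLp _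
  have hPa : ∀ i, Adapted δ (I.1 + i) (P i) := adapted_maxDiff δ b I.1
  have hZa : ∀ i, Adapted δ (I.1 + i) (Z i) := adapted_norm_avg_sub δ b I.1
  have hPd : ∀ i, Adapted δ (I.1 + (i + 1)) fun θ => P (i + 1) θ - P i θ := fun i θ η h => by
    simp only
    rw [hPa (i + 1) h, (hPa i).mono (Nat.le_succ _) h]
  have hPi : ∀ i, Integrable (P i) (volume : Measure Circ) := fun i => (hPa i).integrable
  have hP2 : ∀ i, Integrable (fun θ => P i θ ^ 2) (volume : Measure Circ) := fun i =>
    ((hPa i).integrable_mul (hPi i)).congr (Eventually.of_forall fun θ => (pow_two _).symm)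
  have hP00 : ∀ θ, P 0 θ = 0 := fun θ => by simp [hP, maxDiff]
  -- On the arcs where the maximum increases it equals the current term, a submartingale.
  have hstep : ∀ i, ∫ θ in arc δ I, (P (i + 1) θ - P i θ) * Z (i + 1) θ ≤
      ∫ θ in arc δ I, (P (i + 1) θ - P i θ) * v θ := by
    intro i
    have hwa : Adapted δ (I.1 + (i + 1)) ((arc δ I).indicator fun θ => P (i + 1) θ - P i θ) := by
      intro θ η h
      have h' : θ ∈ arc δ I ↔ η ∈ arc δ I := by
        rw [mem_arc_iff, mem_arc_iff, node_eq_of_le δ (Nat.le_add_right _ _) h]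
      by_cases hθ : θ ∈ arc δ I
      · rw [indicator_of_mem hθ, indicator_of_mem (h'.1 hθ)]
        exact hPd i h
      · rw [indicator_of_notMem hθ, indicator_of_notMem fun hη => hθ (h'.2 hη)]
    have h := hwa.integral_mul_mono
      (fun θ => indicator_nonneg (fun θ _ => sub_nonneg.2 (maxDiff_mono δ b I.1 i θ)) θ)
      (hZa (i + 1)).integrable hvi fun θ hθ => ?_
    · simp_rw [← indicator_mul_left] at h
      rwa [integral_indicator (measurableSet_arc δ I),
        integral_indicator (measurableSet_arc δ I)] at h
    · have hθI : θ ∈ arc δ I := mem_of_indicator_ne_zero hθ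
      rw [mem_arc_iff] at hθI
      set J := node δ (I.1 + (i + 1)) θ with hJ
      rw [setIntegral_congr_fun (g := fun _ => ‖avg δ b J - avg δ b I‖) (measurableSet_arc δ J),
        setIntegral_arc_const, smul_eq_mul]
      · have h1 : (len J : ℂ) * (avg δ b J - avg δ b I) = ∫ η in arc δ J, (b η - avg δ b I) := by
          rw [integral_sub hb.integrable.integrableOn (integrable_const _), setIntegral_arc_const,
            ← len_mul_avg, mul_sub]
          simp
        have h2 : len J * ‖avg δ b J - avg δ b I‖ = ‖∫ η in arc δ J, (b η - avg δ b I)‖ := by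
          rw [← h1, norm_mul, Complex.norm_real, Real.norm_of_nonneg (len_pos J).le]
        rw [h2]
        exact norm_integral_le_integral_norm _
      · intro η hη
        rw [mem_arc_iff] at hη
        have hη' : node δ (I.1 + (i + 1)) η = node δ (I.1 + (i + 1)) θ := hη
        simp only [hZ]
        rw [hη', node_eq_of_le δ (Nat.le_add_right _ _) hη', hθI]
  have hsq : ∫ θ in arc δ I, P j θ ^ 2 ≤ 2 * ∫ θ in arc δ I, P j θ * v θ := by
    calc ∫ θ in arc δ I, P j θ ^ 2
        ≤ ∫ θ in arc δ I, 2 * ∑ i ∈ Finset.range j, (P (i + 1) θ - P i θ) * Z (i + 1) θ := by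
          refine setIntegral_mono (hP2 j).integrableOn ?_ fun θ => ?_
          · exact ((integrable_finsetSum _ fun i _ =>
              (hPd i).integrable_mul (hZa (i + 1)).integrable).const_mul 2).integrableOn
          · exact partialSups_sq_le (fun i => norm_nonneg _) (by simp) j
      _ = 2 * ∑ i ∈ Finset.range j, ∫ θ in arc δ I, (P (i + 1) θ - P i θ) * Z (i + 1) θ := by
          rw [integral_const_mul, integral_finsetSum _ fun i _ =>
            ((hPd i).integrable_mul (hZa (i + 1)).integrable).integrableOn]
      _ ≤ 2 * ∑ i ∈ Finset.range j, ∫ θ in arc δ I, (P (i + 1) θ - P i θ) * v θ := by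
          exact mul_le_mul_of_nonneg_left (Finset.sum_le_sum fun i _ => hstep i) (by norm_num)
      _ = 2 * ∫ θ in arc δ I, P j θ * v θ := by
          rw [← integral_finsetSum _ fun i _ => ((hPd i).integrable_mul hvi).integrableOn]
          congr 2
          ext θ
          rw [← Finset.sum_mul, Finset.sum_range_sub (fun i => P i θ), hP00, sub_zero]
  have hsq2 : ∫ θ in arc δ I, P j θ ^ 2 ≤ 4 * (B ^ 2 * len I) := by
    have h1 : 2 * ∫ θ in arc δ I, P j θ * v θ ≤
        ∫ θ in arc δ I, (1 / 2 * P j θ ^ 2 + 2 * v θ ^ 2) := by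
      rw [← integral_const_mul]
      refine setIntegral_mono (((hPa j).integrable_mul hvi).const_mul 2).integrableOn
        (((hP2 j).const_mul _).add (hv2.const_mul _)).integrableOn fun θ => ?_
      nlinarith [sq_nonneg (P j θ - 2 * v θ)]
    rw [integral_add ((hP2 j).const_mul _).integrableOn (hv2.const_mul _).integrableOn,
      integral_const_mul, integral_const_mul] at h1
    have h2 : ∫ θ in arc δ I, v θ ^ 2 ≤ B ^ 2 * len I := hb.var_le I
    linarith
  calc ∫ θ in arc δ I, P j θ ≤ ∫ θ in arc δ I, ((4 * B)⁻¹ * P j θ ^ 2 + B) := by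
        refine setIntegral_mono (hPi j).integrableOn
          (((hP2 j).const_mul _).add (integrable_const _)).integrableOn fun θ => ?_
        have h1 : (4 * B)⁻¹ * P j θ ^ 2 + B - P j θ = (4 * B)⁻¹ * (P j θ - 2 * B) ^ 2 := by
          field_simp; ring
        have h2 : 0 ≤ (4 * B)⁻¹ * (P j θ - 2 * B) ^ 2 := by positivity
        simp only
        linarith
    _ = (4 * B)⁻¹ * (∫ θ in arc δ I, P j θ ^ 2) + len I * B := by
        rw [integral_add ((hP2 j).const_mul _).integrableOn (integrable_const _),
          integral_const_mul, setIntegral_arc_const, smul_eq_mul]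
    _ ≤ (4 * B)⁻¹ * (4 * (B ^ 2 * len I)) + len I * B := by gcongr
    _ = 2 * B * len I := by field_simp; ring

/-- The maximal function of the mean values over the generations up to `n`, divided by `B`. -/
noncomputable def maxAvg (δ B : ℝ) (b : Circ → ℂ) (n : ℕ) (θ : Circ) : ℝ :=
  partialSups (fun k => ‖avg δ b (node δ k θ)‖ / B) n

lemma maxAvg_mono (δ B : ℝ) (b : Circ → ℂ) (θ : Circ) : Monotone fun n => maxAvg δ B b n θ :=
  partialSups_monotone fun k => ‖avg δ b (node δ k θ)‖ / B

lemma adapted_maxAvg (δ B : ℝ) (b : Circ → ℂ) (n : ℕ) : Adapted δ n (maxAvg δ B b n) := by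
  have h := adapted_partialSups (δ := δ) (n := 0)
    (Z := fun k θ => ‖avg δ b (node δ k θ)‖ / B) (fun j => by
      rw [zero_add]; exact adapted_node δ j fun I => ‖avg δ b I‖ / B) n
  rwa [zero_add] at h

lemma maxAvg_zero_le {δ B : ℝ} {b : Circ → ℂ} (hb : IsBMO δ B b) (θ : Circ) :
    maxAvg δ B b 0 θ ≤ 1 := by
  simp only [maxAvg, partialSups_zero, node_zero]
  exact (div_le_one hb.pos).2 hb.norm_avg_root_le

lemma maxAvg_nonneg {δ B : ℝ} {b : Circ → ℂ} (hb : IsBMO δ B b) (n : ℕ) (θ : Circ) :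
    0 ≤ maxAvg δ B b n θ :=
  (div_nonneg (norm_nonneg _) hb.pos.le).trans
    (le_partialSups (fun k => ‖avg δ b (node δ k θ)‖ / B) n)

lemma maxAvg_succ_sub_le {δ B : ℝ} {b : Circ → ℂ} (hb : IsBMO δ B b) (n : ℕ) (θ : Circ) :
    maxAvg δ B b (n + 1) θ - maxAvg δ B b n θ ≤ 1 := by
  have hB := hb.pos
  have h1 : ‖avg δ b (node δ n θ)‖ / B ≤ maxAvg δ B b n θ :=
    le_partialSups (fun k => ‖avg δ b (node δ k θ)‖ / B) n
  have h2 : ‖avg δ b (node δ (n + 1) θ)‖ / B ≤ ‖avg δ b (node δ n θ)‖ / B + 1 := by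
    rw [div_add_one hB.ne']
    have h3 := norm_le_norm_add_norm_sub' (avg δ b (node δ (n + 1) θ)) (avg δ b (node δ n θ))
    have h4 := hb.norm_avg_succ_sub_le n θ
    gcongr
    linarith
  have h5 : maxAvg δ B b (n + 1) θ ≤ maxAvg δ B b n θ + 1 := by
    simp only [maxAvg] at h1 ⊢
    rw [partialSups_add_one]
    exact sup_le (by linarith) (by linarith)
  linarith

lemma maxAvg_sub_le {δ B : ℝ} {b : Circ → ℂ} (hB : 0 < B) (n j : ℕ) (θ : Circ) :
    maxAvg δ B b (n + j) θ - maxAvg δ B b n θ ≤ B⁻¹ * maxDiff δ b n j θ := by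
  rw [sub_le_iff_le_add', maxAvg]
  have h0 : 0 ≤ B⁻¹ * maxDiff δ b n j θ := by
    refine mul_nonneg (by positivity) ((norm_nonneg _).trans (le_partialSups
      (fun i => ‖avg δ b (node δ (n + i) θ) - avg δ b (node δ n θ)‖) j))
  refine partialSups_le _ _ _ fun k hk => ?_
  rcases le_total k n with h | h
  · have h1 : ‖avg δ b (node δ k θ)‖ / B ≤ maxAvg δ B b n θ :=
      le_partialSups_of_le (fun k => ‖avg δ b (node δ k θ)‖ / B) h
    linarith
  · obtain ⟨i, rfl⟩ := Nat.exists_eq_add_of_le h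
    have h1 : ‖avg δ b (node δ n θ)‖ / B ≤ maxAvg δ B b n θ :=
      le_partialSups (fun k => ‖avg δ b (node δ k θ)‖ / B) n
    have h2 : ‖avg δ b (node δ (n + i) θ) - avg δ b (node δ n θ)‖ ≤ maxDiff δ b n j θ :=
      le_partialSups_of_le
        (fun i => ‖avg δ b (node δ (n + i) θ) - avg δ b (node δ n θ)‖) (by omega : i ≤ j)
    have h3 := norm_le_norm_add_norm_sub' (avg δ b (node δ (n + i) θ)) (avg δ b (node δ n θ))
    have h4 : ‖avg δ b (node δ (n + i) θ)‖ / B ≤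
        (‖avg δ b (node δ n θ)‖ + maxDiff δ b n j θ) / B := by
      gcongr; linarith
    rw [add_div] at h4
    rw [inv_mul_eq_div]
    linarith

/-- The exponential integrability of the maximal function. The increments of the maximal function
have conditional tails at most `2`, and summation by parts bounds the exponential by itself with a
small factor. -/
lemma integral_exp_maxAvg_le {δ B : ℝ} {b : Circ → ℂ} (hb : IsBMO δ B b) (N : ℕ) :
    ∫ θ, Real.exp (1 / 20 * maxAvg δ B b N θ) ≤ 3 * Real.pi := by
  have hB := hb.pos
  set M : ℕ → Circ → ℝ := maxAvg δ B b with hM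
  set w : ℕ → Circ → ℝ := fun n θ => Real.exp (1 / 20 * M n θ) with hw
  have hMa : ∀ n, Adapted δ n (M n) := adapted_maxAvg δ B b
  have hwa : ∀ n, Adapted δ n (w n) := fun n θ η h => by simp only [hw]; rw [hMa n h]
  have hwi : ∀ n, Integrable (w n) (volume : Measure Circ) := fun n => (hwa n).integrable
  have hwmono : ∀ n θ, w n θ ≤ w (n + 1) θ := fun n θ =>
    Real.exp_le_exp.2 (mul_le_mul_of_nonneg_left (maxAvg_mono δ B b θ n.le_succ) (by norm_num))
  have hβi : ∀ k, Integrable (fun θ => M (k + 1) θ - M k θ) (volume : Measure Circ) := fun k =>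
    (hMa (k + 1)).integrable.sub (hMa k).integrable
  -- The factor `1 / 20` is small enough for the last term of `hmain` to be absorbed on the left.
  have hexp : Real.exp (1 / 20) ≤ 20 / 19 := by
    have := Real.exp_bound_div_one_sub_of_interval (x := 1 / 20) (by norm_num) (by norm_num)
    norm_num at this ⊢
    exact this
  have hcar : ∫ θ, ∑ k ∈ Finset.range (N + 1), (M (k + 1) θ - M k θ) * w k θ ≤
      2 * ∫ θ, w N θ := by
    refine integral_sum_mul_le (δ := δ) (β := fun k θ => M (k + 1) θ - M k θ) hβi hwa
      (fun θ => (Real.exp_pos _).le) hwmono fun I hI => ?_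
    have h1 : ∀ θ, ∑ k ∈ Finset.Ico I.1 (N + 1), (M (k + 1) θ - M k θ) ≤
        B⁻¹ * maxDiff δ b I.1 (N + 1 - I.1) θ := fun θ => by
      rw [Finset.sum_Ico_sub (fun k => M k θ) (by omega)]
      have := maxAvg_sub_le (δ := δ) (b := b) hB I.1 (N + 1 - I.1) θ
      rwa [Nat.add_sub_cancel' (by omega)] at this
    calc _ ≤ ∫ θ in arc δ I, B⁻¹ * maxDiff δ b I.1 (N + 1 - I.1) θ :=
          setIntegral_mono (integrable_finsetSum _ fun k _ => hβi k).integrableOn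
            ((adapted_maxDiff δ b _ _).integrable.const_mul _).integrableOn h1
      _ ≤ B⁻¹ * (2 * B * len I) := by
          rw [integral_const_mul]
          exact mul_le_mul_of_nonneg_left (setIntegral_maxDiff_le hb I _) (by positivity)
      _ = 2 * len I := by field_simp
  have hpt : ∀ θ, w (N + 1) θ ≤ 20 / 19 + 1 / 19 *
      ∑ k ∈ Finset.range (N + 1), (M (k + 1) θ - M k θ) * w k θ := by
    intro θ
    have h1 : ∀ k, w (k + 1) θ - w k θ ≤ 1 / 19 * ((M (k + 1) θ - M k θ) * w k θ) := by
      intro k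
      set d := M (k + 1) θ - M k θ with hd
      have hd0 : 0 ≤ d := sub_nonneg.2 (maxAvg_mono δ B b θ k.le_succ)
      have hd1 : d ≤ 1 := maxAvg_succ_sub_le hb k θ
      have h2 : w (k + 1) θ = w k θ * Real.exp (1 / 20 * d) := by
        simp only [hw, hd, ← Real.exp_add]
        congr 1; ring
      have h3 : Real.exp (1 / 20 * d) - 1 ≤ 1 / 19 * d := by
        have h4 := Real.exp_bound_div_one_sub_of_interval (x := 1 / 20 * d) (by positivity)
          (by linarith)
        have h5 : 1 / (1 - 1 / 20 * d) - 1 ≤ 1 / 19 * d := by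
          have : 0 < 1 - 1 / 20 * d := by linarith
          rw [div_sub_one this.ne', div_le_iff₀ this]
          nlinarith
        linarith
      have h6 : 0 ≤ w k θ := (Real.exp_pos _).le
      rw [h2]
      nlinarith
    have h2 : w (N + 1) θ = w 0 θ + ∑ k ∈ Finset.range (N + 1), (w (k + 1) θ - w k θ) := by
      rw [Finset.sum_range_sub (fun k => w k θ)]; ring
    have h3 : w 0 θ ≤ 20 / 19 := by
      refine le_trans (Real.exp_le_exp.2 ?_) hexp
      have := maxAvg_zero_le hb θ
      linarith
    rw [h2, Finset.mul_sum]
    exact add_le_add h3 (Finset.sum_le_sum fun k _ => h1 k)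
  have hmain : ∫ θ, w (N + 1) θ ≤ 20 / 19 * (2 * Real.pi) + 1 / 19 * (2 * ∫ θ, w N θ) := by
    have hi : Integrable (fun θ => ∑ k ∈ Finset.range (N + 1), (M (k + 1) θ - M k θ) * w k θ)
        (volume : Measure Circ) := integrable_finsetSum _ fun k _ =>
      ((hwa k).integrable_mul (hβi k)).congr (Eventually.of_forall fun θ => mul_comm _ _)
    calc _ ≤ ∫ θ, (20 / 19 + 1 / 19 *
          ∑ k ∈ Finset.range (N + 1), (M (k + 1) θ - M k θ) * w k θ) :=
          integral_mono (hwi _) ((integrable_const _).add (hi.const_mul _)) hpt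
      _ = 20 / 19 * (2 * Real.pi) + 1 / 19 *
          ∫ θ, ∑ k ∈ Finset.range (N + 1), (M (k + 1) θ - M k θ) * w k θ := by
          rw [integral_add (integrable_const _) (hi.const_mul _), integral_const_mul,
            integral_const]
          simp [Measure.real, AddCircle.measure_univ, Real.pi_pos.le, mul_comm]
      _ ≤ _ := by gcongr
  have hle : ∫ θ, w N θ ≤ ∫ θ, w (N + 1) θ := integral_mono (hwi N) (hwi (N + 1)) (hwmono N)
  change ∫ θ, w N θ ≤ _
  linarith [Real.pi_pos]

/-- The supremum over all generations of `e^{M/20} - 1`, where `M` is the maximal function. -/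
noncomputable def expMax (δ B : ℝ) (b : Circ → ℂ) (θ : Circ) : ℝ≥0∞ :=
  ⨆ n, ENNReal.ofReal (Real.exp (1 / 20 * maxAvg δ B b n θ) - 1)

lemma lintegral_expMax_le {δ B : ℝ} {b : Circ → ℂ} (hb : IsBMO δ B b) :
    ∫⁻ θ, expMax δ B b θ ≤ ENNReal.ofReal Real.pi := by
  have ha : ∀ n, Adapted δ n fun θ => Real.exp (1 / 20 * maxAvg δ B b n θ) - 1 :=
    fun n θ η h => by simp only [adapted_maxAvg δ B b n h]
  have he : ∀ n, Adapted δ n fun θ => Real.exp (1 / 20 * maxAvg δ B b n θ) :=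
    fun n θ η h => by simp only [adapted_maxAvg δ B b n h]
  unfold expMax
  rw [lintegral_iSup (fun n => (ha n).measurable.ennreal_ofReal)]
  · refine iSup_le fun n => ?_
    rw [← ofReal_integral_eq_lintegral_ofReal (ha n).integrable]
    · refine ENNReal.ofReal_le_ofReal ?_
      rw [integral_sub (he n).integrable (integrable_const _), integral_const]
      have := integral_exp_maxAvg_le hb n
      simp only [Measure.real, AddCircle.measure_univ, smul_eq_mul, mul_one]
      rw [ENNReal.toReal_ofReal Real.two_pi_pos.le]
      linarith
    · refine Eventually.of_forall fun θ => sub_nonneg.2 (Real.one_le_exp ?_)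
      exact mul_nonneg (by norm_num) (maxAvg_nonneg hb n θ)
  · intro m n hmn θ
    refine ENNReal.ofReal_le_ofReal (sub_le_sub_right (Real.exp_le_exp.2 ?_) _)
    exact mul_le_mul_of_nonneg_left (maxAvg_mono δ B b θ hmn) (by norm_num)

/-! ### The bound in `H^log` -/

/-- The generalized Hölder inequality for `Ψ₀`: either `t ≤ log (e + y)`, and then
`y / log (e + y) ≤ s`, or `y < e^t - e`. -/
lemma Psi0_ofReal_le {y s t : ℝ} (hy : 0 ≤ y) (hs : 0 ≤ s) (h : y ≤ s * t) :
    Psi0 (ENNReal.ofReal y) ≤ ENNReal.ofReal s + ENNReal.ofReal (Real.exp t - 1) := by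
  have he : 1 ≤ Real.log (Real.exp 1 + y) := by
    rw [Real.le_log_iff_exp_le (by positivity)]; linarith
  rw [Psi0, if_neg ENNReal.ofReal_ne_top, ENNReal.toReal_ofReal hy]
  rcases le_total t (Real.log (Real.exp 1 + y)) with h1 | h1
  · refine le_trans (ENNReal.ofReal_le_ofReal ?_) le_self_add
    rw [div_le_iff₀ (by linarith)]
    exact h.trans (mul_le_mul_of_nonneg_left h1 hs)
  · refine le_trans (ENNReal.ofReal_le_ofReal ?_) le_add_self
    have h2 : Real.exp 1 + y ≤ Real.exp t := by
      rwa [Real.log_le_iff_le_exp (by positivity)] at h1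
    have h3 : y / Real.log (Real.exp 1 + y) ≤ y := div_le_self hy he
    have h4 : 1 ≤ Real.exp 1 := Real.one_le_exp (by norm_num)
    linarith

lemma squareFn_paraCoeff_le {δ B t : ℝ} (hB : 0 ≤ B) (ht : 0 ≤ t) {f b : Circ → ℂ} {θ : Circ}
    (h : ∀ k, ‖avg δ b (node δ k θ)‖ ≤ 20 * B * t) :
    squareFn δ ⟨0, paraCoeff δ f b⟩ θ ≤
      ENNReal.ofReal (20 * B * t) * squareFn δ (coeffs δ f) θ := by
  have ht' : 0 ≤ 20 * B * t := by positivity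
  rw [squareFn_eq, squareFn_eq, enorm_zero, zero_add]
  refine le_trans ?_ (mul_le_mul_right le_add_self _)
  have h1 : ENNReal.ofReal (20 * B * t) = (ENNReal.ofReal ((20 * B * t) ^ 2)) ^ (1 / 2 : ℝ) := by
    rw [← ofReal_sqrt_eq_rpow (by positivity), Real.sqrt_sq ht']
  rw [h1, ← ENNReal.mul_rpow_of_nonneg _ _ (by norm_num), ← ENNReal.tsum_mul_left]
  refine ENNReal.rpow_le_rpow (ENNReal.tsum_le_tsum fun k => ?_) (by norm_num)
  rw [← ENNReal.ofReal_mul (by positivity)]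
  refine ENNReal.ofReal_le_ofReal ?_
  simp only [sqTerm, paraCoeff, coeffs, norm_mul, mul_pow]
  have h2 := pow_le_pow_left₀ (norm_nonneg _) (h k) 2
  rw [mul_div_right_comm, mul_comm]
  have := len_pos (node δ k θ)
  rw [← mul_pow, ← mul_pow]
  gcongr

lemma Psi0_squareFn_le {δ B r : ℝ} (hr : 0 < r) {f : Circ → ℂ} {b : Circ → ℂ} (hb : IsBMO δ B b)
    (θ : Circ) : Psi0 (ENNReal.ofReal r⁻¹ * squareFn δ ⟨0, paraCoeff δ f b⟩ θ) ≤
      ENNReal.ofReal (20 * B / r) * squareFn δ (coeffs δ f) θ + expMax δ B b θ := by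
  have hB := hb.pos
  by_cases hS : squareFn δ (coeffs δ f) θ = ∞
  · rw [hS, ENNReal.mul_top (by simpa using by positivity), top_add]
    exact le_top
  by_cases hG : expMax δ B b θ = ∞
  · rw [hG, add_top]
    exact le_top
  set G := (expMax δ B b θ).toReal with hGdef
  have hG0 : 0 ≤ G := ENNReal.toReal_nonneg
  set t := Real.log (1 + G) with htdef
  have ht : 0 ≤ t := Real.log_nonneg (by linarith)
  have hexp : Real.exp t - 1 = G := by rw [htdef, Real.exp_log (by linarith)]; ring
  have havg : ∀ k, ‖avg δ b (node δ k θ)‖ ≤ 20 * B * t := by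
    intro k
    have h1 : ENNReal.ofReal (Real.exp (1 / 20 * maxAvg δ B b k θ) - 1) ≤ expMax δ B b θ :=
      le_iSup (fun n => ENNReal.ofReal (Real.exp (1 / 20 * maxAvg δ B b n θ) - 1)) k
    rw [ENNReal.ofReal_le_iff_le_toReal hG, ← hGdef, ← hexp, sub_le_sub_iff_right,
      Real.exp_le_exp] at h1
    have h2 : ‖avg δ b (node δ k θ)‖ / B ≤ maxAvg δ B b k θ :=
      le_partialSups (fun k => ‖avg δ b (node δ k θ)‖ / B) k
    rw [div_le_iff₀ hB] at h2
    nlinarith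
  set s := (squareFn δ (coeffs δ f) θ).toReal with hs
  have hs0 : 0 ≤ s := ENNReal.toReal_nonneg
  have hSs : squareFn δ (coeffs δ f) θ = ENNReal.ofReal s := (ENNReal.ofReal_toReal hS).symm
  have hle := squareFn_paraCoeff_le (f := f) hB.le ht havg
  rw [hSs, ← ENNReal.ofReal_mul (by positivity)] at hle
  have hfin : squareFn δ ⟨0, paraCoeff δ f b⟩ θ ≠ ∞ := (hle.trans_lt ENNReal.ofReal_lt_top).ne
  set y := (squareFn δ ⟨0, paraCoeff δ f b⟩ θ).toReal with hy
  have hy0 : 0 ≤ y := ENNReal.toReal_nonneg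
  have hYy : squareFn δ ⟨0, paraCoeff δ f b⟩ θ = ENNReal.ofReal y :=
    (ENNReal.ofReal_toReal hfin).symm
  rw [hYy, ENNReal.ofReal_le_ofReal_iff (by positivity)] at hle
  rw [hYy, hSs, ← ENNReal.ofReal_mul (by positivity), ← ENNReal.ofReal_mul (by positivity),
    ← ENNReal.ofReal_toReal hG, ← hGdef, ← hexp]
  refine Psi0_ofReal_le (by positivity) (by positivity) ?_
  calc r⁻¹ * y ≤ r⁻¹ * (20 * B * t * s) := by gcongr
    _ = 20 * B / r * s * t := by field_simp

lemma lintegral_Psi0_squareFn_le {δ B r : ℝ} (hr : 0 < r) {f : L1} {b : Circ → ℂ}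
    (hb : IsBMO δ B b) :
    ∫⁻ θ, Psi0 (ENNReal.ofReal r⁻¹ * squareFn δ ⟨0, paraCoeff δ f b⟩ θ) ≤
      ENNReal.ofReal (20 * B / r) * H1Norm δ f + ENNReal.ofReal Real.pi := by
  refine (lintegral_mono fun θ => Psi0_squareFn_le hr hb θ).trans ?_
  rw [lintegral_add_left ((measurable_squareFn δ _).const_mul _),
    lintegral_const_mul _ (measurable_squareFn δ _)]
  exact add_le_add le_rfl (lintegral_expMax_le hb)

lemma memhLog_paraCoeff {δ : ℝ} (f : H1 δ) (b : BMO δ) :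
    MemhLog δ ⟨0, paraCoeff δ f.1 b.1⟩ := by
  obtain ⟨B, hb⟩ := exists_isBMO b
  have h := lintegral_Psi0_squareFn_le (f := f.1) one_pos hb
  simp only [inv_one, ENNReal.ofReal_one, one_mul] at h
  refine h.trans_lt (ENNReal.add_lt_top.2 ⟨?_, ENNReal.ofReal_lt_top⟩)
  exact ENNReal.mul_lt_top ENNReal.ofReal_lt_top f.2

lemma hLogNorm_paraCoeff_le {δ H B : ℝ} (hH : 0 < H) {f : L1} {b : Circ → ℂ}
    (hf : H1Norm δ f ≤ ENNReal.ofReal H) (hb : IsBMO δ B b) :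
    hLogNorm δ ⟨0, paraCoeff δ f b⟩ ≤ ENNReal.ofReal (20 * H * B) := by
  have hB := hb.pos
  -- With this value the square function of `f` contributes at most `1`, and `1 + π ≤ 2 π`.
  refine iInf₂_le (20 * H * B) ⟨by positivity, ?_⟩
  rw [mul_comm, ← div_eq_mul_inv]
  refine ENNReal.div_le_of_le_mul ?_
  rw [one_mul]
  refine (lintegral_Psi0_squareFn_le (by positivity) hb).trans ?_
  calc _ ≤ ENNReal.ofReal (20 * B / (20 * H * B)) * ENNReal.ofReal H +
        ENNReal.ofReal Real.pi := by gcongr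
    _ = ENNReal.ofReal (1 + Real.pi) := by
        rw [← ENNReal.ofReal_mul (by positivity), ← ENNReal.ofReal_add (by positivity)
          Real.pi_pos.le]
        congr 2
        field_simp
    _ ≤ ENNReal.ofReal (2 * Real.pi) :=
        ENNReal.ofReal_le_ofReal (by linarith [Real.pi_gt_three])

lemma HLogNorm_logPart_le {δ H B : ℝ} (hH : 0 < H) (f : H1 δ) (b : BMO δ)
    (hf : H1Norm δ f.1 ≤ ENNReal.ofReal H) (hb : IsBMO δ B b.1) :
    HLogNorm δ (logPart δ f b) ≤ ENNReal.ofReal (20 * H * B) :=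
  (iInf₂_le _ ⟨memhLog_paraCoeff f b, represents_logPart f b⟩).trans
    (hLogNorm_paraCoeff_le hH hf hb)

lemma logPart_mem_HLog {δ : ℝ} (f : H1 δ) (b : BMO δ) : logPart δ f b ∈ HLog δ :=
  ⟨_, memhLog_paraCoeff f b, represents_logPart f b⟩

/-- A bound by `C H B` for all positive real `H ≥ x` and `B ≥ y` gives the bound by `C x y`. Strictly
positive majorants avoid dividing by norms that vanish. -/
lemma le_mul_mul_of_forall_ofReal {C : ℝ≥0} {x y z : ℝ≥0∞} (hx : x ≠ ∞) (hy : y ≠ ∞)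
    (h : ∀ H B : ℝ, 0 < H → 0 < B → x ≤ ENNReal.ofReal H → y ≤ ENNReal.ofReal B →
      z ≤ ENNReal.ofReal (C * H * B)) : z ≤ C * x * y := by
  have hlim : Tendsto (fun ε : ℝ => ENNReal.ofReal (C * (x.toReal + ε) * (y.toReal + ε)))
      (𝓝[>] 0) (𝓝 (ENNReal.ofReal (C * (x.toReal + 0) * (y.toReal + 0)))) := by
    refine (ENNReal.continuous_ofReal.tendsto _).comp (Tendsto.mono_left ?_ nhdsWithin_le_nhds)
    exact Continuous.tendsto (by fun_prop) 0
  have hz : ENNReal.ofReal (C * (x.toReal + 0) * (y.toReal + 0)) = C * x * y := by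
    rw [add_zero, add_zero, ENNReal.ofReal_mul (by positivity), ENNReal.ofReal_mul (by positivity),
      ENNReal.ofReal_toReal hx, ENNReal.ofReal_toReal hy, ENNReal.ofReal_coe_nnreal]
  rw [← hz]
  refine ge_of_tendsto hlim ?_
  filter_upwards [self_mem_nhdsWithin] with ε (hε : 0 < ε)
  have hle : ∀ w : ℝ≥0∞, w ≠ ∞ → w ≤ ENNReal.ofReal (w.toReal + ε) := fun w hw =>
    ENNReal.le_ofReal_iff_toReal_le hw (by positivity) |>.2 (by linarith)
  exact h _ _ (by positivity) (by positivity) (hle x hx) (hle y hy)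

/-! ### Finite Haar expansions -/

lemma dist_le_len {δ : ℝ} {I : Idx} {θ η : Circ} (hθ : θ ∈ arc δ I) (hη : η ∈ arc δ I) :
    dist θ η ≤ len I := by
  obtain ⟨x, y, rfl, rfl, hxy⟩ := exists_lifts_of_mem_arc hθ hη
  rw [dist_eq_norm]
  exact (QuotientAddGroup.norm_mk_le_norm (S := AddSubgroup.zmultiples (2 * Real.pi))
    (m := x - y)).trans hxy

/-- An integrable function whose integral over every short dyadic arc vanishes is zero: a closed
set is the limit of the unions of the arcs of generation `k` that meet it. -/
lemma ae_eq_zero_of_setIntegral_arc_eq_zero {δ : ℝ} {g : Circ → ℂ}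
    (hg : Integrable g (volume : Measure Circ)) (N : ℕ)
    (h : ∀ I : Idx, N ≤ I.1 → ∫ θ in arc δ I, g θ = 0) : g =ᵐ[volume] 0 := by
  refine ae_eq_zero_of_forall_setIntegral_isClosed_eq_zero hg fun K hK => ?_
  classical
  set U : ℕ → Set Circ := fun k => {θ | (arc δ (node δ k θ) ∩ K).Nonempty} with hU
  set F : ℕ → Circ → ℂ := fun k θ => (if θ ∈ U k then 1 else 0) * g θ with hF
  have hUa : ∀ k, Adapted δ k fun θ => if θ ∈ U k then (1 : ℂ) else 0 := fun k θ η hθ => by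
    simp only [hU, mem_ofPred_eq]
    rw [hθ]
  have hFi : ∀ k, Integrable (F k) (volume : Measure Circ) := fun k =>
    (hUa k).integrable_mul hg
  have hzero : ∀ k, N ≤ k → ∫ θ, F k θ = 0 := by
    intro k hk
    rw [integral_eq_sum_arc δ k (hFi k)]
    refine Finset.sum_eq_zero fun m _ => ?_
    obtain ⟨η, hη⟩ := exists_node_eq δ ⟨k, m⟩
    rw [setIntegral_congr_fun (g := fun θ => (if η ∈ U k then 1 else 0) * g θ)
      (measurableSet_arc δ _), integral_const_mul, h _ hk, mul_zero]
    intro θ hθ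
    have h1 := (mem_arc_iff δ _ θ).1 hθ
    exact congrArg (· * g θ) (hUa k (h1.trans hη.symm))
  have hlen : ∀ θ : Circ, Tendsto (fun k => len (node δ k θ)) atTop (𝓝 0) := fun θ => by
    have := (tendsto_pow_atTop_nhds_zero_of_lt_one (r := (1 / 2 : ℝ)) (by norm_num)
      (by norm_num)).const_mul (2 * Real.pi)
    rw [mul_zero] at this
    refine this.congr fun k => ?_
    rw [len, node_fst, one_div, inv_pow, div_eq_mul_inv]
  have hlim : ∀ θ, Tendsto (fun k => F k θ) atTop (𝓝 (K.indicator g θ)) := by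
    intro θ
    by_cases hθ : θ ∈ K
    · refine tendsto_const_nhds.congr fun k => ?_
      have : θ ∈ U k := ⟨θ, mem_arc_node δ k θ, hθ⟩
      simp [hF, this, hθ]
    · obtain ⟨ε, hε, hball⟩ := Metric.isOpen_iff.1 hK.isOpen_compl θ hθ
      refine tendsto_const_nhds.congr' ?_
      filter_upwards [(hlen θ).eventually_lt_const hε] with k hk
      have : θ ∉ U k := by
        rintro ⟨η, h1, h2⟩
        exact hball (Metric.mem_ball.2 ((dist_le_len h1 (mem_arc_node δ k θ)).trans_lt hk)) h2
      simp [hF, this, hθ]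
  have hdom := tendsto_integral_of_dominated_convergence (μ := (volume : Measure Circ))
    (fun θ => ‖g θ‖) (fun k => (hFi k).aestronglyMeasurable) hg.norm
    (fun k => Eventually.of_forall fun θ => by
      simp only [hF]
      split_ifs <;> simp) (Eventually.of_forall hlim)
  rw [← integral_indicator hK.measurableSet]
  refine tendsto_nhds_unique hdom (tendsto_const_nhds.congr' ?_)
  filter_upwards [eventually_ge_atTop N] with k hk
  exact (hzero k hk).symm

lemma exists_generation_bound {δ : ℝ} {f : L1} (hf : FiniteHaar δ f) :
    ∃ N, ∀ I : Idx, N ≤ I.1 → coeff δ f I = 0 := by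
  obtain ⟨N, hN⟩ := (hf.2.image Sigma.fst).bddAbove
  refine ⟨N + 1, fun I hI => ?_⟩
  by_contra h
  have := hN (mem_image_of_mem _ h)
  omega

lemma avg_root_eq_mean (δ : ℝ) (b : Circ → ℂ) : avg δ b root = mean b := by
  rw [avg, arc_root, Measure.restrict_univ, len_root, mean]
  push_cast
  rfl

/-- The contribution `c_I h_I(θ)` of generation `k` to a Haar series. -/
noncomputable def diff (δ : ℝ) (c : Idx → ℂ) (k : ℕ) (θ : Circ) : ℂ :=
  c (node δ k θ) * (haar δ (node δ k θ) θ : ℂ)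

lemma avg_node_eq_sum {δ : ℝ} {b : Circ → ℂ} (hb : Integrable b (volume : Measure Circ))
    (h0 : mean b = 0) (k : ℕ) (θ : Circ) :
    avg δ b (node δ k θ) = ∑ j ∈ Finset.range k, diff δ (coeff δ b) j θ := by
  induction k with
  | zero => simp [node_zero, avg_root_eq_mean, h0]
  | succ k ih => rw [avg_node_succ δ hb, ih, Finset.sum_range_succ, diff]

lemma ae_eq_sum_diff {δ : ℝ} {b : L1} (h0 : mean b = 0) {N : ℕ}
    (hN : ∀ I : Idx, N ≤ I.1 → coeff δ b I = 0) :
    ∀ᵐ θ : Circ, b θ = ∑ j ∈ Finset.range N, diff δ (coeff δ b) j θ := by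
  have hbi : Integrable b (volume : Measure Circ) := L1.integrable_coeFn b
  have hX : ∀ k, N ≤ k → ∀ θ, avg δ b (node δ k θ) = avg δ b (node δ N θ) := by
    intro k hk θ
    induction k, hk using Nat.le_induction with
    | base => rfl
    | succ k hk ih => rw [avg_node_succ δ hbi, ih, hN _ hk, zero_mul, add_zero]
  have hXi : Integrable (fun θ => avg δ b (node δ N θ)) (volume : Measure Circ) :=
    (adapted_node δ N (avg δ b)).integrable
  have h := ae_eq_zero_of_setIntegral_arc_eq_zero (δ := δ)
    (g := fun θ => b θ - avg δ b (node δ N θ)) (hbi.sub hXi) N fun I hI => by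
      rw [integral_sub hbi.integrableOn hXi.integrableOn,
        setIntegral_congr_fun (f := fun θ => avg δ b (node δ N θ)) (g := fun _ => avg δ b I)
        (measurableSet_arc δ I), setIntegral_arc_const, ← len_mul_avg]
      · simp
      · intro θ hθ
        simp only
        rw [← hX I.1 hI θ, (mem_arc_iff δ I θ).1 hθ]
  filter_upwards [h] with θ hθ
  rw [← avg_node_eq_sum hbi h0]
  exact sub_eq_zero.1 hθ

lemma arc_node_ssubset_iff (δ : ℝ) (k j : ℕ) (θ : Circ) :
    arc δ (node δ j θ) ⊂ arc δ (node δ k θ) ↔ k < j := by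
  have hsub : ∀ {k j : ℕ}, k ≤ j → arc δ (node δ j θ) ⊆ arc δ (node δ k θ) := fun h η hη => by
    rw [mem_arc_iff] at hη ⊢
    exact node_eq_of_le δ h hη
  constructor
  · intro h
    by_contra hkj
    exact h.2 (hsub (not_lt.1 hkj))
  · intro h
    refine ⟨hsub h.le, fun h' => ?_⟩
    have h1 := measure_mono (μ := (volume : Measure Circ)) h'
    rw [volume_arc, volume_arc, ENNReal.ofReal_le_ofReal_iff (len_pos _).le] at h1
    simp only [len, node_fst] at h1
    rw [div_le_div_iff_of_pos_left Real.two_pi_pos (by positivity) (by positivity)] at h1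
    exact absurd h1 (not_le.2 (pow_lt_pow_right₀ (by norm_num) h))

lemma arc_node_eq_iff (δ : ℝ) (k j : ℕ) (θ : Circ) :
    arc δ (node δ k θ) = arc δ (node δ j θ) ↔ k = j := by
  constructor
  · intro h
    rcases lt_trichotomy k j with h1 | h1 | h1
    · exact absurd h.symm ((arc_node_ssubset_iff δ k j θ).2 h1).ne
    · exact h1
    · exact absurd h ((arc_node_ssubset_iff δ j k θ).2 h1).ne
  · rintro rfl
    rfl

/-- At a point only the arcs that contain it contribute to a paraproduct, which is thus a double
sum over generations. -/
lemma finsum_prodTerm_eq {δ : ℝ} {f b : L1} {N : ℕ}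
    (hf : ∀ I : Idx, N ≤ I.1 → coeff δ f I = 0) (hb : ∀ I : Idx, N ≤ I.1 → coeff δ b I = 0)
    (θ : Circ) (s : Set (Idx × Idx)) (R : ℕ → ℕ → Prop) [∀ k j, Decidable (R k j)]
    (hR : ∀ k j, (node δ k θ, node δ j θ) ∈ s ↔ R k j) :
    ∑ᶠ p ∈ s, prodTerm δ f b θ p = ∑ k ∈ Finset.range N, ∑ j ∈ Finset.range N,
      if R k j then diff δ (coeff δ f) k θ * diff δ (coeff δ b) j θ else 0 := by
  classical
  set e : ℕ × ℕ → Idx × Idx := fun q => (node δ q.1 θ, node δ q.2 θ) with he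
  have hinj : Function.Injective e := fun q q' h => by
    simp only [he, Prod.mk.injEq] at h
    exact Prod.ext (congrArg Sigma.fst h.1) (congrArg Sigma.fst h.2)
  rw [finsum_mem_def, finsum_eq_sum_of_support_subset
    (s := (Finset.range N ×ˢ Finset.range N).image e), Finset.sum_image hinj.injOn,
    Finset.sum_product]
  · refine Finset.sum_congr rfl fun k _ => Finset.sum_congr rfl fun j _ => ?_
    rw [indicator_apply]
    simp only [he, hR, prodTerm, diff]
    congr 1
    ring
  · rintro ⟨I, J⟩ hp
    have h1 : prodTerm δ f b θ (I, J) ≠ 0 := fun h0 => hp (by rw [indicator_apply, h0, ite_self])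
    simp only [prodTerm, ne_eq, mul_eq_zero, not_or, Complex.ofReal_eq_zero] at h1
    obtain ⟨⟨⟨h2, h3⟩, h4⟩, h5⟩ := h1
    have h6 : node δ I.1 θ = I := by
      rw [← mem_arc_iff]
      exact not_imp_comm.1 (haar_of_notMem δ) h4
    have h7 : node δ J.1 θ = J := by
      rw [← mem_arc_iff]
      exact not_imp_comm.1 (haar_of_notMem δ) h5
    simp only [Finset.coe_image, mem_image, Finset.mem_coe, Finset.mem_product,
      Finset.mem_range]
    refine ⟨(I.1, J.1), ⟨?_, ?_⟩, by simp only [he, h6, h7]⟩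
    · exact not_le.1 fun h => h2 (hf I h)
    · exact not_le.1 fun h => h3 (hb J h)

lemma sum_range_eq_sum_ite {k N : ℕ} (h : k ≤ N) (u : ℕ → ℂ) :
    ∑ j ∈ Finset.range k, u j = ∑ j ∈ Finset.range N, if j < k then u j else 0 := by
  rw [← Finset.sum_filter]
  congr 1
  ext j
  simp only [Finset.mem_range, Finset.mem_filter]
  omega

lemma boundedPart_of_finiteHaar {δ : ℝ} (f : H1 δ) (b : BMO δ) (hf : FiniteHaar δ f.1)
    (hb : FiniteHaar δ b.1) :
    ∀ᵐ θ : Circ, boundedPart δ f b θ = Pi2 δ f.1 b.1 θ + Pi3 δ f.1 b.1 θ := by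
  obtain ⟨N₁, hN₁⟩ := exists_generation_bound hf
  obtain ⟨N₂, hN₂⟩ := exists_generation_bound hb
  set N := max N₁ N₂
  have hfN : ∀ I : Idx, N ≤ I.1 → coeff δ f.1 I = 0 := fun I h => hN₁ I (le_of_max_le_left h)
  have hbN : ∀ I : Idx, N ≤ I.1 → coeff δ b.1 I = 0 := fun I h => hN₂ I (le_of_max_le_right h)
  have hbi : Integrable b.1 (volume : Measure Circ) := L1.integrable_coeFn b.1
  have hsum : boundedPart δ f b = ∑ k ∈ Finset.range N, blockL1 δ f.1 b.1 k := by
    rw [boundedPart_apply, hf.1, zero_smul, zero_add]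
    refine tsum_eq_sum fun k hk => ?_
    refine Lp.ext ?_
    filter_upwards [blockL1_coe δ f.1 b.1 k, Lp.coeFn_zero ℂ 1 (volume : Measure Circ)] with θ h1 h2
    rw [h1, h2, block, hfN _ (by simpa using hk)]
    simp
  rw [hsum]
  filter_upwards [sum_blockL1_coe δ f.1 b.1 (Finset.range N), ae_eq_sum_diff hb.1 hbN]
    with θ h1 h2
  rw [h1, Pi2, Pi3, finsum_prodTerm_eq hfN hbN θ _ (fun k j => k < j) fun k j =>
    arc_node_ssubset_iff δ k j θ, finsum_prodTerm_eq hfN hbN θ _ (fun k j => k = j) fun k j =>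
    arc_node_eq_iff δ k j θ, ← Finset.sum_add_distrib]
  refine Finset.sum_congr rfl fun k hk => ?_
  rw [block, h2, avg_node_eq_sum hbi hb.1, sum_range_eq_sum_ite (Finset.mem_range.1 hk).le,
    ← Finset.sum_sub_distrib, ← Finset.sum_add_distrib, Finset.mul_sum]
  refine Finset.sum_congr rfl fun j _ => ?_
  rw [← diff]
  rcases lt_trichotomy k j with h | rfl | h
  · simp [h, h.ne, h.not_gt]
  · simp
  · simp [h, h.ne', h.not_gt]

lemma partialSum_eq_sum_diff (δ : ℝ) (c : Coeffs) (N : ℕ) (θ : Circ) :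
    partialSum δ c N θ = c.zero + ∑ k ∈ Finset.range N, diff δ c.coef k θ := by
  rw [partialSum]
  congr 1
  refine Finset.sum_congr rfl fun k _ => ?_
  have h := sum_indicator_arc δ k (fun I η => c.coef I * (haar δ I η : ℂ)) θ
  rw [diff, ← h]
  refine Finset.sum_congr rfl fun m _ => ?_
  by_cases hm : θ ∈ arc δ ⟨k, m⟩
  · rw [indicator_of_mem hm]
  · rw [indicator_of_notMem hm, haar_of_notMem δ hm]
    simp

lemma logPart_of_finiteHaar {δ : ℝ} (f : H1 δ) (b : BMO δ) (hf : FiniteHaar δ f.1)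
    (hb : FiniteHaar δ b.1) (φ : TestFn) :
    (logPart δ f b).1 φ = ∫ θ, Pi1 δ f.1 b.1 θ * φ.1 θ := by
  obtain ⟨N₁, hN₁⟩ := exists_generation_bound hf
  obtain ⟨N₂, hN₂⟩ := exists_generation_bound hb
  have hbi : Integrable b.1 (volume : Measure Circ) := L1.integrable_coeFn b.1
  refine tendsto_nhds_unique (represents_logPart f b φ) (tendsto_const_nhds.congr' ?_)
  filter_upwards [eventually_ge_atTop (max N₁ N₂)] with N hN
  congr 1
  ext θ
  congr 1
  rw [Pi1, finsum_prodTerm_eq (fun I h => hN₁ I (le_trans (le_of_max_le_left hN) h))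
    (fun I h => hN₂ I (le_trans (le_of_max_le_right hN) h)) θ _ (fun k j => j < k) fun k j =>
    arc_node_ssubset_iff δ j k θ, partialSum_eq_sum_diff, zero_add]
  refine Finset.sum_congr rfl fun k hk => ?_
  refine Eq.symm ?_
  change paraCoeff δ f.1 b.1 (node δ k θ) * (haar δ (node δ k θ) θ : ℂ) = _
  rw [paraCoeff, avg_node_eq_sum hbi hb.1, sum_range_eq_sum_ite (Finset.mem_range.1 hk).le,
    mul_right_comm, ← diff, Finset.mul_sum]
  refine Finset.sum_congr rfl fun j _ => ?_
  rw [mul_ite, mul_zero]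

end DyadicBGK

open DyadicBGK
theorem mainTheorem3 :
    ∃ C : ℝ≥0, ∀ δ : ℝ, 0 ≤ δ → δ < 1 →
      ∃ (S : H1 δ →ₗ[ℂ] BMO δ →ₗ[ℂ] L1) (T : H1 δ →ₗ[ℂ] BMO δ →ₗ[ℂ] Distr),
        (∀ (f : H1 δ) (b : BMO δ), IsProduct δ f.1 b.1 (ofL1 (S f b) + T f b)) ∧
        (∀ (f : H1 δ) (b : BMO δ), ‖S f b‖ₑ ≤ C * H1Norm δ f.1 * BMONorm δ b.1) ∧
        (∀ (f : H1 δ) (b : BMO δ), T f b ∈ HLog δ ∧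
          HLogNorm δ (T f b) ≤ C * H1Norm δ f.1 * BMONorm δ b.1) ∧
        (∀ (f : H1 δ) (b : BMO δ), FiniteHaar δ f.1 → FiniteHaar δ b.1 →
          (∀ᵐ θ : Circ, S f b θ = Pi2 δ f.1 b.1 θ + Pi3 δ f.1 b.1 θ) ∧
          (∀ φ : TestFn, (T f b).1 φ = ∫ θ, Pi1 δ f.1 b.1 θ * φ.1 θ)) := by
  refine ⟨20, fun δ _ _ => ⟨boundedPart δ, logPart δ, isProduct_boundedPart_add_logPart,
    fun f b => ?_, fun f b => ⟨logPart_mem_HLog f b, ?_⟩, fun f b hf hb =>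
    ⟨boundedPart_of_finiteHaar f b hf hb, logPart_of_finiteHaar f b hf hb⟩⟩⟩
  · refine le_mul_mul_of_forall_ofReal (ne_of_lt f.2) (ne_of_lt b.2) fun H B hH hB hf hb => ?_
    rw [← ofReal_norm]
    refine ENNReal.ofReal_le_ofReal ((norm_boundedPart_le hH.le f b hf
      (isBMO_of_BMONorm_le hB hb)).trans ?_)
    have : 0 < H * B := by positivity
    push_cast
    linarith
  · refine le_mul_mul_of_forall_ofReal (ne_of_lt f.2) (ne_of_lt b.2) fun H B hH hB hf hb => ?_
    exact HLogNorm_logPart_le hH f b hf (isBMO_of_BMONorm_le hB hb)
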